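/- **Problem.** Jobs $J_1,\dots,J_n$ with positive integer processing times $p_j$ and positive integer weights $w_j$ are given in WSPT order, $p_1/w_1\le\dots\le p_n/w_n$. The original schedule $\pi^*$ processes them in this order without idle time, so $C_j(\pi^*)=p_1+\dots+p_j$ and $S_j(\pi^*)=C_j(\pi^*)-p_j$. The single machine is unavailable during $[T_1,T_2]$, where $0\le T_1<T_2$ are integers; further data are an integer $k$ and a number $\mu\ge0$. A schedule $\sigma$ assigns to every job a starting time $S_j\ge0$ and $C_j=S_j+p_j$, such that jobs do not overlap and each job has $C_j\le T_1$ or $S_j\ge T_2$. Put $\Delta_{\max}=\max_j|C_j(\sigma)-C_j(\pi^*)|$. The problem $(1,h_1\mid\Delta_{\max}\le k\mid\mu\Delta_{\max}+\sum w_jC_j)$ asks to minimize $\mu\Delta_{\max}+\sum_j w_jC_j(\sigma)$ over the schedules with $\Delta_{\max}\le k$. Let $P=\sum p_j$, $W=\sum w_j$, $w_{\max}=\max w_j$, $p_{\min}=\min p_j$, and let $j_1$ be the least $j$ with $C_j(\pi^*)>T_1$. It is assumed that $p_{\min}\le T_1<P$ and $T_2-S_{j_1}(\pi^*)\le k$.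 **Algorithm $\mathrm{Approx}(a,\varepsilon)$ with bound $K$** (for $\mu=0$, job $J_a$ starting at $T_2$). Let $P_j=p_1+\dots+p_j$, let $Z_{i..j}(t)$ be the total weighted completion time of $J_i,\dots,J_j$ when processed in this order without idle time from time $t$ on, let $\delta=1+\varepsilon/(2n)$, and let $m$ be the maximum of $a$ and the largest $j$ with $C_j(\pi^*)-K\le T_1$. A quadruple $(j;\ell^1,\ell^2;Z)$ represents a partial schedule of $J_1,\dots,J_j$ with last completion times $\ell^1$ before and $\ell^2$ after the unavailable period and total weighted completion time $Z$. The intervals $[p_{\min},T_1]$, $[T_2+p_a,T_2+P]$ and $[Z_{1..a-1}(0)+w_a(T_2+p_a),\,Z_{1..n}(0)+WT_2]$ for $\ell^1,\ell^2,Z$ are split geometrically with ratio $\delta$ (with the additional interval $\{0\}$ for $\ell^1$), which gives three-dimensional boxes; for each $j\in\{a,\dots,m\}$, and once more for full schedules, every box holds at most one quadruple: of the quadruples that fall into the same box, one with smallest $\ell^1$. Start with $(a;P_{a-1},T_2+p_a;Z_{1..a-1}(0)+w_a(T_2+p_a))$. From each stored $(j;\ell^1,\ell^2;Z)$ with $j<m$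 generate 1. $(j+1;\ell^1,\ell^2+p_{j+1};Z+w_{j+1}(\ell^2+p_{j+1}))$; 2. if $\ell^1+p_{j+1}\le T_1$ and $C_{j+1}(\pi^*)-(\ell^1+p_{j+1})\le K$: $(j+1;\ell^1+p_{j+1},\ell^2;Z+w_{j+1}(\ell^1+p_{j+1}))$; 3. if $\ell^1+p_{j+1}<C_{j+1}(\pi^*)-K\le T_1$: the full schedule that processes $J_{j+1},\dots,J_m$ from time $C_{j+1}(\pi^*)-p_{j+1}-K$ on and $J_{m+1},\dots,J_n$ from time $\ell^2$ on. Each stored quadruple with $j=m$ is completed by processing $J_{m+1},\dots,J_n$ from time $\ell^2$ on. Among the stored full schedules, one with the smallest $Z$ is returned. **Algorithm $\mathrm{Approx}^\mu(\varepsilon)$.** For each $a\le j_1$ with $\Delta_a=T_2-S_a(\pi^*)\le k$, call $\mathrm{Approx}(a,\varepsilon)$ with the bounds $K=\Delta_a(1+\varepsilon)^i$, $1\le i\le\lfloor\log_{1+\varepsilon}(k/\Delta_a)\rfloor$, and with $K=k$. Return the schedule with the smallest value of $\mu\Delta_{\max}+\sum w_jC_j$ among those obtained. **Theorem 4.4.**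 For every $0<\varepsilon\le1$ and every instance as above, $\mathrm{Approx}^\mu(\varepsilon)$ returns a schedule that satisfies $\Delta_{\max}\le k$ and whose objective value is at most $(1+\varepsilon)$ times that of every schedule with $\Delta_{\max}\le k$. Counting each arithmetic operation, comparison, evaluation of $\lfloor\log_b x\rfloor$ or $\lceil\log_b x\rceil$, and memory access as one step, its running time is $$O\Bigl(\frac{n^5}{\varepsilon^4}\,\log T_1\,\log(T_2+P)\,\log(w_{\max}P+WT_2)\,\log k\Bigr)$$ with an absolute implied constant, where $\log x$ stands for $\max\{1,\log_2x\}$ (this matters only if $T_1=1$ or $k=1$). Hence it is a fully polynomial time approximation scheme. -/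

import Mathlib

/-! ### The rescheduling problem -/

/-- Data of the problem `(1, h₁ | Δ_max ≤ k | μ Δ_max + ∑ w_j C_j)`: jobs `0, …, n-1`, listed in
their original order, with processing times `p`, weights `w`, the machine being unavailable during
`[T₁, T₂]`, the bound `k` on the maximum time deviation and the balancing factor `μ`. -/
structure Resched where
  n : ℕ
  p : Fin n → ℕ
  w : Fin n → ℕ
  T₁ : ℕ
  T₂ : ℕ
  k : ℕ
  μ : ℝ

namespace Resched

/-- Completion time of job `j` in the original schedule `π*` (no idle time, order `0, …, n-1`). -/
def origC (I : Resched) (j : Fin I.n) : ℕ := ∑ i ∈ Finset.univ.filter (fun i => i ≤ j), I.p i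

/-- Starting time of job `j` in the original schedule `π*`. -/
def origS (I : Resched) (j : Fin I.n) : ℕ := ∑ i ∈ Finset.univ.filter (fun i => i < j), I.p i

/-- Total processing time. -/
def totalP (I : Resched) : ℕ := ∑ j, I.p j

/-- Total weight. -/
def totalW (I : Resched) : ℕ := ∑ j, I.w j

/-- Maximum weight. -/
def wMax (I : Resched) : ℕ := Finset.univ.sup I.w

/-- The standing assumptions on the data. -/
structure Valid (I : Resched) : Prop where
  p_pos : ∀ j, 0 < I.p j
  w_pos : ∀ j, 0 < I.w j
  /-- the jobs are in WSPT order: `p_i / w_i ≤ p_j / w_j` for `i ≤ j` -/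
  wspt : ∀ i j, i ≤ j → (I.p i : ℚ) / I.w i ≤ (I.p j : ℚ) / I.w j
  T_lt : I.T₁ < I.T₂
  μ_nonneg : 0 ≤ I.μ
  /-- `p_min ≤ T₁` -/
  pmin_le : ∃ j, I.p j ≤ I.T₁
  /-- `T₁ < P` -/
  T₁_lt : I.T₁ < I.totalP
  /-- `T₂ - S_{j₁}(π*) ≤ k`, where `j₁` is the first job completed after `T₁` in `π*` -/
  k_ge : ∀ j₁, IsLeast {j | I.T₁ < I.origC j} j₁ → I.T₂ ≤ I.origS j₁ + I.k

/-- Completion time of job `j` in the schedule with starting times `σ`. -/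
def compl (I : Resched) (σ : Fin I.n → ℝ) (j : Fin I.n) : ℝ := σ j + I.p j

/-- Time deviation of job `j`. -/
def dev (I : Resched) (σ : Fin I.n → ℝ) (j : Fin I.n) : ℝ := |I.compl σ j - I.origC j|

/-- Maximum time deviation. -/
noncomputable def devMax (I : Resched) (σ : Fin I.n → ℝ) : ℝ := ⨆ j, I.dev σ j

/-- Feasible schedules, given by their (real) starting times: jobs are processed without
preemption, one at a time, never during `[T₁, T₂]`, and the maximum time deviation is at
most `k`. -/
structure Feasible (I : Resched) (σ : Fin I.n → ℝ) : Prop where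
  start_nonneg : ∀ j, 0 ≤ σ j
  disjoint : ∀ i j, i ≠ j → I.compl σ i ≤ σ j ∨ I.compl σ j ≤ σ i
  avoids : ∀ j, I.compl σ j ≤ I.T₁ ∨ (I.T₂ : ℝ) ≤ σ j
  devMax_le : I.devMax σ ≤ I.k

/-- The objective function `μ Δ_max + ∑ w_j C_j`. -/
noncomputable def objective (I : Resched) (σ : Fin I.n → ℝ) : ℝ :=
  I.μ * I.devMax σ + ∑ j, (I.w j : ℝ) * I.compl σ j

end Resched

/-! ### Unit-cost computations -/

/-- A computation with result `val` that takes `time` elementary steps. -/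
structure Timed (α : Type) where
  val : α
  time : ℕ

namespace Timed

instance instMonadTimed : Monad Timed where
  pure a := ⟨a, 0⟩
  bind x f := ⟨(f x.val).val, x.time + (f x.val).time⟩

/-- One elementary step (on counters and addresses, or a memory access). -/
def op {α : Type} (a : α) : Timed α := ⟨a, 1⟩

/-- `for i = 0, …, m - 1 do body i`, with one step of overhead for each iteration. -/
def loop {α : Type} (body : ℕ → α → Timed α) : ℕ → α → Timed α
  | 0, x => pure x
  | m + 1, x => do
      let y ← loop body m x
      let i ← op m
      body i y

end Timed

/-- The number type of a unit-cost machine: every operation takes one step. Programs are written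
for an arbitrary such type, so that numbers can only be handled through these operations. -/
class UnitCost (R : Type) where
  ofNat : ℕ → R
  add : R → R → R
  sub : R → R → R
  mul : R → R → R
  div : R → R → R
  le : R → R → Bool
  lt : R → R → Bool
  /-- `⌊log_b x⌋` -/
  floorLog : R → R → ℕ
  /-- `⌈log_b x⌉` -/
  ceilLog : R → R → ℕ

/-- The real numbers with their usual operations. -/
noncomputable instance instUnitCostReal : UnitCost ℝ where
  ofNat n := (n : ℝ)
  add x y := x + y
  sub x y := x - y
  mul x y := x * y
  div x y := x / y
  le x y := decide (x ≤ y)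
  lt x y := decide (x < y)
  floorLog b x := ⌊Real.logb b x⌋₊
  ceilLog b x := ⌈Real.logb b x⌉₊

namespace Prog

open Timed

section
variable {R : Type} [UnitCost R]

def lit (n : ℕ) : Timed R := op (UnitCost.ofNat n)
def add (x y : R) : Timed R := op (UnitCost.add x y)
def sub (x y : R) : Timed R := op (UnitCost.sub x y)
def mul (x y : R) : Timed R := op (UnitCost.mul x y)
def div (x y : R) : Timed R := op (UnitCost.div x y)
def le (x y : R) : Timed Bool := op (UnitCost.le x y)
def lt (x y : R) : Timed Bool := op (UnitCost.lt x y)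
def floorLog (b x : R) : Timed ℕ := op (UnitCost.floorLog b x)
def ceilLog (b x : R) : Timed ℕ := op (UnitCost.ceilLog b x)

end

/-- Arrays; reading or writing one cell takes one step, creating an array takes one step for
each cell. -/
def Arr (α : Type) : Type := ℕ → α

def newArr {α : Type} (size : ℕ) (a : α) : Timed (Arr α) := ⟨fun _ => a, size⟩
def get {α : Type} (A : Arr α) (i : ℕ) : Timed α := op (A i)
def set {α : Type} (A : Arr α) (i : ℕ) (a : α) : Timed (Arr α) := op (Function.update A i a)

/-- Three-dimensional arrays whose cells may be empty, with the same costs. -/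
def Table (α : Type) : Type := ℕ × ℕ × ℕ → Option α

def newTable (α : Type) (m₁ m₂ m₃ : ℕ) : Timed (Table α) := ⟨fun _ => none, m₁ * m₂ * m₃⟩
def getCell {α : Type} (A : Table α) (i : ℕ × ℕ × ℕ) : Timed (Option α) := op (A i)
def setCell {α : Type} (A : Table α) (i : ℕ × ℕ × ℕ) (a : α) : Timed (Table α) :=
  op (Function.update A i (some a))

/-- Runs through the cells `[0, m₁) × [0, m₂) × [0, m₃)` of a table, calling `f` on the content
of every non-empty cell. -/
def scan {α β : Type} (m₁ m₂ m₃ : ℕ) (A : Table α) (f : α → β → Timed β) (b : β) : Timed β :=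
  loop (fun i₁ => loop (fun i₂ => loop (fun i₃ x => do
    match ← getCell A (i₁, i₂, i₃) with
    | none => pure x
    | some a => f a x) m₃) m₂) m₁ b

/-! ### The algorithm -/

/-- Input of the algorithm; jobs are numbered from `0`. -/
structure Input (R : Type) where
  n : ℕ
  p : Arr R
  w : Arr R
  T₁ : R
  T₂ : R
  k : R
  μ : R
  ε : R

/-- Precomputed data: `P i`, `W i` are the total processing time and the total weight of the
first `i` jobs, `Z i` is their total weighted completion time in `π*`. Thus job `j` is processed
during `[P j, P (j + 1)]` in `π*`. -/
structure Sums (R : Type) where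
  P : Arr R
  W : Arr R
  Z : Arr R
  pmin : R
  δ : R

/-- A quadruple `(j; ℓ¹, ℓ², Z)` (`j` being the index of the table that stores it), together with
the partial schedule that it describes, for backtracking: a linked list of blocks `(m, s)`,
the block of the last jobs first, which says that the next `m` jobs
are processed one after the other from time `s` on. -/
structure Quad (R : Type) where
  l₁ : R
  l₂ : R
  z : R
  plan : List (ℕ × R)

/-- The lower bounds `L¹, L², L³`, and the numbers of cells of a table in its three directions. -/
structure Grid (R : Type) where
  L₁ : R
  L₂ : R
  L₃ : R
  m₁ : ℕ
  m₂ : ℕ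
  m₃ : ℕ

section
variable {R : Type} [UnitCost R]

def maxR (x y : R) : Timed R := do
  if ← le x y then pure y else pure x

def preprocess (I : Input R) : Timed (Sums R) := do
  let zero ← lit 0
  let P ← newArr (I.n + 1) zero
  let W ← newArr (I.n + 1) zero
  let Z ← newArr (I.n + 1) zero
  let p₀ ← get I.p 0
  let one ← lit 1
  let two ← lit 2
  let n' ← lit I.n
  let t ← mul two n'
  let e ← div I.ε t
  let δ ← add one e
  loop (fun j (s : Sums R) => do
    let pj ← get I.p j
    let wj ← get I.w j
    let P₀ ← get s.P j
    let W₀ ← get s.W j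
    let Z₀ ← get s.Z j
    let P₁ ← add P₀ pj
    let W₁ ← add W₀ wj
    let t ← mul wj P₁
    let Z₁ ← add Z₀ t
    let j' ← op (j + 1)
    let P ← set s.P j' P₁
    let W ← set s.W j' W₁
    let Z ← set s.Z j' Z₁
    let pmin ← (do if ← lt pj s.pmin then pure pj else pure s.pmin)
    pure ⟨P, W, Z, pmin, s.δ⟩) I.n ⟨P, W, Z, p₀, δ⟩

/-- The number of jobs `j` with `C_j(π*) - K ≤ T₁`: these are the first ones. -/
def countEarly (I : Input R) (s : Sums R) (K : R) : Timed ℕ :=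
  loop (fun j c => do
    let j' ← op (j + 1)
    let t ← get s.P j'
    let t ← sub t K
    if ← le t I.T₁ then pure j' else pure c) I.n 0

/-- Total weighted completion time of the jobs `i, …, j - 1` when they are processed in this order
from time `t` on. -/
def blockZ (s : Sums R) (i j : ℕ) (t : R) : Timed R := do
  let Zi ← get s.Z i
  let Zj ← get s.Z j
  let Wi ← get s.W i
  let Wj ← get s.W j
  let Pi ← get s.P i
  let z ← sub Zj Zi
  let w ← sub Wj Wi
  let d ← sub t Pi
  let y ← mul w d
  add z y

/-- Index `i ≥ 1` of the interval `[L, L δ]` (if `i = 1`) or `(L δ^(i-1), L δ^i]` (if `i ≥ 2`)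
that contains `x`. -/
def interval (δ L x : R) : Timed ℕ := do
  let y ← div x L
  let i ← ceilLog δ y
  op (max 1 i)

/-- Puts a quadruple into the box that it belongs to. If the box is occupied, the quadruple with
the smaller `ℓ¹` is kept. -/
def store (δ : R) (g : Grid R) (A : Table (Quad R)) (q : Quad R) : Timed (Table (Quad R)) := do
  let zero ← lit 0
  let i₁ ← (do if ← le q.l₁ zero then op 0 else interval δ g.L₁ q.l₁)
  let i₂ ← interval δ g.L₂ q.l₂
  let i₃ ← interval δ g.L₃ q.z
  match ← getCell A (i₁, i₂, i₃) with
  | none => setCell A (i₁, i₂, i₃) q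
  | some q' => do
      if ← lt q.l₁ q'.l₁ then setCell A (i₁, i₂, i₃) q else pure A

/-- Assigns job `j` in all possible ways to a partial schedule `q` on the jobs `0, …, j - 1`.
Here `A` stores the partial schedules on `0, …, j` and `F` stores the full schedules; only the
jobs before `m` may be processed before `T₁`. -/
def extend (I : Input R) (s : Sums R) (g : Grid R) (K : R) (m j : ℕ) (q : Quad R)
    (AF : Table (Quad R) × Table (Quad R)) : Timed (Table (Quad R) × Table (Quad R)) := do
  let pj ← get I.p j
  let wj ← get I.w j
  let j' ← op (j + 1)
  let Cj ← get s.P j'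
  -- Case 1: in the later schedule
  let c ← add q.l₂ pj
  let t ← mul wj c
  let z ← add q.z t
  let A ← store s.δ g AF.1 ⟨q.l₁, c, z, (1, q.l₂) :: q.plan⟩
  -- Case 2: in the earlier schedule, without idle time
  let e ← add q.l₁ pj
  let fits ← le e I.T₁
  let d ← sub Cj e
  let near ← le d K
  let A ← (do
    if fits && near then
      let t ← mul wj e
      let z ← add q.z t
      store s.δ g A ⟨e, q.l₂, z, (1, q.l₁) :: q.plan⟩
    else pure A)
  -- Case 3: in the earlier schedule, after an idle period; the full schedule is then determined
  let f ← sub Cj K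
  let late ← lt e f
  let ok ← le f I.T₁
  let F ← (do
    if late && ok then
      let t ← sub f pj
      let Pj ← get s.P j
      let Pm ← get s.P m
      let Pn ← get s.P I.n
      let x ← sub Pm Pj
      let l₁ ← add t x
      let y ← sub Pn Pm
      let l₂ ← add q.l₂ y
      let z₁ ← blockZ s j m t
      let z₂ ← blockZ s m I.n q.l₂
      let z ← add q.z z₁
      let z ← add z z₂
      let b₁ ← op (m - j)
      let b₂ ← op (I.n - m)
      store s.δ g AF.2 ⟨l₁, l₂, z, (b₂, q.l₂) :: (b₁, t) :: q.plan⟩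
    else pure AF.2)
  pure (A, F)

/-- Completes a partial schedule on the jobs before `m` by processing all other jobs in the later
schedule. -/
def finish (I : Input R) (s : Sums R) (g : Grid R) (m : ℕ) (q : Quad R)
    (F : Table (Quad R)) : Timed (Table (Quad R)) := do
  let Pm ← get s.P m
  let Pn ← get s.P I.n
  let y ← sub Pn Pm
  let l₂ ← add q.l₂ y
  let z₂ ← blockZ s m I.n q.l₂
  let z ← add q.z z₂
  let b ← op (I.n - m)
  store s.δ g F ⟨q.l₁, l₂, z, (b, q.l₂) :: q.plan⟩

/-- The number `⌊log_δ (U / L)⌋ + 2` of cells needed for the intervals of `[L, U]`, which are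
numbered from `1` on, and for the number `0`. -/
def cells (δ L U : R) : Timed ℕ := do
  let x ← div U L
  let r ← floorLog δ x
  op (r + 2)

/-- The algorithm `Approx(a, ε)` for `μ = 0` and the bound `K` on the maximum time deviation,
where job `a` starts at time `T₂`. -/
def approx (I : Input R) (s : Sums R) (a : ℕ) (K : R) : Timed (Option (Quad R)) := do
  let c ← countEarly I s K
  let a' ← op (a + 1)
  let m ← op (max c a')
  let pa ← get I.p a
  let wa ← get I.w a
  let Pa ← get s.P a
  let Za ← get s.Z a
  let Pn ← get s.P I.n
  let Wn ← get s.W I.n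
  let Zn ← get s.Z I.n
  let L₂ ← add I.T₂ pa
  let U₂ ← add I.T₂ Pn
  let t ← mul wa L₂
  let L₃ ← add Za t
  let t ← mul Wn I.T₂
  let U₃ ← add Zn t
  let m₁ ← cells s.δ s.pmin I.T₁
  let m₂ ← cells s.δ L₂ U₂
  let m₃ ← cells s.δ L₃ U₃
  let g : Grid R := ⟨s.pmin, L₂, L₃, m₁, m₂, m₃⟩
  let zero ← lit 0
  let A ← newTable (Quad R) m₁ m₂ m₃
  let F ← newTable (Quad R) m₁ m₂ m₃
  let A ← store s.δ g A ⟨Pa, L₂, L₃, [(1, I.T₂), (a, zero)]⟩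
  let steps ← op (m - a')
  let AF ← loop (fun i (AF : Table (Quad R) × Table (Quad R)) => do
    let j ← op (a' + i)
    let B ← newTable (Quad R) m₁ m₂ m₃
    scan m₁ m₂ m₃ AF.1 (extend I s g K m j) (B, AF.2)) steps (A, F)
  let F ← scan m₁ m₂ m₃ AF.1 (finish I s g m) AF.2
  scan m₁ m₂ m₃ F (fun q (best : Option (Quad R)) =>
    match best with
    | none => op (some q)
    | some q' => do
        if ← lt q.z q'.z then op (some q) else pure (some q')) none

/-- Writes the starting times of the jobs according to a plan; also returns the number of jobs
treated. -/
def expand (I : Input R) : List (ℕ × R) → Timed (ℕ × Arr R)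
  | [] => do
      let zero ← lit 0
      let S ← newArr I.n zero
      pure (0, S)
  | (b, t) :: rest => do
      let (j₀, S) ← expand I rest
      let r ← loop (fun i (x : Arr R × R) => do
        let j ← op (j₀ + i)
        let S ← set x.1 j x.2
        let pj ← get I.p j
        let t ← add x.2 pj
        pure (S, t)) b (S, t)
      let j₁ ← op (j₀ + b)
      pure (j₁, r.1)

/-- Objective value `μ Δ_max + ∑ w_j C_j` of the schedule with starting times `S`. -/
def value (I : Input R) (s : Sums R) (S : Arr R) : Timed R := do
  let zero ← lit 0
  let r ← loop (fun j (x : R × R) => do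
    let pj ← get I.p j
    let wj ← get I.w j
    let Sj ← get S j
    let j' ← op (j + 1)
    let D ← get s.P j'
    let C ← add Sj pj
    let u ← sub C D
    let v ← sub D C
    let d ← maxR u v
    let dmax ← maxR x.1 d
    let t ← mul wj C
    let z ← add x.2 t
    pure (dmax, z)) I.n (zero, zero)
  let t ← mul I.μ r.1
  add t r.2

/-- Runs `Approx(a, ε)` with the bound `K` and keeps the better one of its schedule and the best
schedule (with its objective value) found so far. -/
def tryBound (I : Input R) (s : Sums R) (a : ℕ) (K : R) (best : Option (R × Arr R)) :
    Timed (Option (R × Arr R)) := do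
  match ← approx I s a K with
  | none => pure best
  | some q => do
      let (_, S) ← expand I q.plan
      let v ← value I s S
      match best with
      | none => op (some (v, S))
      | some (v', S') => do
          if ← lt v v' then op (some (v, S)) else pure (some (v', S'))

/-- The algorithm `Approx^μ(ε)`: for all `a ≤ j₁` with `Δ_a = T₂ - S_a(π*) ≤ k`, the algorithm
`Approx(a, ε)` is called with the bounds `Δ_a (1 + ε)^i`, `1 ≤ i ≤ ⌊log_{1+ε} (k / Δ_a)⌋`, and with
the bound `k`. The result consists of the starting times of the best schedule found. -/
def approxMu (I : Input R) : Timed (Option (Arr R)) := do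
  let s ← preprocess I
  let zero ← lit 0
  let one ← lit 1
  let base ← add one I.ε
  -- job number `j₁` is the first one that is completed after time `T₁` in `π*`
  let j₁ ← countEarly I s zero
  let j₁' ← op (j₁ + 1)
  let best ← loop (fun a (best : Option (R × Arr R)) => do
    let Pa ← get s.P a
    let Δa ← sub I.T₂ Pa
    if ← le Δa I.k then
      let x ← div I.k Δa
      let r₄ ← floorLog base x
      let y ← loop (fun _ (y : R × Option (R × Arr R)) => do
        let K ← mul y.1 base
        let b ← tryBound I s a K y.2
        pure (K, b)) r₄ (Δa, best)
      tryBound I s a I.k y.2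
    else pure best) j₁' none
  match best with
  | none => pure none
  | some (_, S) => pure (some S)

end

end Prog

namespace Resched

/-- The input of the algorithm for the instance `I` and the accuracy `ε`. -/
noncomputable def toInput (I : Resched) (ε : ℝ) : Prog.Input ℝ where
  n := I.n
  p := fun j => if h : j < I.n then (I.p ⟨j, h⟩ : ℝ) else 0
  w := fun j => if h : j < I.n then (I.w ⟨j, h⟩ : ℝ) else 0
  T₁ := I.T₁
  T₂ := I.T₂
  k := I.k
  μ := I.μ
  ε := ε

/-- The factor `log x` of a running time, for integers `x ≥ 1`: the binary logarithm of `x`, except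
that it is `1` if `x = 1`. -/
noncomputable def logFactor (x : ℕ) : ℝ := max 1 (Real.logb 2 x)

/-- The bound `n⁵ / ε⁴ · log T₁ · log (T₂ + P) · log (w_max P + W T₂) · log k`. -/
noncomputable def timeBound (I : Resched) (ε : ℝ) : ℝ :=
  (I.n : ℝ) ^ 5 / ε ^ 4 * logFactor I.T₁ * logFactor (I.T₂ + I.totalP) *
    logFactor (I.wMax * I.totalP + I.totalW * I.T₂) * logFactor I.k

end Resched

/-!
# The approximation scheme for rescheduling with one unavailable period

**Approximation.** The jobs that a feasible schedule `τ` processes before the unavailable period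
form a set `E`. Let every job of `E` be completed as early as the bound on the time deviations
permits when `E` is processed in WSPT order, and let the other jobs follow from time `T₂` on in WSPT
order without idle time. This target schedule costs at most as much as `τ`
(`IsSchedule.exists_target`): on the jobs of `E` that are not delayed by the bound and on the later
jobs by Smith's rule (`smith_rule`), on the delayed jobs one by one. The length of the late
jobs grows along the original order, so once a job of `E` is delayed, all later ones of `E` are;
hence the jobs that are not delayed come first and form a block without idle time.

`Approx(a, ε)` follows the target schedule whose first late job is `a`: after each job some stored
quadruple has `ℓ¹` at most the target value, and `ℓ²` and `Z` at most a power of `δ` times the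
target values. Putting the next job where the target schedule puts it preserves this, and replacing
the quadruple by the representative of its box costs one factor of `δ` (`follows_assignJob`). As the
representative has the smaller `ℓ¹`, it may happen that the next job of `E` would be completed too
early. But then the schedule that inserts idle time and processes the next jobs with time deviation
exactly `K` is generated, and no job before the unavailable period can be earlier in the target
schedule (`Follows.idle`). So `Approx(a, ε)` loses a factor of at most `δ ^ n ≤ 1 + ε` in the total
weighted completion time (`approx_le`, `Input.Good.δ_pow_le`). The bounds `K` that are tried form a
geometric progression of ratio `1 + ε`, so that one of them is at least `Δ_max(τ)` and at most
`(1 + ε) Δ_max(τ)`; both summands of the objective are then within the factor `1 + ε`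
(`approxMu_spec`).

**Running time.** A table has `O((n / ε)³)` boxes, up to the product of the three logarithms
(`boxes_le`), because `log₂ (1 + x) ≥ x` for `0 ≤ x ≤ 1` (`logb_one_add_le`). It is scanned `O(n)`
times, with constant time for each box (`approx_time_le`), for at most `n` jobs `a` and
`O(log k / ε)` bounds `K` (`tryJob_time_le`, `approxMu_time_le`). The upper end of the interval for
`Z` is at most the square of `w_max P + W T₂`, as `n ≤ P` (`Valid.cost_le`), so the number of jobs
does not enter the logarithm.
-/

-- Arrays and tables are functions; this lets terms of these types be applied as such.
attribute [reducible] Prog.Arr Prog.Table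

/-! ### Timed computations -/

namespace Timed

variable {α β : Type}

@[simp] theorem val_bind (x : Timed α) (f : α → Timed β) : (x >>= f).val = (f x.val).val := (rfl)
@[simp] theorem time_bind (x : Timed α) (f : α → Timed β) :
    (x >>= f).time = x.time + (f x.val).time := (rfl)
@[simp] theorem val_pure (a : α) : (pure a : Timed α).val = a := (rfl)
@[simp] theorem time_pure (a : α) : (pure a : Timed α).time = 0 := (rfl)
@[simp] theorem val_op (a : α) : (op a).val = a := (rfl)
@[simp] theorem time_op (a : α) : (op a).time = 1 := (rfl)
@[simp] theorem loop_zero (body : ℕ → α → Timed α) (x : α) : loop body 0 x = pure x := (rfl)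
theorem loop_succ_val (body : ℕ → α → Timed α) (m : ℕ) (x : α) :
    (loop body (m + 1) x).val = (body m (loop body m x).val).val := (rfl)
theorem loop_succ_time (body : ℕ → α → Timed α) (m : ℕ) (x : α) :
    (loop body (m + 1) x).time =
      (loop body m x).time + (1 + (body m (loop body m x).val).time) := (rfl)

@[simp] theorem val_ite (c : Prop) [Decidable c] (x y : Timed α) :
    (if c then x else y).val = if c then x.val else y.val := by split <;> rfl
@[simp] theorem time_ite (c : Prop) [Decidable c] (x y : Timed α) :
    (if c then x else y).time = if c then x.time else y.time := by split <;> rfl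

theorem loop_inv {body : ℕ → α → Timed α} {m : ℕ} {x : α} (Inv : ℕ → α → Prop) (h0 : Inv 0 x)
    (h : ∀ i < m, ∀ y, Inv i y → Inv (i + 1) (body i y).val) : Inv m (loop body m x).val := by
  induction m with
  | zero => exact h0
  | succ m ih =>
    rw [loop_succ_val]
    exact h m (Nat.lt_succ_self m) _ (ih fun i hi => h i (hi.trans (Nat.lt_succ_self m)))

theorem loop_time_le_of_inv {body : ℕ → α → Timed α} {m : ℕ} {x : α} (Inv : ℕ → α → Prop)
    (T : ℕ) (h0 : Inv 0 x)
    (h : ∀ i < m, ∀ y, Inv i y → Inv (i + 1) (body i y).val ∧ (body i y).time ≤ T) :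
    (loop body m x).time ≤ m * (T + 1) := by
  induction m with
  | zero => simp
  | succ m ih =>
    have h' : ∀ i < m, ∀ y, Inv i y → Inv (i + 1) (body i y).val ∧ (body i y).time ≤ T :=
      fun i hi => h i (hi.trans (Nat.lt_succ_self m))
    have h1 := ih h'
    have h2 := (h m (Nat.lt_succ_self m) _ (loop_inv Inv h0 fun i hi y hy => (h' i hi y hy).1)).2
    rw [loop_succ_time, Nat.succ_mul]
    omega

theorem loop_time_le {body : ℕ → α → Timed α} {m : ℕ} {x : α} (T : ℕ)
    (h : ∀ i < m, ∀ y, (body i y).time ≤ T) : (loop body m x).time ≤ m * (T + 1) :=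
  loop_time_le_of_inv (fun _ _ => True) T trivial fun i hi y _ => ⟨trivial, h i hi y⟩

/-- A property that iteration `i₀` establishes and that no iteration destroys holds after the
loop. -/
theorem loop_reach {body : ℕ → α → Timed α} {m : ℕ} {x : α} (Inv : ℕ → α → Prop) (D : α → Prop)
    (h0 : Inv 0 x) (h : ∀ i < m, ∀ y, Inv i y → Inv (i + 1) (body i y).val)
    (hD : ∀ i < m, ∀ y, Inv i y → D y → D (body i y).val)
    {i₀ : ℕ} (hi₀ : i₀ < m) (hR : ∀ y, Inv i₀ y → D (body i₀ y).val) :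
    D (loop body m x).val := by
  induction m with
  | zero => exact absurd hi₀ (Nat.not_lt_zero _)
  | succ m ih =>
    rw [loop_succ_val]
    have hI : Inv m (loop body m x).val :=
      loop_inv Inv h0 fun i hi => h i (hi.trans (Nat.lt_succ_self m))
    rcases Nat.lt_succ_iff_lt_or_eq.1 hi₀ with hlt | rfl
    · exact hD m (Nat.lt_succ_self m) _ hI
        (ih (fun i hi => h i (hi.trans (Nat.lt_succ_self m)))
          (fun i hi => hD i (hi.trans (Nat.lt_succ_self m))) hlt)
    · exact hR _ hI

end Timed

namespace Prog

open Timed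

@[simp] theorem lit_eq (n : ℕ) : (lit n : Timed ℝ) = op (n : ℝ) := (rfl)
@[simp] theorem add_eq (x y : ℝ) : add x y = op (x + y) := (rfl)
@[simp] theorem sub_eq (x y : ℝ) : sub x y = op (x - y) := (rfl)
@[simp] theorem mul_eq (x y : ℝ) : mul x y = op (x * y) := (rfl)
@[simp] theorem div_eq (x y : ℝ) : div x y = op (x / y) := (rfl)
@[simp] theorem le_eq (x y : ℝ) : le x y = op (decide (x ≤ y)) := (rfl)
@[simp] theorem lt_eq (x y : ℝ) : lt x y = op (decide (x < y)) := (rfl)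
@[simp] theorem floorLog_eq (b x : ℝ) : floorLog b x = op ⌊Real.logb b x⌋₊ := (rfl)
@[simp] theorem get_eq {α : Type} (A : Arr α) (i : ℕ) : get A i = op (A i) := (rfl)
@[simp] theorem set_eq {α : Type} (A : Arr α) (i : ℕ) (a : α) :
    set A i a = op (Function.update A i a) := (rfl)
@[simp] theorem getCell_eq {α : Type} (A : Table α) (i : ℕ × ℕ × ℕ) :
    getCell A i = op (A i) := (rfl)
@[simp] theorem setCell_eq {α : Type} (A : Table α) (i : ℕ × ℕ × ℕ) (a : α) :
    setCell A i a = op (Function.update A i (some a)) := (rfl)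
@[simp] theorem val_newArr {α : Type} (size : ℕ) (a : α) :
    (newArr size a).val = fun _ => a := (rfl)
@[simp] theorem time_newArr {α : Type} (size : ℕ) (a : α) : (newArr size a).time = size := (rfl)
@[simp] theorem val_newTable (α : Type) (m₁ m₂ m₃ : ℕ) :
    (newTable α m₁ m₂ m₃).val = fun _ => none := (rfl)
@[simp] theorem time_newTable (α : Type) (m₁ m₂ m₃ : ℕ) :
    (newTable α m₁ m₂ m₃).time = m₁ * m₂ * m₃ := (rfl)

@[simp] theorem val_maxR (x y : ℝ) : (maxR x y).val = max x y := by
  simp only [maxR, le_eq, val_bind, val_op, val_ite, val_pure, decide_eq_true_eq]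
  split_ifs with h
  · exact (max_eq_right h).symm
  · exact (max_eq_left (not_le.1 h).le).symm

@[simp] theorem time_maxR (x y : ℝ) : (maxR x y).time = 1 := by
  simp [maxR]

section scan

variable {α β : Type} {m₁ m₂ m₃ : ℕ} {A : Table α} {f : α → β → Timed β} {b : β}

theorem scan_inv (Inv : β → Prop) (h0 : Inv b)
    (h : ∀ i a, A i = some a → ∀ y, Inv y → Inv (f a y).val) :
    Inv (scan m₁ m₂ m₃ A f b).val := by
  refine loop_inv (fun _ => Inv) h0 fun i₁ _ y hy => ?_
  refine loop_inv (fun _ => Inv) hy fun i₂ _ y hy => ?_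
  refine loop_inv (fun _ => Inv) hy fun i₃ _ y hy => ?_
  simp only [getCell_eq, val_bind, val_op]
  cases hA : A (i₁, i₂, i₃) with
  | none => exact hy
  | some a => exact h _ a hA y hy

theorem scan_time_le (T : ℕ) (h₂ : 0 < m₂) (h₃ : 0 < m₃) (h : ∀ a y, (f a y).time ≤ T) :
    (scan m₁ m₂ m₃ A f b).time ≤ m₁ * m₂ * m₃ * (T + 4) := by
  have key : (scan m₁ m₂ m₃ A f b).time ≤ m₁ * (m₂ * (m₃ * (T + 2) + 1) + 1) := by
    refine loop_time_le _ fun i₁ _ y => ?_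
    refine loop_time_le _ fun i₂ _ y => ?_
    refine loop_time_le (T + 1) fun i₃ _ y => ?_
    simp only [getCell_eq, time_bind, val_op, time_op]
    cases A (i₁, i₂, i₃) with
    | none => simp
    | some a => have := h a y; simp only; omega
  calc (scan m₁ m₂ m₃ A f b).time ≤ m₁ * m₂ * m₃ * (T + 2) + m₁ * m₂ * 1 + m₁ * 1 :=
        key.trans_eq (by ring)
    _ ≤ m₁ * m₂ * m₃ * (T + 2) + m₁ * m₂ * m₃ + m₁ * (m₂ * m₃) := by
        gcongr <;> nlinarith
    _ = _ := by ring

/-- A property that the content of one cell in range establishes and that no cell destroys holds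
after the scan. -/
theorem scan_reach (Inv : β → Prop) (D : β → Prop) (h0 : Inv b)
    (h : ∀ i a, A i = some a → ∀ y, Inv y → Inv (f a y).val)
    (hD : ∀ i a, A i = some a → ∀ y, Inv y → D y → D (f a y).val)
    {i : ℕ × ℕ × ℕ} {a : α} (hi₁ : i.1 < m₁) (hi₂ : i.2.1 < m₂) (hi₃ : i.2.2 < m₃)
    (hA : A i = some a) (hR : ∀ y, Inv y → D (f a y).val) :
    D (scan m₁ m₂ m₃ A f b).val := by
  obtain ⟨j₁, j₂, j₃⟩ := i
  have inv3 : ∀ i₁ i₂ i₃ y, Inv y → Inv ((do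
      match ← getCell A (i₁, i₂, i₃) with
      | none => pure y
      | some a => f a y) : Timed β).val := by
    intro i₁ i₂ i₃ y hy
    simp only [getCell_eq, val_bind, val_op]
    cases hA : A (i₁, i₂, i₃) with
    | none => exact hy
    | some a => exact h _ a hA y hy
  have D3 : ∀ i₁ i₂ i₃ y, Inv y → D y → D ((do
      match ← getCell A (i₁, i₂, i₃) with
      | none => pure y
      | some a => f a y) : Timed β).val := by
    intro i₁ i₂ i₃ y hy hDy
    simp only [getCell_eq, val_bind, val_op]
    cases hA : A (i₁, i₂, i₃) with
    | none => exact hDy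
    | some a => exact hD _ a hA y hy hDy
  -- the invariant `Inv ∧ D` of the inner loops shows that they keep `D`
  refine loop_reach (fun _ => Inv) D h0
    (fun i₁ _ y hy => loop_inv (fun _ => Inv) hy fun i₂ _ y hy =>
      loop_inv (fun _ => Inv) hy fun i₃ _ y hy => inv3 i₁ i₂ i₃ y hy)
    (fun i₁ _ y hy hDy => (loop_inv (fun _ y => Inv y ∧ D y) ⟨hy, hDy⟩ fun i₂ _ y hy =>
      loop_inv (fun _ y => Inv y ∧ D y) hy fun i₃ _ y hy =>
        ⟨inv3 i₁ i₂ i₃ y hy.1, D3 i₁ i₂ i₃ y hy.1 hy.2⟩).2) hi₁ fun y hy => ?_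
  refine loop_reach (fun _ => Inv) D hy
    (fun i₂ _ y hy => loop_inv (fun _ => Inv) hy fun i₃ _ y hy => inv3 _ i₂ i₃ y hy)
    (fun i₂ _ y hy hDy => (loop_inv (fun _ y => Inv y ∧ D y) ⟨hy, hDy⟩ fun i₃ _ y hy =>
      ⟨inv3 _ i₂ i₃ y hy.1, D3 _ i₂ i₃ y hy.1 hy.2⟩).2) hi₂ fun y hy => ?_
  refine loop_reach (fun _ => Inv) D hy (fun i₃ _ y hy => inv3 _ _ i₃ y hy)
    (fun i₃ _ y hy hDy => D3 _ _ i₃ y hy hDy) hi₃ fun y hy => ?_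
  simp only [getCell_eq, val_bind, val_op] at hA ⊢
  rw [hA]
  exact hR y hy

end scan

end Prog

/-! ### What the subroutines compute -/

namespace Prog

open Timed

namespace Input

/-- Total processing time of the first `j` jobs: the starting time of job `j` in `π*`. -/
noncomputable def P (J : Input ℝ) (j : ℕ) : ℝ := ∑ i ∈ Finset.range j, J.p i

/-- Total weight of the first `j` jobs. -/
noncomputable def W (J : Input ℝ) (j : ℕ) : ℝ := ∑ i ∈ Finset.range j, J.w i

/-- Total weighted completion time of the first `j` jobs in `π*`. -/
noncomputable def Z (J : Input ℝ) (j : ℕ) : ℝ := ∑ i ∈ Finset.range j, J.w i * J.P (i + 1)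

/-- The standing assumptions, for the real-valued input of the algorithm. -/
structure Good (J : Input ℝ) : Prop where
  one_le_p : ∀ i < J.n, 1 ≤ J.p i
  one_le_w : ∀ i < J.n, 1 ≤ J.w i
  wspt : ∀ i j, i ≤ j → j < J.n → J.p i * J.w j ≤ J.p j * J.w i
  T_lt : J.T₁ < J.T₂
  pmin_le : ∃ i < J.n, J.p i ≤ J.T₁
  T₁_lt : J.T₁ < J.P J.n
  ε_pos : 0 < J.ε
  ε_le : J.ε ≤ 1
  μ_nonneg : 0 ≤ J.μ

theorem P_succ (J : Input ℝ) (j : ℕ) : J.P (j + 1) = J.P j + J.p j := Finset.sum_range_succ _ _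
theorem W_succ (J : Input ℝ) (j : ℕ) : J.W (j + 1) = J.W j + J.w j := Finset.sum_range_succ _ _
theorem Z_succ (J : Input ℝ) (j : ℕ) : J.Z (j + 1) = J.Z j + J.w j * J.P (j + 1) :=
  Finset.sum_range_succ _ _
@[simp] theorem P_zero (J : Input ℝ) : J.P 0 = 0 := rfl
@[simp] theorem W_zero (J : Input ℝ) : J.W 0 = 0 := rfl
@[simp] theorem Z_zero (J : Input ℝ) : J.Z 0 = 0 := rfl

namespace Good

variable {J : Input ℝ} (hJ : J.Good)
include hJ

theorem n_pos : 0 < J.n := by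
  obtain ⟨i, hi, -⟩ := hJ.pmin_le
  exact Nat.zero_lt_of_lt hi

theorem p_pos {i : ℕ} (hi : i < J.n) : 0 < J.p i := one_pos.trans_le (hJ.one_le_p i hi)

theorem w_pos {i : ℕ} (hi : i < J.n) : 0 < J.w i := one_pos.trans_le (hJ.one_le_w i hi)

theorem P_mono {i j : ℕ} (hij : i ≤ j) (hj : j ≤ J.n) : J.P i ≤ J.P j :=
  Finset.sum_le_sum_of_subset_of_nonneg (Finset.range_mono hij) fun _ hx _ =>
    (hJ.p_pos ((Finset.mem_range.1 hx).trans_le hj)).le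

theorem P_nonneg {j : ℕ} (hj : j ≤ J.n) : 0 ≤ J.P j := by
  simpa using hJ.P_mono (Nat.zero_le j) hj

theorem one_le_T₁ : 1 ≤ J.T₁ := by
  obtain ⟨i, hi, h⟩ := hJ.pmin_le
  exact (hJ.one_le_p i hi).trans h

end Good

/-- The ratio `δ = 1 + ε / (2 n)` of the geometric subdivisions. -/
noncomputable def δ (J : Input ℝ) : ℝ := 1 + J.ε / (2 * J.n)

theorem Good.one_lt_δ {J : Input ℝ} (hJ : J.Good) : 1 < J.δ := by
  have h1 : (0 : ℝ) < J.n := by exact_mod_cast hJ.n_pos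
  have h2 := hJ.ε_pos
  have : 0 < J.ε / (2 * J.n) := by positivity
  unfold δ
  linarith

end Input

/-- `s` holds the data that `preprocess` is meant to compute for the input `J`. -/
structure IsSums (J : Input ℝ) (s : Sums ℝ) : Prop where
  P_eq : ∀ j ≤ J.n, s.P j = J.P j
  W_eq : ∀ j ≤ J.n, s.W j = J.W j
  Z_eq : ∀ j ≤ J.n, s.Z j = J.Z j
  pmin_le : ∀ i < J.n, s.pmin ≤ J.p i
  pmin_mem : ∃ i < J.n, s.pmin = J.p i
  δ_eq : s.δ = J.δ

theorem isSums_preprocess {J : Input ℝ} (hn : 0 < J.n) : IsSums J (preprocess J).val := by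
  simp only [preprocess, lit_eq, val_bind, val_op, val_newArr, get_eq, mul_eq, div_eq, add_eq,
    set_eq, lt_eq]
  apply (fun (s : Sums ℝ) (h : (∀ j ≤ J.n, s.P j = J.P j) ∧ (∀ j ≤ J.n, s.W j = J.W j) ∧
      (∀ j ≤ J.n, s.Z j = J.Z j) ∧ (∀ i < J.n, s.pmin ≤ J.p i) ∧ (∃ i < J.n, s.pmin = J.p i) ∧
      s.δ = J.δ) => (⟨h.1, h.2.1, h.2.2.1, h.2.2.2.1, h.2.2.2.2.1, h.2.2.2.2.2⟩ : IsSums J s))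
  refine loop_inv (fun m (s : Sums ℝ) => (∀ j ≤ m, s.P j = J.P j) ∧ (∀ j ≤ m, s.W j = J.W j) ∧
      (∀ j ≤ m, s.Z j = J.Z j) ∧ (∀ i < m, s.pmin ≤ J.p i) ∧ (∃ i < J.n, s.pmin = J.p i) ∧
      s.δ = J.δ) ?_ ?_
  · refine ⟨?_, ?_, ?_, ?_, ⟨0, hn, rfl⟩, by simp [Input.δ]⟩ <;> simp
  · rintro m hm s ⟨hP, hW, hZ, hp, hm', hδ⟩
    have aux : ∀ (f : Arr ℝ) (g : ℕ → ℝ) (x : ℝ), (∀ j ≤ m, f j = g j) → x = g (m + 1) →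
        ∀ j ≤ m + 1, Function.update f (m + 1) x j = g j := by
      intro f g x hf hx j hj
      rcases Nat.le_succ_iff.1 hj with h | rfl
      · rw [Function.update_of_ne (by omega), hf j h]
      · rw [Function.update_self, hx]
    refine ⟨aux _ _ _ hP ?_, aux _ _ _ hW ?_, aux _ _ _ hZ ?_, ?_, ?_, hδ⟩
    · simp only [val_op, hP m le_rfl, J.P_succ]
    · simp only [val_op, hW m le_rfl, J.W_succ]
    · simp only [val_op, hP m le_rfl, hZ m le_rfl, J.Z_succ, J.P_succ]
    · intro i hi
      simp only [val_bind, val_op, val_ite, val_pure, decide_eq_true_eq]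
      rcases Nat.lt_succ_iff_lt_or_eq.1 hi with h | rfl
      · split_ifs with hlt
        · exact hlt.le.trans (hp i h)
        · exact hp i h
      · split_ifs with hlt
        · exact le_rfl
        · exact not_lt.1 hlt
    · simp only [val_bind, val_op, val_ite, val_pure, decide_eq_true_eq]
      split_ifs with hlt
      · exact ⟨m, hm, rfl⟩
      · exact hm'

theorem preprocess_time_le (J : Input ℝ) : (preprocess J).time ≤ 18 * J.n + 11 := by
  simp only [preprocess, lit_eq, time_bind, val_op, time_op, val_newArr, time_newArr,
    get_eq, mul_eq, div_eq, add_eq, set_eq, lt_eq]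
  refine le_trans (Nat.add_le_add_left (Nat.add_le_add_left (Nat.add_le_add_left
    (Nat.add_le_add_left (Nat.add_le_add_left (Nat.add_le_add_left (Nat.add_le_add_left
    (Nat.add_le_add_left (Nat.add_le_add_left (Nat.add_le_add_left (Nat.add_le_add_left
    (loop_time_le 14 fun i _ y => ?_) _) _) _) _) _) _) _) _) _) _) _) ?_
  · simp
  · omega

theorem countEarly_spec {J : Input ℝ} (hJ : J.Good) {s : Sums ℝ} (hs : IsSums J s) (K : ℝ) :
    (countEarly J s K).val ≤ J.n ∧
      ∀ j < J.n, j < (countEarly J s K).val ↔ J.P (j + 1) - K ≤ J.T₁ := by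
  have h := loop_inv (fun m (c : ℕ) => c ≤ m ∧ (∀ j < m, j < c ↔ J.P (j + 1) - K ≤ J.T₁))
    (m := J.n) (x := 0) (body := fun j c => do
      let j' ← op (j + 1)
      let t ← get s.P j'
      let t ← sub t K
      if ← le t J.T₁ then pure j' else pure c) ⟨le_rfl, by simp⟩ ?_
  · exact h
  · rintro m hm c ⟨hc, hi⟩
    simp only [val_bind, val_op, get_eq, sub_eq, le_eq, val_ite, val_pure, decide_eq_true_eq,
      hs.P_eq (m + 1) hm]
    split_ifs with h
    · refine ⟨le_rfl, fun j hj => ⟨fun _ => ?_, fun _ => hj⟩⟩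
      have := hJ.P_mono (Nat.succ_le_succ (Nat.le_of_lt_succ hj)) hm
      linarith
    · refine ⟨hc.trans (Nat.le_succ m), fun j hj => ?_⟩
      rcases Nat.lt_succ_iff_lt_or_eq.1 hj with hj | rfl
      · exact hi j hj
      · exact ⟨fun h' => absurd hc (not_le.2 h'), fun h' => absurd h' h⟩

theorem countEarly_time_le (J : Input ℝ) (s : Sums ℝ) (K : ℝ) :
    (countEarly J s K).time ≤ J.n * 5 := by
  refine loop_time_le 4 fun i _ y => ?_
  simp

theorem blockZ_val {J : Input ℝ} {s : Sums ℝ} (hs : IsSums J s) {i j : ℕ} (hij : i ≤ j)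
    (hj : j ≤ J.n) (t : ℝ) :
    (blockZ s i j t).val = ∑ l ∈ Finset.Ico i j, J.w l * (t + (J.P (l + 1) - J.P i)) := by
  simp only [blockZ, get_eq, sub_eq, mul_eq, add_eq, val_bind, val_op,
    hs.P_eq i (hij.trans hj), hs.Z_eq i (hij.trans hj), hs.W_eq i (hij.trans hj), hs.Z_eq j hj,
    hs.W_eq j hj]
  rw [Input.Z, Input.Z, Input.W, Input.W, ← Finset.sum_Ico_eq_sub _ hij,
    ← Finset.sum_Ico_eq_sub _ hij, Finset.sum_mul, ← Finset.sum_add_distrib]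
  exact Finset.sum_congr rfl fun l _ => by ring

@[simp] theorem blockZ_time (s : Sums ℝ) (i j : ℕ) (t : ℝ) : (blockZ s i j t).time = 10 := rfl

/-- The number of the interval with ratio `δ`, counted from `L` on, that contains `x`. -/
noncomputable def intervalIndex (δ L x : ℝ) : ℕ := max 1 ⌈Real.logb δ (x / L)⌉₊

theorem interval_val (δ L x : ℝ) : (interval δ L x).val = intervalIndex δ L x := rfl
theorem interval_time (δ L x : ℝ) : (interval δ L x).time = 3 := rfl
theorem cells_val (δ L U : ℝ) : (cells δ L U).val = ⌊Real.logb δ (U / L)⌋₊ + 2 := rfl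
@[simp] theorem cells_time (δ L U : ℝ) : (cells δ L U).time = 3 := rfl

theorem intervalIndex_lt {δ L x U : ℝ} (hδ : 1 < δ) (hL : 0 < L) (hx : L ≤ x) (hU : x ≤ U) :
    intervalIndex δ L x < (cells δ L U).val := by
  rw [cells_val, intervalIndex]
  have h : Real.logb δ (x / L) ≤ Real.logb δ (U / L) :=
    Real.logb_le_logb_of_le hδ (div_pos (hL.trans_le hx) hL) (by gcongr)
  have h2 := (Nat.ceil_mono h).trans (Nat.ceil_le_floor_add_one (Real.logb δ (U / L)))
  omega

/-- Numbers of the same interval differ by a factor of at most `δ`. -/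
theorem le_mul_of_intervalIndex_eq {δ L x y : ℝ} (hδ : 1 < δ) (hL : 0 < L) (hx : L ≤ x)
    (hy : L ≤ y) (h : intervalIndex δ L x = intervalIndex δ L y) : y ≤ δ * x := by
  have hx0 := hL.trans_le hx
  have hy0 := hL.trans_le hy
  have hlx : 0 ≤ Real.logb δ (x / L) := Real.logb_nonneg hδ ((one_le_div hL).2 hx)
  have key : Real.logb δ (y / L) ≤ Real.logb δ (x / L) + 1 := by
    have h1 := Nat.le_ceil (Real.logb δ (y / L))
    have h2 := Nat.ceil_lt_add_one hlx
    unfold intervalIndex at h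
    by_cases hc : ⌈Real.logb δ (y / L)⌉₊ ≤ 1
    · have : (⌈Real.logb δ (y / L)⌉₊ : ℝ) ≤ 1 := by exact_mod_cast hc
      linarith
    · have : ⌈Real.logb δ (y / L)⌉₊ = ⌈Real.logb δ (x / L)⌉₊ := by omega
      rw [this] at h1
      linarith
  have hδ0 : (0 : ℝ) < δ := one_pos.trans hδ
  have h3 : Real.logb δ (y / L) ≤ Real.logb δ (δ * (x / L)) := by
    rw [Real.logb_mul hδ0.ne' (div_pos hx0 hL).ne', Real.logb_self_eq_one hδ]
    linarith
  have h4 := (Real.logb_le_logb hδ (div_pos hy0 hL)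
    (mul_pos hδ0 (div_pos hx0 hL))).1 h3
  rw [← mul_div_assoc, div_le_div_iff_of_pos_right hL] at h4
  exact h4

/-- The box that a quadruple belongs to. -/
noncomputable def box (δ : ℝ) (g : Grid ℝ) (q : Quad ℝ) : ℕ × ℕ × ℕ :=
  (if q.l₁ ≤ 0 then 0 else intervalIndex δ g.L₁ q.l₁, intervalIndex δ g.L₂ q.l₂,
    intervalIndex δ g.L₃ q.z)

theorem store_val_eq (δ : ℝ) (g : Grid ℝ) (A : Table (Quad ℝ)) (q : Quad ℝ) :
    (store δ g A q).val = match A (box δ g q) with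
      | none => Function.update A (box δ g q) (some q)
      | some q' => if q.l₁ < q'.l₁ then Function.update A (box δ g q) (some q) else A := by
  have hb : (if q.l₁ ≤ 0 then 0 else intervalIndex δ g.L₁ q.l₁, intervalIndex δ g.L₂ q.l₂,
    intervalIndex δ g.L₃ q.z) = box δ g q := rfl
  simp only [store, lit_eq, val_bind, val_op, le_eq, val_ite, interval_val, getCell_eq,
    setCell_eq, lt_eq, decide_eq_true_eq, Nat.cast_zero, hb]
  cases A (box δ g q) with
  | none => rfl
  | some q' => simp only [val_bind, val_op, val_ite, decide_eq_true_eq, val_pure]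

theorem store_val (δ : ℝ) (g : Grid ℝ) (A : Table (Quad ℝ)) (q : Quad ℝ) :
    (store δ g A q).val = A ∨
      (store δ g A q).val = Function.update A (box δ g q) (some q) := by
  rw [store_val_eq]
  cases A (box δ g q) with
  | none => exact Or.inr rfl
  | some q' =>
    simp only
    split_ifs
    · exact Or.inr rfl
    · exact Or.inl rfl

/-- The box of `q` is occupied, by a quadruple whose `ℓ¹` is at most that of `q`. -/
def Covers (δ : ℝ) (g : Grid ℝ) (A : Table (Quad ℝ)) (q : Quad ℝ) : Prop :=
  ∃ q', A (box δ g q) = some q' ∧ q'.l₁ ≤ q.l₁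

theorem covers_store_self (δ : ℝ) (g : Grid ℝ) (A : Table (Quad ℝ)) (q : Quad ℝ) :
    Covers δ g (store δ g A q).val q := by
  rw [store_val_eq]
  cases hA : A (box δ g q) with
  | none => exact ⟨q, Function.update_self .., le_rfl⟩
  | some q' =>
    simp only
    split_ifs with h
    · exact ⟨q, Function.update_self .., le_rfl⟩
    · exact ⟨q', hA, not_lt.1 h⟩

theorem Covers.store {δ : ℝ} {g : Grid ℝ} {A : Table (Quad ℝ)} {q₀ : Quad ℝ}
    (h : Covers δ g A q₀) (q : Quad ℝ) : Covers δ g (store δ g A q).val q₀ := by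
  by_cases hb : box δ g q₀ = box δ g q
  · obtain ⟨q', hq', hle⟩ := covers_store_self δ g A q
    obtain ⟨q₁, hq₁, hle₁⟩ := h
    unfold Covers
    rw [store_val_eq, ← hb, hq₁]
    simp only
    split_ifs with hlt
    · exact ⟨q, Function.update_self .., hlt.le.trans hle₁⟩
    · exact ⟨q₁, hq₁, hle₁⟩
  · obtain ⟨q₁, hq₁, hle₁⟩ := h
    refine ⟨q₁, ?_, hle₁⟩
    rcases store_val δ g A q with h | h <;> rw [h]
    · exact hq₁
    · rw [Function.update_of_ne hb, hq₁]

/-- Every quadruple in the table lies in its own box and satisfies `V`. -/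
def TableOf (δ : ℝ) (g : Grid ℝ) (V : Quad ℝ → Prop) (A : Table (Quad ℝ)) : Prop :=
  ∀ i q, A i = some q → box δ g q = i ∧ V q

theorem tableOf_empty (δ : ℝ) (g : Grid ℝ) (V : Quad ℝ → Prop) :
    TableOf δ g V (fun _ => none) := fun _ _ h => by cases h

theorem TableOf.store {δ : ℝ} {g : Grid ℝ} {V : Quad ℝ → Prop} {A : Table (Quad ℝ)}
    (h : TableOf δ g V A) {q : Quad ℝ} (hq : V q) : TableOf δ g V (store δ g A q).val := by
  rcases store_val δ g A q with h' | h' <;> rw [h']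
  · exact h
  · intro i q₁ hi
    by_cases hb : i = box δ g q
    · subst hb
      rw [Function.update_self] at hi
      cases hi
      exact ⟨rfl, hq⟩
    · rw [Function.update_of_ne hb] at hi
      exact h i q₁ hi

theorem store_time_le (δ : ℝ) (g : Grid ℝ) (A : Table (Quad ℝ)) (q : Quad ℝ) :
    (store δ g A q).time ≤ 14 := by
  simp only [store, lit_eq, time_bind, val_bind, time_op, val_op, le_eq, time_ite, interval_time,
    getCell_eq, setCell_eq, lt_eq]
  split_ifs <;> split <;> simp only [time_bind, time_op, val_op, time_ite, time_pure] <;>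
    (try split_ifs) <;> omega

/-! ### Schedules described by plans -/

theorem expand_nil (J : Input ℝ) : (expand J []).val = (0, fun _ => 0) := by
  simp [expand]

theorem expand_cons (J : Input ℝ) (b : ℕ) (t : ℝ) (rest : List (ℕ × ℝ)) {j₀ : ℕ} {S : Arr ℝ}
    (h : (expand J rest).val = (j₀, S)) :
    (expand J ((b, t) :: rest)).val = (j₀ + b, fun i =>
      if j₀ ≤ i ∧ i < j₀ + b then t + (J.P i - J.P j₀) else S i) := by
  simp only [expand, val_bind, h, val_op, set_eq, get_eq, add_eq, val_pure, Prod.mk.injEq, true_and]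
  refine (loop_inv (fun m (x : Arr ℝ × ℝ) => x.2 = t + (J.P (j₀ + m) - J.P j₀) ∧
    x.1 = fun i => if j₀ ≤ i ∧ i < j₀ + m then t + (J.P i - J.P j₀) else S i) ?_ ?_).2
  · refine ⟨by simp, funext fun i => ?_⟩
    rw [if_neg (by omega)]
  · rintro m _ ⟨S', x⟩ ⟨rfl, rfl⟩
    refine ⟨?_, funext fun i => ?_⟩
    · simp only [val_bind, val_op, val_pure, ← add_assoc, J.P_succ]; ring
    · simp only [val_bind, val_op, val_pure, Function.update_apply]
      by_cases hi : i = j₀ + m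
      · rw [if_pos hi, if_pos (by omega), hi]
      · rw [if_neg hi]
        exact if_congr (by omega) rfl rfl

theorem expand_time (J : Input ℝ) (l : List (ℕ × ℝ)) :
    (expand J l).time = 1 + J.n + 5 * (expand J l).val.1 + l.length := by
  induction l with
  | nil => simp [expand]
  | cons x rest ih =>
    obtain ⟨b, t⟩ := x
    rw [expand_cons J b t rest rfl]
    have hl : ∀ (j₀ m : ℕ) (y : Arr ℝ × ℝ), (loop (fun i (x : Arr ℝ × ℝ) => do
        let j ← op (j₀ + i)
        let S ← set x.1 j x.2
        let pj ← get J.p j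
        let t ← add x.2 pj
        pure (S, t)) m y).time = 5 * m := by
      intro j₀ m y
      induction m with
      | zero => rfl
      | succ m ih => rw [loop_succ_time, ih]; simp; omega
    simp only [expand, time_bind, hl, ih, time_op, time_pure, List.length_cons]
    generalize (expand J rest).val.1 = x
    omega

/-- `value` computes the maximum time deviation, to which it adds the total weighted completion
time. -/
theorem value_spec {J : Input ℝ} {s : Sums ℝ} (hs : IsSums J s) (S : Arr ℝ) :
    ∃ D : ℝ, (value J s S).val = J.μ * D + ∑ i ∈ Finset.range J.n, J.w i * (S i + J.p i) ∧
      0 ≤ D ∧ (∀ i < J.n, |S i - J.P i| ≤ D) ∧ (D = 0 ∨ ∃ i < J.n, D = |S i - J.P i|) := by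
  simp only [value, lit_eq, val_bind, val_op, get_eq, add_eq, sub_eq, mul_eq]
  refine (fun h => ⟨_, by rw [h.1], h.2⟩) (loop_inv (fun m (x : ℝ × ℝ) =>
    x.2 = ∑ i ∈ Finset.range m, J.w i * (S i + J.p i) ∧ 0 ≤ x.1 ∧
      (∀ i < m, |S i - J.P i| ≤ x.1) ∧ (x.1 = 0 ∨ ∃ i < J.n, x.1 = |S i - J.P i|)) ?_ ?_)
  · simp
  · rintro m hm ⟨D, z⟩ ⟨hz, h0, h1, h2⟩
    have hd : max (S m + J.p m - s.P (m + 1)) (s.P (m + 1) - (S m + J.p m)) = |S m - J.P m| := by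
      rw [hs.P_eq (m + 1) hm, J.P_succ, abs_eq_max_neg]
      congr 1 <;> ring
    simp only [val_bind, val_op, val_pure, val_maxR] at hz h0 h1 h2 ⊢
    rw [hd]
    refine ⟨by rw [hz, Finset.sum_range_succ], h0.trans (le_max_left _ _), fun i hi => ?_, ?_⟩
    · rcases Nat.lt_succ_iff_lt_or_eq.1 hi with hi | rfl
      · exact (h1 i hi).trans (le_max_left _ _)
      · exact le_max_right _ _
    · rcases max_choice D |S m - J.P m| with h | h <;> rw [h]
      · exact h2
      · exact Or.inr ⟨m, hm, rfl⟩

theorem value_time_le (J : Input ℝ) (s : Sums ℝ) (S : Arr ℝ) :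
    (value J s S).time ≤ 13 * J.n + 3 := by
  simp only [value, lit_eq, time_bind, val_op, time_op, mul_eq, add_eq]
  refine le_trans (Nat.add_le_add_left (Nat.add_le_add_right
    (loop_time_le 12 fun i _ y => ?_) _) _) ?_
  · simp
  · omega

end Prog

/-! ### Partial schedules -/

namespace Prog

open Timed

/-- The starting times `S` give a schedule of the first `j` jobs, whose last completion times are
at most `l₁` before and `l₂` after the unavailable period, with total weighted completion time
`z`, in which the time deviation of every job is at most `K`. -/
structure IsPartial (J : Input ℝ) (K : ℝ) (j : ℕ) (l₁ l₂ z : ℝ) (S : ℕ → ℝ) : Prop where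
  le_n : j ≤ J.n
  l₁_nonneg : 0 ≤ l₁
  l₁_le : l₁ ≤ J.T₁
  le_l₂ : J.T₂ ≤ l₂
  l₂_le : l₂ ≤ J.T₂ + J.P j
  z_eq : z = ∑ i ∈ Finset.range j, J.w i * (S i + J.p i)
  start_nonneg : ∀ i < j, 0 ≤ S i
  start_le : ∀ i < j, S i ≤ J.T₂ + J.P i
  fits : ∀ i < j, S i + J.p i ≤ l₁ ∨ (J.T₂ ≤ S i ∧ S i + J.p i ≤ l₂)
  dev_le : ∀ i < j, |S i - J.P i| ≤ K
  disjoint : ∀ i < j, ∀ i' < i, S i + J.p i ≤ S i' ∨ S i' + J.p i' ≤ S i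

theorem isPartial_zero {J : Input ℝ} (hJ : J.Good) (K : ℝ) (S : ℕ → ℝ) :
    IsPartial J K 0 0 J.T₂ 0 S where
  le_n := Nat.zero_le _
  l₁_nonneg := le_rfl
  l₁_le := zero_le_one.trans hJ.one_le_T₁
  le_l₂ := le_rfl
  l₂_le := by simp
  z_eq := by simp
  start_nonneg := by simp
  start_le := by simp
  fits := by simp
  dev_le := by simp
  disjoint := by simp

/-- A partial schedule can be continued by a block of jobs that starts at time `t`, either before
the unavailable period or immediately after the jobs processed there. -/
theorem IsPartial.append {J : Input ℝ} (hJ : J.Good) {K : ℝ} {j : ℕ} {l₁ l₂ z : ℝ} {S : ℕ → ℝ}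
    (h : IsPartial J K j l₁ l₂ z S) {b : ℕ} (hb : j + b ≤ J.n) {t l₁' l₂' : ℝ}
    (hdev : |t - J.P j| ≤ K) (hT : l₁' ≤ J.T₁)
    (hc : (l₁ ≤ t ∧ l₁' = t + (J.P (j + b) - J.P j) ∧ l₂' = l₂) ∨
      (t = l₂ ∧ l₁' = l₁ ∧ l₂' = l₂ + (J.P (j + b) - J.P j))) :
    IsPartial J K (j + b) l₁' l₂'
      (z + ∑ i ∈ Finset.Ico j (j + b), J.w i * (t + (J.P (i + 1) - J.P j)))
      (fun i => if j ≤ i ∧ i < j + b then t + (J.P i - J.P j) else S i) := by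
  have hlen := hJ.P_mono (Nat.le_add_right j b) hb
  have hPj := hJ.P_nonneg h.le_n
  have hTT := hJ.T_lt
  have h0 := h.l₁_nonneg
  have h1 := h.le_l₂
  have h2 := h.l₂_le
  have h3 := hJ.one_le_T₁
  have h4 := h.l₁_le
  have new : ∀ i, j ≤ i → i < j + b → 0 ≤ J.P i - J.P j ∧ 0 ≤ J.P i ∧ 0 < J.p i ∧
      J.P i + J.p i ≤ J.P (j + b) := fun i hi hi' =>
    ⟨sub_nonneg.2 (hJ.P_mono hi (by omega)), hJ.P_nonneg (by omega), hJ.p_pos (by omega), by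
      rw [← J.P_succ]; exact hJ.P_mono hi' hb⟩
  have old : ∀ i, i < j + b → ¬(j ≤ i ∧ i < j + b) → i < j := fun i h1 h2 => by omega
  refine ⟨hb, ?_, hT, ?_, ?_, ?_, ?_, ?_, ?_, ?_, ?_⟩
  · rcases hc with ⟨_, _, _⟩ | ⟨_, _, _⟩ <;> linarith
  · rcases hc with ⟨_, _, _⟩ | ⟨_, _, _⟩ <;> linarith
  · rcases hc with ⟨_, _, _⟩ | ⟨_, _, _⟩ <;> linarith
  · rw [Finset.sum_range_add_sum_Ico _ (Nat.le_add_right j b) |>.symm, h.z_eq]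
    congr 1
    · refine Finset.sum_congr rfl fun i hi => ?_
      rw [if_neg (by have := Finset.mem_range.1 hi; omega)]
    · refine Finset.sum_congr rfl fun i hi => ?_
      rw [if_pos (Finset.mem_Ico.1 hi), J.P_succ]
      ring
  · intro i hi
    split_ifs with hc'
    · obtain ⟨n1, n2, n3, n4⟩ := new i hc'.1 hc'.2
      rcases hc with ⟨_, _, _⟩ | ⟨_, _, _⟩ <;> linarith
    · exact h.start_nonneg i (old i hi hc')
  · intro i hi
    split_ifs with hc'
    · obtain ⟨n1, n2, n3, n4⟩ := new i hc'.1 hc'.2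
      rcases hc with ⟨_, _, _⟩ | ⟨_, _, _⟩ <;> linarith
    · exact h.start_le i (old i hi hc')
  · intro i hi
    split_ifs with hc'
    · obtain ⟨n1, n2, n3, n4⟩ := new i hc'.1 hc'.2
      rcases hc with ⟨_, _, _⟩ | ⟨_, _, _⟩
      · left; linarith
      · right; constructor <;> linarith
    · rcases h.fits i (old i hi hc') with h' | ⟨h', h''⟩
      · left
        rcases hc with ⟨_, _, _⟩ | ⟨_, _, _⟩ <;> linarith
      · right
        refine ⟨h', ?_⟩
        rcases hc with ⟨_, _, _⟩ | ⟨_, _, _⟩ <;> linarith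
  · intro i hi
    split_ifs with hc'
    · rwa [show t + (J.P i - J.P j) - J.P i = t - J.P j by ring]
    · exact h.dev_le i (old i hi hc')
  · intro i hi i' hi'
    split_ifs with c1 c2 c2
    · right
      have := J.P_succ i'
      have := hJ.P_mono (Nat.succ_le_of_lt hi') (by omega)
      simp only [Nat.succ_eq_add_one] at this
      linarith
    · obtain ⟨n1, n2, n3, n4⟩ := new i c1.1 c1.2
      rcases h.fits i' (old i' (by omega) c2) with h' | ⟨h', h''⟩
      · right
        rcases hc with ⟨_, _, _⟩ | ⟨_, _, _⟩ <;> linarith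
      · rcases hc with ⟨_, _, _⟩ | ⟨_, _, _⟩
        · left; linarith
        · right; linarith
    · omega
    · exact h.disjoint i (old i hi c1) i' hi'

/-- A quadruple on the first `j` jobs that describes a schedule and respects the lower bounds from
which the boxes are counted. -/
structure IsEntry (J : Input ℝ) (K pmin : ℝ) (a j : ℕ) (q : Quad ℝ) : Prop where
  jobs : (expand J q.plan).val.1 = j
  isPartial : IsPartial J K j q.l₁ q.l₂ q.z (expand J q.plan).val.2
  l₁_pos : q.l₁ = 0 ∨ pmin ≤ q.l₁
  L₂_le : J.T₂ + J.p a ≤ q.l₂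
  L₃_le : J.Z a + J.w a * (J.T₂ + J.p a) ≤ q.z

/-- An entry of the table for the first `j` jobs: there has been no idle time so far, all jobs
before `a` have been processed before the unavailable period, and the plan is short. -/
structure IsStage (J : Input ℝ) (K pmin : ℝ) (a j : ℕ) (q : Quad ℝ) : Prop
    extends IsEntry J K pmin a j q where
  packed : q.l₁ + q.l₂ = J.T₂ + J.P j
  P_le : J.P a ≤ q.l₁
  length_le : q.plan.length ≤ j + 1

/-- An entry of the table of full schedules. -/
structure IsFull (J : Input ℝ) (K pmin : ℝ) (a : ℕ) (q : Quad ℝ) : Prop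
    extends IsEntry J K pmin a J.n q where
  length_le : q.plan.length ≤ J.n + 2

theorem IsEntry.append {J : Input ℝ} (hJ : J.Good) {K pmin : ℝ} {a j : ℕ} {q : Quad ℝ}
    (h : IsEntry J K pmin a j q) {b j' : ℕ} (hj' : j + b = j') (hb : j' ≤ J.n) {t l₁' l₂' z' : ℝ}
    (hdev : |t - J.P j| ≤ K) (hT : l₁' ≤ J.T₁)
    (hc : (q.l₁ ≤ t ∧ l₁' = t + (J.P j' - J.P j) ∧ l₂' = q.l₂) ∨
      (t = q.l₂ ∧ l₁' = q.l₁ ∧ l₂' = q.l₂ + (J.P j' - J.P j)))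
    (hl₁ : l₁' = 0 ∨ pmin ≤ l₁')
    (hz : z' = q.z + ∑ i ∈ Finset.Ico j j', J.w i * (t + (J.P (i + 1) - J.P j))) :
    IsEntry J K pmin a j' ⟨l₁', l₂', z', (b, t) :: q.plan⟩ := by
  subst hj'
  have he := expand_cons J b t q.plan
    (show (expand J q.plan).val = (j, (expand J q.plan).val.2) by rw [← h.jobs])
  have ht : 0 ≤ t := by
    have h1 := h.isPartial.l₁_nonneg
    have h2 := h.isPartial.le_l₂
    have h3 := hJ.one_le_T₁
    have h4 := hJ.T_lt
    rcases hc with ⟨_, _, _⟩ | ⟨_, _, _⟩ <;> linarith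
  have hlen := hJ.P_mono (Nat.le_add_right j b) hb
  refine ⟨by rw [he], ?_, hl₁, ?_, ?_⟩
  · rw [he, hz]
    exact h.isPartial.append hJ hb hdev hT hc
  · have := h.L₂_le
    rcases hc with ⟨_, _, _⟩ | ⟨_, _, _⟩ <;> simp only <;> linarith
  · refine h.L₃_le.trans ?_
    simp only [hz]
    refine le_add_of_nonneg_right (Finset.sum_nonneg fun i hi => ?_)
    rw [Finset.mem_Ico] at hi
    have h1 := hJ.P_mono (show j ≤ i + 1 by omega) (by omega)
    exact mul_nonneg (hJ.w_pos (by omega)).le (by linarith)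

/-- The grid used by `Approx(a, ε)`. -/
noncomputable def gridOf (J : Input ℝ) (s : Sums ℝ) (a : ℕ) : Grid ℝ :=
  ⟨s.pmin, J.T₂ + J.p a, J.Z a + J.w a * (J.T₂ + J.p a), (cells s.δ s.pmin J.T₁).val,
    (cells s.δ (J.T₂ + J.p a) (J.T₂ + J.P J.n)).val,
    (cells s.δ (J.Z a + J.w a * (J.T₂ + J.p a)) (J.Z J.n + J.W J.n * J.T₂)).val⟩

section

variable {J : Input ℝ} (hJ : J.Good) {s : Sums ℝ} (hs : IsSums J s)
include hJ hs

theorem IsSums.one_lt_δ : 1 < s.δ := hs.δ_eq ▸ hJ.one_lt_δ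

theorem IsSums.one_le_pmin : 1 ≤ s.pmin := by
  obtain ⟨i, hi, h⟩ := hs.pmin_mem
  exact h ▸ hJ.one_le_p i hi

omit hs in
theorem Input.Good.L₂_pos {a : ℕ} (ha : a < J.n) : 1 < J.T₂ + J.p a := by
  have h1 := hJ.one_le_T₁
  have h2 := hJ.T_lt
  have h3 := hJ.p_pos ha
  linarith

omit hs in
theorem Input.Good.Z_nonneg {a : ℕ} (ha : a ≤ J.n) : 0 ≤ J.Z a :=
  Finset.sum_nonneg fun i hi => by
    have := Finset.mem_range.1 hi
    exact mul_nonneg (hJ.w_pos (by omega)).le (hJ.P_nonneg (by omega))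

omit hs in
theorem Input.Good.one_lt_L₃ {a : ℕ} (ha : a < J.n) : 1 < J.Z a + J.w a * (J.T₂ + J.p a) := by
  have h1 := hJ.L₂_pos ha
  have h2 := hJ.one_le_w a ha
  have h3 := hJ.Z_nonneg ha.le
  nlinarith

/-- The boxes cover all quadruples that occur. -/
theorem IsEntry.box_lt {K : ℝ} {a j : ℕ} (ha : a < J.n) {q : Quad ℝ}
    (h : IsEntry J K s.pmin a j q) : (box s.δ (gridOf J s a) q).1 < (gridOf J s a).m₁ ∧
      (box s.δ (gridOf J s a) q).2.1 < (gridOf J s a).m₂ ∧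
      (box s.δ (gridOf J s a) q).2.2 < (gridOf J s a).m₃ := by
  have hδ := hs.one_lt_δ hJ
  have hp := hs.one_le_pmin hJ
  have hle := h.isPartial.le_n
  have hPn := hJ.P_mono hle le_rfl
  refine ⟨?_, ?_, ?_⟩
  · simp only [box, gridOf]
    split_ifs with h0
    · rw [cells_val]; omega
    · rcases h.l₁_pos with h1 | h1
      · exact absurd h1.le h0
      · exact intervalIndex_lt hδ (by linarith) h1 h.isPartial.l₁_le
  · exact intervalIndex_lt hδ (one_pos.trans (hJ.L₂_pos ha)) h.L₂_le
      (h.isPartial.l₂_le.trans (by linarith))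
  · refine intervalIndex_lt hδ (one_pos.trans (hJ.one_lt_L₃ ha)) h.L₃_le ?_
    rw [h.isPartial.z_eq, Input.Z, Input.W, Finset.sum_mul, ← Finset.sum_add_distrib]
    refine (Finset.sum_le_sum (g := fun i => J.w i * J.P (i + 1) + J.w i * J.T₂)
      fun i hi => ?_).trans (Finset.sum_le_sum_of_subset_of_nonneg (Finset.range_mono hle) ?_)
    · have hij := Finset.mem_range.1 hi
      rw [← mul_add]
      refine mul_le_mul_of_nonneg_left ?_ (hJ.w_pos (by omega)).le
      have := h.isPartial.start_le i hij
      rw [J.P_succ]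
      linarith
    · intro i hi _
      have hij := Finset.mem_range.1 hi
      have h1 := hJ.one_le_T₁
      have h2 := hJ.T_lt
      have h3 := hJ.P_nonneg (show i + 1 ≤ J.n by omega)
      have h4 := hJ.w_pos hij
      rw [← mul_add]
      exact mul_nonneg h4.le (by linarith)

/-- A table that covers an entry holds one that is no worse up to a factor of `δ`. -/
theorem Covers.exists_le {K : ℝ} {a j : ℕ} (ha : a < J.n) {V : Quad ℝ → Prop}
    (hV : ∀ q, V q → IsEntry J K s.pmin a j q) {A : Table (Quad ℝ)}
    (hA : TableOf s.δ (gridOf J s a) V A) {q : Quad ℝ} (hq : IsEntry J K s.pmin a j q)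
    (hc : Covers s.δ (gridOf J s a) A q) :
    ∃ i q', A i = some q' ∧ i.1 < (gridOf J s a).m₁ ∧ i.2.1 < (gridOf J s a).m₂ ∧
      i.2.2 < (gridOf J s a).m₃ ∧ V q' ∧ q'.l₁ ≤ q.l₁ ∧ q'.l₂ ≤ s.δ * q.l₂ ∧
      q'.z ≤ s.δ * q.z := by
  obtain ⟨q', hq', hle⟩ := hc
  obtain ⟨hb, hv⟩ := hA _ _ hq'
  obtain ⟨b1, b2, b3⟩ := hq.box_lt hJ hs ha
  have hδ := hs.one_lt_δ hJ
  have hL₂ := hJ.L₂_pos ha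
  have hL₃ := hJ.one_lt_L₃ ha
  have he := hV _ hv
  have hb' := hb.symm
  simp only [box, Prod.mk.injEq] at hb'
  exact ⟨_, q', hq', b1, b2, b3, hv, hle,
    le_mul_of_intervalIndex_eq hδ (show 0 < (gridOf J s a).L₂ from one_pos.trans hL₂) hq.L₂_le
      he.L₂_le hb'.2.1,
    le_mul_of_intervalIndex_eq hδ (show 0 < (gridOf J s a).L₃ from one_pos.trans hL₃) hq.L₃_le
      he.L₃_le hb'.2.2⟩

end

/-! ### The quadruples generated from a stored one -/

/-- The quadruple in which job `j` is added to the later schedule. -/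
noncomputable def lateQuad (J : Input ℝ) (j : ℕ) (q : Quad ℝ) : Quad ℝ :=
  ⟨q.l₁, q.l₂ + J.p j, q.z + J.w j * (q.l₂ + J.p j), (1, q.l₂) :: q.plan⟩

/-- The quadruple in which job `j` is added to the earlier schedule without idle time. -/
noncomputable def earlyQuad (J : Input ℝ) (j : ℕ) (q : Quad ℝ) : Quad ℝ :=
  ⟨q.l₁ + J.p j, q.l₂, q.z + J.w j * (q.l₁ + J.p j), (1, q.l₁) :: q.plan⟩

/-- The full schedule in which the jobs `j, …, m - 1` are processed in the earlier schedule with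
time deviation `K`, and all other remaining jobs in the later schedule. -/
noncomputable def idleQuad (J : Input ℝ) (K : ℝ) (m j : ℕ) (q : Quad ℝ) : Quad ℝ :=
  ⟨J.P m - K, q.l₂ + (J.P J.n - J.P m),
    q.z + ∑ i ∈ Finset.Ico j m, J.w i * (J.P (i + 1) - K) +
      ∑ i ∈ Finset.Ico m J.n, J.w i * (q.l₂ + (J.P (i + 1) - J.P m)),
    (J.n - m, q.l₂) :: (m - j, J.P j - K) :: q.plan⟩

/-- The full schedule in which all jobs from `m` on are processed in the later schedule. -/
noncomputable def finishQuad (J : Input ℝ) (m : ℕ) (q : Quad ℝ) : Quad ℝ :=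
  ⟨q.l₁, q.l₂ + (J.P J.n - J.P m),
    q.z + ∑ i ∈ Finset.Ico m J.n, J.w i * (q.l₂ + (J.P (i + 1) - J.P m)),
    (J.n - m, q.l₂) :: q.plan⟩

theorem extend_val {J : Input ℝ} {s : Sums ℝ} (hs : IsSums J s) (g : Grid ℝ) (K : ℝ) {m j : ℕ}
    (hjm : j < m) (hm : m ≤ J.n) (q : Quad ℝ) (AF : Table (Quad ℝ) × Table (Quad ℝ)) :
    (extend J s g K m j q AF).val =
      (if q.l₁ + J.p j ≤ J.T₁ ∧ J.P (j + 1) - (q.l₁ + J.p j) ≤ K then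
        (store s.δ g (store s.δ g AF.1 (lateQuad J j q)).val (earlyQuad J j q)).val
      else (store s.δ g AF.1 (lateQuad J j q)).val,
      if q.l₁ + J.p j < J.P (j + 1) - K ∧ J.P (j + 1) - K ≤ J.T₁ then
        (store s.δ g AF.2 (idleQuad J K m j q)).val
      else AF.2) := by
  have ht : J.P (j + 1) - K - J.p j = J.P j - K := by rw [J.P_succ]; ring
  have hl : J.P j - K + (J.P m - J.P j) = J.P m - K := by ring
  have hsum : ∑ l ∈ Finset.Ico j m, J.w l * (J.P j - K + (J.P (l + 1) - J.P j)) =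
      ∑ i ∈ Finset.Ico j m, J.w i * (J.P (i + 1) - K) :=
    Finset.sum_congr rfl fun i _ => by ring
  simp only [extend, get_eq, add_eq, mul_eq, sub_eq, le_eq, lt_eq, val_bind, val_op, val_ite,
    val_pure, Bool.and_eq_true, decide_eq_true_eq, hs.P_eq (j + 1) (hjm.trans_le hm),
    hs.P_eq j (hjm.le.trans hm), hs.P_eq m hm, hs.P_eq J.n le_rfl, blockZ_val hs hjm.le hm,
    blockZ_val hs hm le_rfl, ht, hl, hsum]
  simp only [lateQuad, earlyQuad, idleQuad]

theorem extend_time_le (J : Input ℝ) (s : Sums ℝ) (g : Grid ℝ) (K : ℝ) (m j : ℕ) (q : Quad ℝ)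
    (AF : Table (Quad ℝ) × Table (Quad ℝ)) : (extend J s g K m j q AF).time ≤ 100 := by
  simp only [extend, get_eq, add_eq, mul_eq, sub_eq, le_eq, lt_eq, val_op, time_bind,
    time_op, time_ite, time_pure, blockZ_time]
  have h := store_time_le s.δ g
  split_ifs <;> grind

theorem finish_val {J : Input ℝ} {s : Sums ℝ} (hs : IsSums J s) (g : Grid ℝ) {m : ℕ}
    (hm : m ≤ J.n) (q : Quad ℝ) (F : Table (Quad ℝ)) :
    (finish J s g m q F).val = (store s.δ g F (finishQuad J m q)).val := by
  simp only [finish, get_eq, add_eq, sub_eq, val_bind, val_op, hs.P_eq m hm, hs.P_eq J.n le_rfl,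
    blockZ_val hs hm le_rfl, finishQuad]

theorem finish_time_le (J : Input ℝ) (s : Sums ℝ) (g : Grid ℝ) (m : ℕ) (q : Quad ℝ)
    (F : Table (Quad ℝ)) : (finish J s g m q F).time ≤ 30 := by
  simp only [finish, get_eq, add_eq, sub_eq, val_op, time_bind, time_op, blockZ_time]
  have h := store_time_le s.δ g
  grind

end Prog

/-! ### Feasibility of the generated schedules -/

namespace Prog

open Timed

section

variable {J : Input ℝ} (hJ : J.Good) {s : Sums ℝ} (hs : IsSums J s) {K : ℝ} {a : ℕ}
  (hK : J.T₂ - J.P a ≤ K) {j : ℕ} {q : Quad ℝ}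

section

include hJ hK

/-- Since there is no idle time, a later job is delayed by `T₂ - ℓ¹`, which is at most `Δ_a`. -/
theorem IsStage.abs_l₂_sub_le {pmin : ℝ} (h : IsStage J K pmin a j q) :
    |q.l₂ - J.P j| ≤ K := by
  have h1 := h.packed
  have h2 := h.P_le
  have h3 := h.isPartial.l₁_le
  have h4 := hJ.T_lt
  rw [abs_le]
  constructor <;> linarith

theorem IsStage.late {pmin : ℝ} (h : IsStage J K pmin a j q) (hj : j < J.n) :
    IsStage J K pmin a (j + 1) (lateQuad J j q) := by
  refine ⟨h.toIsEntry.append hJ rfl hj (h.abs_l₂_sub_le hJ hK) h.isPartial.l₁_le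
    (Or.inr ⟨rfl, rfl, ?_⟩) h.l₁_pos ?_, ?_, h.P_le, ?_⟩
  · rw [J.P_succ]; ring
  · simp [J.P_succ]
  · have := h.packed
    simp only [lateQuad, J.P_succ]
    linarith
  · simpa [lateQuad] using h.length_le

theorem IsStage.finish {pmin : ℝ} (h : IsStage J K pmin a j q) :
    IsFull J K pmin a (finishQuad J j q) := by
  have hj := h.isPartial.le_n
  refine ⟨h.toIsEntry.append hJ (by omega) le_rfl (h.abs_l₂_sub_le hJ hK) h.isPartial.l₁_le
    (Or.inr ⟨rfl, rfl, rfl⟩) h.l₁_pos rfl, ?_⟩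
  have := h.length_le
  simp only [finishQuad, List.length_cons]
  omega

end

include hJ hs

theorem IsStage.early (h : IsStage J K s.pmin a j q) (hj : j < J.n) (hT : q.l₁ + J.p j ≤ J.T₁)
    (hd : J.P (j + 1) - (q.l₁ + J.p j) ≤ K) :
    IsStage J K s.pmin a (j + 1) (earlyQuad J j q) := by
  have hp := hJ.p_pos hj
  have h0 := h.isPartial.l₁_nonneg
  have hpk := h.packed
  have hl₂ := h.isPartial.le_l₂
  have hPa := h.P_le
  have hP := J.P_succ j
  refine ⟨h.toIsEntry.append hJ rfl hj ?_ hT (Or.inl ⟨le_rfl, ?_, rfl⟩)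
    (Or.inr ?_) ?_, ?_, ?_, ?_⟩
  · rw [abs_le]
    constructor <;> linarith
  · rw [J.P_succ]; ring
  · have := hs.pmin_le j hj
    linarith
  · simp [J.P_succ]
  · simp only [earlyQuad]
    linarith
  · simp only [earlyQuad]
    linarith
  · simpa [earlyQuad] using h.length_le

include hK

theorem IsStage.idle (h : IsStage J K s.pmin a j q) {m : ℕ} (hjm : j < m) (hm : m ≤ J.n)
    (hmT : J.P m - K ≤ J.T₁) (hlt : q.l₁ + J.p j < J.P (j + 1) - K) :
    IsFull J K s.pmin a (idleQuad J K m j q) := by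
  have hPa := h.P_le
  have hl := h.isPartial.l₁_le
  have hTT := hJ.T_lt
  have hP := J.P_succ j
  have hpk := h.packed
  have hl₁ := h.isPartial.l₁_nonneg
  have hK0 : 0 ≤ K := by linarith
  have hPm := hJ.P_mono (Nat.succ_le_of_lt hjm) hm
  simp only [Nat.succ_eq_add_one] at hPm
  have hp := hJ.p_pos (hjm.trans_le hm)
  have e₁ : IsEntry J K s.pmin a m ⟨J.P m - K, q.l₂,
      q.z + ∑ i ∈ Finset.Ico j m, J.w i * (J.P (i + 1) - K), (m - j, J.P j - K) :: q.plan⟩ := by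
    refine h.toIsEntry.append hJ (by omega) hm ?_ hmT (Or.inl ⟨?_, ?_, rfl⟩) (Or.inr ?_) ?_
    · rw [show J.P j - K - J.P j = -K by ring, abs_neg, abs_of_nonneg hK0]
    · linarith
    · ring
    · have := hs.pmin_le j (hjm.trans_le hm)
      linarith
    · congr 1
      exact Finset.sum_congr rfl fun i _ => by ring
  refine ⟨e₁.append hJ (by omega) le_rfl ?_ hmT (Or.inr ⟨rfl, rfl, rfl⟩) e₁.l₁_pos rfl, ?_⟩
  · rw [abs_le]
    constructor <;> linarith
  · have := h.length_le
    simp only [idleQuad, List.length_cons]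
    omega

/-- The quadruple from which `Approx(a, ε)` starts. -/
noncomputable def startQuad (J : Input ℝ) (a : ℕ) : Quad ℝ :=
  ⟨J.P a, J.T₂ + J.p a, J.Z a + J.w a * (J.T₂ + J.p a), [(1, J.T₂), (a, 0)]⟩

theorem isStage_startQuad (ha : a < J.n) (hPa : J.P a ≤ J.T₁) :
    IsStage J K s.pmin a (a + 1) (startQuad J a) := by
  have hK0 : 0 ≤ K := by have := hJ.T_lt; linarith
  have hPa0 := hJ.P_nonneg ha.le
  have e₀ : (expand J []).val = (0, fun _ => 0) := expand_nil J
  have e₁ := expand_cons J a 0 [] e₀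
  have e₂ := expand_cons J 1 J.T₂ _ e₁
  have p₁ := (isPartial_zero hJ K fun _ => 0).append hJ (b := a) (t := 0) (l₁' := J.P a)
    (l₂' := J.T₂) (by omega) (by simpa using hK0) hPa
    (Or.inl ⟨le_rfl, by simp, rfl⟩)
  have p₂ := p₁.append hJ (b := 1) (t := J.T₂) (l₁' := J.P a) (l₂' := J.T₂ + J.p a) (by omega)
    (by
      rw [zero_add, abs_le]
      have := hJ.T_lt
      constructor <;> linarith) hPa
    (Or.inr ⟨rfl, rfl, by simp [J.P_succ]⟩)
  have hz : (0 + ∑ i ∈ Finset.Ico 0 (0 + a), J.w i * (0 + (J.P (i + 1) - J.P 0)) +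
      ∑ i ∈ Finset.Ico (0 + a) (0 + a + 1), J.w i * (J.T₂ + (J.P (i + 1) - J.P (0 + a)))) =
      J.Z a + J.w a * (J.T₂ + J.p a) := by
    simp [J.P_succ, Input.Z]
  rw [hz] at p₂
  have hn : 0 + a + 1 = a + 1 := by omega
  refine ⟨⟨by simp only [startQuad]; rw [e₂, hn], ?_, ?_, le_rfl, le_rfl⟩, ?_, le_rfl, by
    simp [startQuad]⟩
  · simp only [startQuad]
    rw [e₂]
    rw [hn] at p₂ ⊢
    exact p₂
  · rcases Nat.eq_zero_or_pos a with rfl | h0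
    · exact Or.inl rfl
    · right
      have h1 := hJ.P_mono (show 1 ≤ a from h0) ha.le
      have h2 := hs.pmin_le 0 hJ.n_pos
      rw [show (1 : ℕ) = 0 + 1 from rfl, J.P_succ, J.P_zero] at h1
      simp only [startQuad]
      linarith
  · simp only [startQuad, J.P_succ]
    ring

end

/-! ### The tables -/

/-- The tables of `Approx(a, ε)` when the first `j` jobs have been assigned. -/
def IsTables (J : Input ℝ) (s : Sums ℝ) (K : ℝ) (a j : ℕ)
    (AF : Table (Quad ℝ) × Table (Quad ℝ)) : Prop :=
  TableOf s.δ (gridOf J s a) (IsStage J K s.pmin a j) AF.1 ∧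
    TableOf s.δ (gridOf J s a) (IsFull J K s.pmin a) AF.2

theorem IsTables.extend {J : Input ℝ} (hJ : J.Good) {s : Sums ℝ} (hs : IsSums J s) {K : ℝ} {a : ℕ}
    (hK : J.T₂ - J.P a ≤ K) {m j : ℕ} (hjm : j < m) (hm : m ≤ J.n) (hmT : J.P m - K ≤ J.T₁)
    {q : Quad ℝ} (hq : IsStage J K s.pmin a j q) {AF : Table (Quad ℝ) × Table (Quad ℝ)}
    (h : IsTables J s K a (j + 1) AF) :
    IsTables J s K a (j + 1) (extend J s (gridOf J s a) K m j q AF).val := by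
  rw [extend_val hs _ _ hjm hm]
  have hj := hjm.trans_le hm
  constructor
  · dsimp only
    have h' := h.1.store (hq.late hJ hK hj)
    split_ifs with hc
    · exact h'.store (hq.early hJ hs hj hc.1 hc.2)
    · exact h'
  · dsimp only
    split_ifs with hc
    · exact h.2.store (hq.idle hJ hs hK hjm hm hmT hc.1)
    · exact h.2

/-- One iteration of the main loop of `Approx(a, ε)`: assign job `j`. -/
noncomputable def assignJob (J : Input ℝ) (s : Sums ℝ) (g : Grid ℝ) (K : ℝ) (m j : ℕ)
    (AF : Table (Quad ℝ) × Table (Quad ℝ)) : Timed (Table (Quad ℝ) × Table (Quad ℝ)) := do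
  let j ← op j
  let B ← newTable (Quad ℝ) g.m₁ g.m₂ g.m₃
  scan g.m₁ g.m₂ g.m₃ AF.1 (Prog.extend J s g K m j) (B, AF.2)

theorem assignJob_val (J : Input ℝ) (s : Sums ℝ) (g : Grid ℝ) (K : ℝ) (m j : ℕ)
    (AF : Table (Quad ℝ) × Table (Quad ℝ)) : (assignJob J s g K m j AF).val =
      (scan g.m₁ g.m₂ g.m₃ AF.1 (Prog.extend J s g K m j) (fun _ => none, AF.2)).val := by
  simp only [assignJob, val_bind, val_op, val_newTable]

/-- One iteration of the search for a best full schedule. -/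
noncomputable def keepBetter (q : Quad ℝ) (best : Option (Quad ℝ)) : Timed (Option (Quad ℝ)) :=
  match best with
  | none => op (some q)
  | some q' => do
      if ← lt q.z q'.z then op (some q) else pure (some q')

/-- The number `m` of `Approx(a, ε)` with bound `K`: only jobs before it may be early. -/
noncomputable def earlyBound (J : Input ℝ) (s : Sums ℝ) (a : ℕ) (K : ℝ) : ℕ :=
  max (countEarly J s K).val (a + 1)

/-- The tables of `Approx(a, ε)` after the main loop. -/
noncomputable def finalTables (J : Input ℝ) (s : Sums ℝ) (a : ℕ) (K : ℝ) :
    Timed (Table (Quad ℝ) × Table (Quad ℝ)) :=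
  loop (fun i => assignJob J s (gridOf J s a) K (earlyBound J s a K) (a + 1 + i))
    (earlyBound J s a K - (a + 1))
    ((store s.δ (gridOf J s a) (fun _ => none) (startQuad J a)).val, fun _ => none)

/-- All full schedules that `Approx(a, ε)` stores. -/
noncomputable def fullTable (J : Input ℝ) (s : Sums ℝ) (a : ℕ) (K : ℝ) : Timed (Table (Quad ℝ)) :=
  scan (gridOf J s a).m₁ (gridOf J s a).m₂ (gridOf J s a).m₃ (finalTables J s a K).val.1
    (finish J s (gridOf J s a) (earlyBound J s a K)) (finalTables J s a K).val.2

theorem approx_val {J : Input ℝ} {s : Sums ℝ} (hs : IsSums J s) {a : ℕ} (ha : a < J.n) (K : ℝ) :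
    (approx J s a K).val = (scan (gridOf J s a).m₁ (gridOf J s a).m₂ (gridOf J s a).m₃
      (fullTable J s a K).val keepBetter none).val := by
  have h1 := hs.P_eq a ha.le
  have h2 := hs.Z_eq a ha.le
  have h3 := hs.P_eq _ le_rfl
  have h4 := hs.W_eq _ le_rfl
  have h5 := hs.Z_eq _ le_rfl
  simp only [approx, val_bind, val_op, get_eq, add_eq, mul_eq, lit_eq, val_newTable, h1, h2, h3,
    h4, h5, Nat.cast_zero, fullTable, finalTables, earlyBound, gridOf, startQuad]
  congr 1
  congr 1
  funext q best
  cases best <;> rfl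

theorem assignJob_time_le (J : Input ℝ) (s : Sums ℝ) (a : ℕ) (K : ℝ) (m j : ℕ)
    (AF : Table (Quad ℝ) × Table (Quad ℝ)) :
    (assignJob J s (gridOf J s a) K m j AF).time ≤
      (gridOf J s a).m₁ * (gridOf J s a).m₂ * (gridOf J s a).m₃ * 105 + 1 := by
  have h := scan_time_le (m₁ := (gridOf J s a).m₁) (m₂ := (gridOf J s a).m₂)
    (m₃ := (gridOf J s a).m₃) (A := AF.1) (b := (fun _ => none, AF.2)) 100 (Nat.succ_pos _)
    (Nat.succ_pos _) fun q y => extend_time_le J s (gridOf J s a) K m j q y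
  simp only [assignJob, time_bind, val_op, time_op, val_newTable, time_newTable]
  omega

theorem approx_time_le {J : Input ℝ} (hJ : J.Good) {s : Sums ℝ} (hs : IsSums J s) {a : ℕ}
    (ha : a < J.n) (K : ℝ) :
    (approx J s a K).time ≤ 200 * J.n *
      ((gridOf J s a).m₁ * (gridOf J s a).m₂ * (gridOf J s a).m₃) := by
  have hm := (countEarly_spec hJ hs K).1
  have hsum : ∀ {c M st l f z c' st' l' f' z' : ℕ}, c ≤ c' → st ≤ st' → l ≤ l' → f ≤ f' → z ≤ z' →
      c + (1 + (1 + (1 + (1 + (1 + (1 + (1 + (1 + (1 + (1 + (1 + (1 + (1 + (1 + (1 + (3 + (3 +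
      (3 + (1 + (M + (M + (st + (1 + (l + (f + z))))))))))))))))))))))))) ≤
      c' + st' + l' + f' + z' + 26 + 2 * M := by
    intros; linarith
  have h₁ : 0 < (gridOf J s a).m₁ := Nat.succ_pos _
  have h₂ : 0 < (gridOf J s a).m₂ := Nat.succ_pos _
  have h₃ : 0 < (gridOf J s a).m₃ := Nat.succ_pos _
  simp only [approx, time_bind, val_op, time_op, get_eq, add_eq, mul_eq, lit_eq, val_newTable,
    time_newTable, cells_time]
  have hPa := hs.P_eq a ha.le
  have hZa := hs.Z_eq a ha.le
  have hPn := hs.P_eq _ le_rfl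
  have hWn := hs.W_eq _ le_rfl
  have hZn := hs.Z_eq _ le_rfl
  rw [hZa, hPn, hWn, hZn]
  refine (hsum (countEarly_time_le J s K) (store_time_le _ _ _ _)
    (loop_time_le _ fun i _ y => assignJob_time_le J s a K
      (max (countEarly J s K).val (a + 1)) (a + 1 + i) y)
    (scan_time_le 30 h₂ h₃ fun q y => finish_time_le J s _ _ q y)
    (scan_time_le 2 h₂ h₃ fun q y => ?_)).trans ?_
  · cases y with
    | none => simp
    | some q' =>
      simp only [lt_eq, time_bind, time_op, val_op, time_ite, time_pure]
      split_ifs <;> simp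
  · change _ + _ + _ * ((gridOf J s a).m₁ * (gridOf J s a).m₂ * (gridOf J s a).m₃ * _ + _ + _) +
      (gridOf J s a).m₁ * (gridOf J s a).m₂ * (gridOf J s a).m₃ * _ +
      (gridOf J s a).m₁ * (gridOf J s a).m₂ * (gridOf J s a).m₃ * _ + 26 +
      2 * ((gridOf J s a).m₁ * (gridOf J s a).m₂ * (gridOf J s a).m₃) ≤ _
    have hM := Nat.mul_pos (Nat.mul_pos h₁ h₂) h₃
    generalize (gridOf J s a).m₁ * (gridOf J s a).m₂ * (gridOf J s a).m₃ = M at hM ⊢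
    have hst : max (countEarly J s K).val (a + 1) - (a + 1) ≤ J.n := by omega
    have hn := hJ.n_pos
    refine (Nat.add_le_add_right (Nat.add_le_add_right (Nat.add_le_add_right
      (Nat.add_le_add_right (Nat.add_le_add_left (Nat.mul_le_mul_right _ hst) _) _) _) _) _).trans
      ?_
    have h1 : J.n ≤ J.n * M := Nat.le_mul_of_pos_right _ hM
    have h2 : M ≤ J.n * M := Nat.le_mul_of_pos_left _ hn
    nlinarith

end Prog

/-! ### Comparison with a target schedule -/

namespace Prog

open Timed

/-- Total processing time of the jobs of `E` among the first `j` jobs. -/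
noncomputable def earlyLen (J : Input ℝ) (E : Finset ℕ) (j : ℕ) : ℝ :=
  ∑ i ∈ Finset.range j, if i ∈ E then J.p i else 0

/-- Completion time of job `i` when the jobs of `E` are processed before and the other jobs after
the unavailable period, both in WSPT order, and every job of `E` starts as early as the bound `K`
on the time deviation permits. -/
noncomputable def targetC (J : Input ℝ) (K : ℝ) (E : Finset ℕ) (i : ℕ) : ℝ :=
  if i ∈ E then max (earlyLen J E (i + 1)) (J.P (i + 1) - K)
  else J.T₂ + (J.P (i + 1) - earlyLen J E (i + 1))

/-- Total weighted completion time of the first `j` jobs for the completion times `targetC`. -/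
noncomputable def targetZ (J : Input ℝ) (K : ℝ) (E : Finset ℕ) (j : ℕ) : ℝ :=
  ∑ i ∈ Finset.range j, J.w i * targetC J K E i

/-- The jobs of `E` can be processed before the unavailable period, with time deviations of at most
`K`, and `a` is the first job not in `E`. -/
structure IsTarget (J : Input ℝ) (K : ℝ) (a : ℕ) (E : Finset ℕ) : Prop where
  lt_n : a < J.n
  mem_of_lt : ∀ i < a, i ∈ E
  not_mem : a ∉ E
  earlyLen_le : earlyLen J E J.n ≤ J.T₁
  near : ∀ i ∈ E, i < J.n → J.P (i + 1) - K ≤ J.T₁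

theorem earlyLen_succ_of_mem {J : Input ℝ} {E : Finset ℕ} {j : ℕ} (h : j ∈ E) :
    earlyLen J E (j + 1) = earlyLen J E j + J.p j := by
  rw [earlyLen, Finset.sum_range_succ, if_pos h, earlyLen]

theorem earlyLen_succ_of_not_mem {J : Input ℝ} {E : Finset ℕ} {j : ℕ} (h : j ∉ E) :
    earlyLen J E (j + 1) = earlyLen J E j := by
  rw [earlyLen, Finset.sum_range_succ, if_neg h, add_zero, earlyLen]

theorem targetZ_succ (J : Input ℝ) (K : ℝ) (E : Finset ℕ) (j : ℕ) :
    targetZ J K E (j + 1) = targetZ J K E j + J.w j * targetC J K E j :=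
  Finset.sum_range_succ _ _

theorem earlyLen_eq_P {J : Input ℝ} {E : Finset ℕ} {j : ℕ} (h : ∀ i < j, i ∈ E) :
    earlyLen J E j = J.P j :=
  Finset.sum_congr rfl fun i hi => if_pos (h i (Finset.mem_range.1 hi))

section

variable {J : Input ℝ} (hJ : J.Good) {K : ℝ} {a : ℕ} {E : Finset ℕ}
include hJ

theorem earlyLen_mono {i j : ℕ} (hij : i ≤ j) (hj : j ≤ J.n) :
    earlyLen J E i ≤ earlyLen J E j :=
  Finset.sum_le_sum_of_subset_of_nonneg (Finset.range_mono hij) fun l hl _ => by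
    have := hJ.p_pos ((Finset.mem_range.1 hl).trans_le hj)
    split_ifs <;> simp [this.le]

theorem earlyLen_nonneg {j : ℕ} (hj : j ≤ J.n) : 0 ≤ earlyLen J E j :=
  earlyLen_mono (E := E) hJ (Nat.zero_le j) hj

/-- The total length of the later jobs grows with the number of jobs. -/
theorem sub_earlyLen_mono {i j : ℕ} (hij : i ≤ j) (hj : j ≤ J.n) :
    J.P i - earlyLen J E i ≤ J.P j - earlyLen J E j := by
  have h : ∀ l, J.P l - earlyLen J E l = ∑ x ∈ Finset.range l, if x ∈ E then 0 else J.p x := by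
    intro l
    rw [Input.P, earlyLen, ← Finset.sum_sub_distrib]
    exact Finset.sum_congr rfl fun x _ => by split_ifs <;> simp
  rw [h, h]
  refine Finset.sum_le_sum_of_subset_of_nonneg (Finset.range_mono hij) fun l hl _ => ?_
  have := hJ.p_pos ((Finset.mem_range.1 hl).trans_le hj)
  split_ifs <;> simp [this.le]

theorem earlyLen_le_P {j : ℕ} (hj : j ≤ J.n) : earlyLen J E j ≤ J.P j := by
  have := sub_earlyLen_mono (E := E) hJ (Nat.zero_le j) hj
  simp only [Input.P_zero, earlyLen, Finset.range_zero, Finset.sum_empty, sub_self] at this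
  rw [earlyLen]
  linarith

theorem targetC_nonneg {i : ℕ} (hi : i < J.n) : 0 ≤ targetC J K E i := by
  unfold targetC
  split_ifs
  · exact (earlyLen_nonneg hJ hi).trans (le_max_left _ _)
  · have h1 := earlyLen_le_P (E := E) hJ (show i + 1 ≤ J.n from hi)
    have h2 := hJ.one_le_T₁
    have h3 := hJ.T_lt
    linarith

/-- The quadruple `q` is as good as the target schedule on the first `j` jobs, up to a factor of
`D` in `ℓ²` and `Z`. -/
def Follows (J : Input ℝ) (K : ℝ) (E : Finset ℕ) (D : ℝ) (j : ℕ) (q : Quad ℝ) : Prop :=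
  q.l₁ ≤ earlyLen J E j ∧ q.l₂ ≤ D * (J.T₂ + (J.P j - earlyLen J E j)) ∧
    q.z ≤ D * targetZ J K E j

variable {D : ℝ} (hD : 1 ≤ D) {j : ℕ} {q : Quad ℝ} (h : Follows J K E D j q)
include hD h

theorem Follows.late (hj : j < J.n) (hE : j ∉ E) :
    Follows J K E D (j + 1) (lateQuad J j q) := by
  obtain ⟨h1, h2, h3⟩ := h
  have hp := hJ.p_pos hj
  have hw := hJ.w_pos hj
  have hl : q.l₂ + J.p j ≤ D * (J.T₂ + (J.P (j + 1) - earlyLen J E (j + 1))) := by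
    rw [earlyLen_succ_of_not_mem hE, J.P_succ]
    nlinarith
  refine ⟨?_, hl, ?_⟩
  · rw [earlyLen_succ_of_not_mem hE]
    exact h1
  · have := mul_le_mul_of_nonneg_left hl hw.le
    rw [targetZ_succ, targetC, if_neg hE]
    simp only [lateQuad]
    linarith

theorem Follows.early (hj : j < J.n) (hE : j ∈ E) :
    Follows J K E D (j + 1) (earlyQuad J j q) := by
  obtain ⟨h1, h2, h3⟩ := h
  have hw := hJ.w_pos hj
  refine ⟨?_, ?_, ?_⟩
  · rw [earlyLen_succ_of_mem hE]
    exact add_le_add_left h1 _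
  · rw [earlyLen_succ_of_mem hE, J.P_succ]
    rwa [add_sub_add_right_eq_sub]
  · have hC := targetC_nonneg (K := K) (E := E) hJ hj
    have h4 : q.l₁ + J.p j ≤ targetC J K E j := by
      rw [targetC, if_pos hE, earlyLen_succ_of_mem hE]
      exact (add_le_add_left h1 _).trans (le_max_left _ _)
    have h5 : J.w j * (q.l₁ + J.p j) ≤ D * (J.w j * targetC J K E j) :=
      (mul_le_mul_of_nonneg_left h4 hw.le).trans (le_mul_of_one_le_left (by positivity) hD)
    rw [targetZ_succ]
    simp only [earlyQuad]
    linarith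

/-- All jobs after the first `m` ones being late in the target schedule, they are completed at the
same time differences there as in a block. -/
theorem Follows.block_le {m : ℕ} (hjm : j ≤ m) (hm : m ≤ J.n)
    (hE : ∀ i ∈ E, i < J.n → i < m) :
    ∑ i ∈ Finset.Ico m J.n, J.w i * (q.l₂ + (J.P (i + 1) - J.P m)) ≤
      D * ∑ i ∈ Finset.Ico m J.n, J.w i * targetC J K E i := by
  rw [Finset.mul_sum]
  refine Finset.sum_le_sum fun i hi => ?_
  obtain ⟨hmi, hin⟩ := Finset.mem_Ico.1 hi
  have hnot : ∀ l, m ≤ l → l < J.n → l ∉ E := fun l hl hl' hlE => by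
    have := hE l hlE hl'
    omega
  have he : ∀ l, m ≤ l → l ≤ J.n → earlyLen J E l = earlyLen J E m := by
    intro l hl
    induction l, hl using Nat.le_induction with
    | base => exact fun _ => rfl
    | succ l hl ih =>
      intro hln
      rw [earlyLen_succ_of_not_mem (hnot l hl hln), ih (by omega)]
  have h1 := sub_earlyLen_mono (E := E) hJ hjm hm
  have h2 := hJ.P_mono (show m ≤ i + 1 by omega) hin
  have h3 := h.2.1
  rw [targetC, if_neg (hnot i hmi hin), he (i + 1) (by omega) hin]
  have h4 : q.l₂ + (J.P (i + 1) - J.P m) ≤ D * (J.T₂ + (J.P (i + 1) - earlyLen J E m)) := by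
    nlinarith
  calc _ ≤ J.w i * (D * (J.T₂ + (J.P (i + 1) - earlyLen J E m))) :=
        mul_le_mul_of_nonneg_left h4 (hJ.w_pos hin).le
    _ = _ := by ring

omit hJ hD h in
theorem targetZ_add_sum_Ico {m : ℕ} (hjm : j ≤ m) :
    targetZ J K E j + ∑ i ∈ Finset.Ico j m, J.w i * targetC J K E i = targetZ J K E m :=
  Finset.sum_range_add_sum_Ico _ hjm

theorem Follows.finish (hj : j ≤ J.n) (hE : ∀ i ∈ E, i < J.n → i < j) :
    (finishQuad J j q).z ≤ D * targetZ J K E J.n := by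
  have h1 := h.block_le hJ hD le_rfl hj hE
  have h2 := h.2.2
  rw [← targetZ_add_sum_Ico hj]
  simp only [finishQuad]
  linarith

/-- The jobs completed with time deviation `K` before the unavailable period cannot be completed
earlier in the target schedule. -/
theorem Follows.idle {m : ℕ} (hjm : j < m) (hm : m ≤ J.n) (hE : ∀ i ∈ E, i < J.n → i < m)
    (hmT : J.P m - K ≤ J.T₁) : (idleQuad J K m j q).z ≤ D * targetZ J K E J.n := by
  have h1 := h.block_le hJ hD hjm.le hm hE
  have h2 := h.2.2
  have h3 : ∑ i ∈ Finset.Ico j m, J.w i * (J.P (i + 1) - K) ≤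
      D * ∑ i ∈ Finset.Ico j m, J.w i * targetC J K E i := by
    rw [Finset.mul_sum]
    refine Finset.sum_le_sum fun i hi => ?_
    obtain ⟨hji, him⟩ := Finset.mem_Ico.1 hi
    have hin := him.trans_le hm
    have hC : J.P (i + 1) - K ≤ targetC J K E i := by
      unfold targetC
      split_ifs
      · exact le_max_right _ _
      · have h4 := hJ.P_mono (Nat.succ_le_of_lt him) hm
        have h5 := earlyLen_le_P (E := E) hJ (show i + 1 ≤ J.n from hin)
        have h6 := hJ.T_lt
        simp only [Nat.succ_eq_add_one] at h4
        linarith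
    have hw := hJ.w_pos hin
    have hC0 := targetC_nonneg (K := K) (E := E) hJ hin
    exact (mul_le_mul_of_nonneg_left hC hw.le).trans
      (le_mul_of_one_le_left (by positivity) hD)
  rw [← targetZ_add_sum_Ico hm, ← targetZ_add_sum_Ico hjm.le]
  simp only [idleQuad]
  linarith

end

section

variable {J : Input ℝ} (hJ : J.Good) {s : Sums ℝ} (hs : IsSums J s) {K : ℝ} {a : ℕ}
  (hK : J.T₂ - J.P a ≤ K)
include hJ hs

theorem earlyBound_le (ha : a < J.n) (K : ℝ) : earlyBound J s a K ≤ J.n :=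
  max_le (countEarly_spec hJ hs K).1 ha

/-- If there is a job to be assigned, then the last one that may be early can be completed
by `T₁`. -/
theorem P_earlyBound_sub_le {j : ℕ} (hj : a + 1 ≤ j) (hjm : j < earlyBound J s a K) :
    J.P (earlyBound J s a K) - K ≤ J.T₁ := by
  have hc := countEarly_spec hJ hs K
  have hm : earlyBound J s a K = (countEarly J s K).val := by
    rw [earlyBound, lt_max_iff] at hjm
    rw [earlyBound, max_eq_left]
    omega
  rw [hm] at hjm ⊢
  obtain ⟨c, hc'⟩ := Nat.exists_eq_succ_of_ne_zero (Nat.ne_zero_of_lt hjm)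
  rw [hc'] at hc ⊢
  exact (hc.2 c (by omega)).1 (by omega)

theorem IsTarget.lt_earlyBound {E : Finset ℕ} (hE : IsTarget J K a E) :
    ∀ i ∈ E, i < J.n → i < earlyBound J s a K := fun i hi hin =>
  (((countEarly_spec hJ hs K).2 i hin).2 (hE.near i hi hin)).trans_le (le_max_left _ _)

include hK

theorem isTables_assignJob {j : ℕ} (ha : a < J.n) (hj : a + 1 ≤ j) (hjm : j < earlyBound J s a K)
    {AF : Table (Quad ℝ) × Table (Quad ℝ)} (h : IsTables J s K a j AF) :
    IsTables J s K a (j + 1)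
      (assignJob J s (gridOf J s a) K (earlyBound J s a K) j AF).val := by
  rw [assignJob_val]
  exact scan_inv (IsTables J s K a (j + 1)) ⟨tableOf_empty _ _ _, h.2⟩ fun i q hq AF' h' =>
    h'.extend hJ hs hK hjm (earlyBound_le hJ hs ha K) (P_earlyBound_sub_le hJ hs hj hjm)
      (h.1 i q hq).2

theorem isTables_start (ha : a < J.n) (hPa : J.P a ≤ J.T₁) : IsTables J s K a (a + 1)
    ((store s.δ (gridOf J s a) (fun _ => none) (startQuad J a)).val, fun _ => none) := by
  have h := (tableOf_empty s.δ (gridOf J s a) (IsStage J K s.pmin a (a + 1))).store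
    (isStage_startQuad hJ hs hK ha hPa)
  exact ⟨h, tableOf_empty _ _ _⟩

theorem isTables_finalTables (ha : a < J.n) (hPa : J.P a ≤ J.T₁) :
    IsTables J s K a (earlyBound J s a K) (finalTables J s a K).val := by
  have h := loop_inv (m := earlyBound J s a K - (a + 1))
    (fun i AF => IsTables J s K a (a + 1 + i) AF) (isTables_start hJ hs hK ha hPa)
    fun i hi AF h => isTables_assignJob (j := a + 1 + i) hJ hs hK ha (by omega) (by omega) h
  have hm : a + 1 ≤ earlyBound J s a K := le_max_right _ _
  rw [Nat.add_sub_cancel' hm] at h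
  exact h

theorem tableOf_fullTable (ha : a < J.n) (hPa : J.P a ≤ J.T₁) :
    TableOf s.δ (gridOf J s a) (IsFull J K s.pmin a) (fullTable J s a K).val := by
  have h := isTables_finalTables hJ hs hK ha hPa
  refine scan_inv _ h.2 fun i q hq F hF => ?_
  rw [finish_val hs _ (earlyBound_le hJ hs ha K)]
  exact hF.store ((h.1 i q hq).2.finish hJ hK)

/-- Every schedule that `Approx(a, ε)` returns is feasible for the bound `K`. -/
theorem isFull_of_approx (ha : a < J.n) (hPa : J.P a ≤ J.T₁) {q : Quad ℝ}
    (hq : (approx J s a K).val = some q) : IsFull J K s.pmin a q := by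
  rw [approx_val hs ha] at hq
  refine scan_inv (fun o : Option (Quad ℝ) => ∀ q, o = some q → IsFull J K s.pmin a q)
    (fun _ h => by cases h) (fun i q' hq' o ho => ?_) q hq
  have hf := (tableOf_fullTable hJ hs hK ha hPa i q' hq').2
  rcases o with _ | q₂
  · intro q₁ h
    cases h
    exact hf
  · simp only [keepBetter, lt_eq, val_bind, val_op, val_ite, val_pure]
    intro q₁ h
    split_ifs at h
    · cases h
      exact hf
    · exact ho q₁ h

/-- A table holds, in range, a quadruple with the property `Q`. -/
def Holds (g : Grid ℝ) (A : Table (Quad ℝ)) (Q : Quad ℝ → Prop) : Prop :=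
  ∃ i q, A i = some q ∧ i.1 < g.m₁ ∧ i.2.1 < g.m₂ ∧ i.2.2 < g.m₃ ∧ Q q

/-- A table of full schedules covers a full schedule that costs at most `B`. -/
def CoversCost (J : Input ℝ) (s : Sums ℝ) (K : ℝ) (a : ℕ) (F : Table (Quad ℝ)) (B : ℝ) : Prop :=
  ∃ q, IsFull J K s.pmin a q ∧ Covers s.δ (gridOf J s a) F q ∧ q.z ≤ B

omit hJ hs hK in
theorem CoversCost.store {F : Table (Quad ℝ)} {B : ℝ} (h : CoversCost J s K a F B) (q : Quad ℝ) :
    CoversCost J s K a (store s.δ (gridOf J s a) F q).val B := by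
  obtain ⟨q₀, h1, h2, h3⟩ := h
  exact ⟨q₀, h1, h2.store q, h3⟩

omit hJ hK in
theorem covers_extend {m j : ℕ} (hjm : j < m) (hm : m ≤ J.n) (q q₁ : Quad ℝ)
    {AF : Table (Quad ℝ) × Table (Quad ℝ)} (h : Covers s.δ (gridOf J s a) AF.1 q₁) :
    Covers s.δ (gridOf J s a) (extend J s (gridOf J s a) K m j q AF).val.1 q₁ := by
  rw [extend_val hs _ _ hjm hm]
  dsimp only
  split_ifs
  · exact (h.store _).store _
  · exact h.store _

omit hJ hK in
theorem coversCost_extend {m j : ℕ} (hjm : j < m) (hm : m ≤ J.n) (q : Quad ℝ) {B : ℝ}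
    {AF : Table (Quad ℝ) × Table (Quad ℝ)} (h : CoversCost J s K a AF.2 B) :
    CoversCost J s K a (extend J s (gridOf J s a) K m j q AF).val.2 B := by
  rw [extend_val hs _ _ hjm hm]
  dsimp only
  split_ifs
  · exact h.store _
  · exact h

/-- One iteration of the main loop. A stored quadruple that follows the target schedule gives
another one, at the cost of a factor of `δ`, unless the earlier job that comes next would be
completed too early; then the schedule with idle time is at least as good as the target schedule. -/
theorem follows_assignJob {E : Finset ℕ} (hE : IsTarget J K a E) {j : ℕ} (hj : a + 1 ≤ j)
    (hjm : j < earlyBound J s a K) {AF : Table (Quad ℝ) × Table (Quad ℝ)}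
    (h : IsTables J s K a j AF) {D : ℝ} (hD : 1 ≤ D)
    (hA : Holds (gridOf J s a) AF.1 (Follows J K E D j)) :
    Holds (gridOf J s a) (assignJob J s (gridOf J s a) K (earlyBound J s a K) j AF).val.1
        (Follows J K E (s.δ * D) (j + 1)) ∨
      CoversCost J s K a (assignJob J s (gridOf J s a) K (earlyBound J s a K) j AF).val.2
        (D * targetZ J K E J.n) := by
  have hn := hE.lt_n
  have hm := earlyBound_le hJ hs hn K
  have hmT := P_earlyBound_sub_le hJ hs hj hjm
  have hjn := hjm.trans_le hm
  have hT := isTables_assignJob hJ hs hK hn hj hjm h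
  obtain ⟨i, q, hAq, hi₁, hi₂, hi₃, hq⟩ := hA
  have hqs := (h.1 i q hAq).2
  -- a quadruple that is covered afterwards and follows the target schedule suffices
  have reach : ∀ q₁, IsStage J K s.pmin a (j + 1) q₁ → Follows J K E D (j + 1) q₁ →
      Covers s.δ (gridOf J s a)
        (assignJob J s (gridOf J s a) K (earlyBound J s a K) j AF).val.1 q₁ →
      Holds (gridOf J s a) (assignJob J s (gridOf J s a) K (earlyBound J s a K) j AF).val.1
        (Follows J K E (s.δ * D) (j + 1)) := by
    intro q₁ h₁ hf hc
    obtain ⟨i', q', h1, h2, h3, h4, -, h6, h7, h8⟩ :=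
      hc.exists_le hJ hs hn (fun q hq => hq.toIsEntry) hT.1 h₁.toIsEntry
    have hδ := (hs.one_lt_δ hJ).le
    refine ⟨i', q', h1, h2, h3, h4, h6.trans hf.1, h7.trans ?_, h8.trans ?_⟩
    · rw [mul_assoc]
      exact mul_le_mul_of_nonneg_left hf.2.1 (by linarith)
    · rw [mul_assoc]
      exact mul_le_mul_of_nonneg_left hf.2.2 (by linarith)
  by_cases hjE : j ∈ E
  · have hlen : q.l₁ + J.p j ≤ J.T₁ := by
      have h1 := earlyLen_mono (E := E) hJ (show j + 1 ≤ J.n from hjn) le_rfl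
      have h2 := hE.earlyLen_le
      have h3 := hq.1
      rw [earlyLen_succ_of_mem hjE] at h1
      linarith
    by_cases hnear : J.P (j + 1) - (q.l₁ + J.p j) ≤ K
    · left
      refine reach _ (hqs.early hJ hs hjn hlen hnear) (hq.early hJ hD hjn hjE) ?_
      rw [assignJob_val]
      refine scan_reach (fun _ => True)
        (fun AF' : Table (Quad ℝ) × Table (Quad ℝ) =>
          Covers s.δ (gridOf J s a) AF'.1 (earlyQuad J j q)) trivial
        (fun _ _ _ _ _ => trivial) (fun i' q' _ AF' _ hc => covers_extend hs hjm hm _ _ hc)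
        hi₁ hi₂ hi₃ hAq fun AF' _ => ?_
      rw [extend_val hs _ _ hjm hm, if_pos ⟨hlen, hnear⟩]
      dsimp only
      exact covers_store_self _ _ _ _
    · right
      rw [assignJob_val]
      have hlt : q.l₁ + J.p j < J.P (j + 1) - K := by linarith [not_le.1 hnear]
      have hok : J.P (j + 1) - K ≤ J.T₁ := hE.near j hjE hjn
      refine scan_reach (fun _ => True)
        (fun AF' : Table (Quad ℝ) × Table (Quad ℝ) =>
          CoversCost J s K a AF'.2 (D * targetZ J K E J.n)) trivial
        (fun _ _ _ _ _ => trivial) (fun i' q' _ AF' _ hc => coversCost_extend hs hjm hm _ hc)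
        hi₁ hi₂ hi₃ hAq fun AF' _ => ?_
      rw [extend_val hs _ _ hjm hm]
      dsimp only
      rw [if_pos ⟨hlt, hok⟩]
      exact ⟨_, hqs.idle hJ hs hK hjm hm hmT hlt, covers_store_self _ _ _ _,
        hq.idle hJ hD hjm hm (hE.lt_earlyBound hJ hs) hmT⟩
  · left
    refine reach _ (hqs.late hJ hK hjn) (hq.late hJ hD hjn hjE) ?_
    rw [assignJob_val]
    refine scan_reach (fun _ => True)
      (fun AF' : Table (Quad ℝ) × Table (Quad ℝ) =>
        Covers s.δ (gridOf J s a) AF'.1 (lateQuad J j q)) trivial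
      (fun _ _ _ _ _ => trivial) (fun i' q' _ AF' _ hc => covers_extend hs hjm hm _ _ hc)
      hi₁ hi₂ hi₃ hAq fun AF' _ => ?_
    rw [extend_val hs _ _ hjm hm]
    dsimp only
    split_ifs
    · exact (covers_store_self _ _ _ _).store _
    · exact covers_store_self _ _ _ _

omit hs hK in
theorem follows_start {E : Finset ℕ} (hE : IsTarget J K a E) {q : Quad ℝ}
    (hq : q = startQuad J a) : Follows J K E 1 (a + 1) q := by
  subst hq
  have he := earlyLen_eq_P (J := J) hE.mem_of_lt
  have hn := hE.lt_n
  refine ⟨?_, ?_, ?_⟩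
  · rw [earlyLen_succ_of_not_mem hE.not_mem, he]
    exact le_rfl
  · rw [earlyLen_succ_of_not_mem hE.not_mem, he, J.P_succ]
    simp [startQuad]
  · rw [one_mul, targetZ_succ, targetC, if_neg hE.not_mem,
      earlyLen_succ_of_not_mem hE.not_mem, he, J.P_succ, add_sub_cancel_left]
    refine add_le_add_left (Finset.sum_le_sum fun i hi => ?_) _
    have hi := Finset.mem_range.1 hi
    refine mul_le_mul_of_nonneg_left ?_ (hJ.w_pos (hi.trans hn)).le
    rw [targetC, if_pos (hE.mem_of_lt i hi),
      earlyLen_eq_P fun l hl => hE.mem_of_lt l (by omega)]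
    exact le_max_left _ _

/-- After the main loop, either a stored partial or a stored full schedule can compete with the
target schedule. -/
theorem follows_finalTables {E : Finset ℕ} (hE : IsTarget J K a E) (hPa : J.P a ≤ J.T₁) :
    Holds (gridOf J s a) (finalTables J s a K).val.1
        (Follows J K E (s.δ ^ (J.n - 1)) (earlyBound J s a K)) ∨
      CoversCost J s K a (finalTables J s a K).val.2 (s.δ ^ (J.n - 1) * targetZ J K E J.n) := by
  have hn := hE.lt_n
  have hmn := earlyBound_le hJ hs hn K
  have hδ := (hs.one_lt_δ hJ).le
  have hm : a + 1 ≤ earlyBound J s a K := le_max_right _ _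
  have hZ : 0 ≤ targetZ J K E J.n := Finset.sum_nonneg fun i hi =>
    mul_nonneg (hJ.w_pos (Finset.mem_range.1 hi)).le (targetC_nonneg hJ (Finset.mem_range.1 hi))
  have hmono : ∀ {e : ℕ} {j : ℕ} {q : Quad ℝ}, j ≤ J.n → e ≤ J.n - 1 →
      Follows J K E (s.δ ^ e) j q → Follows J K E (s.δ ^ (J.n - 1)) j q := by
    intro e j q hj he hq
    have hp := pow_le_pow_right₀ hδ he
    have h1 := earlyLen_le_P (E := E) hJ hj
    have h2 := hJ.one_le_T₁
    have h3 := hJ.T_lt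
    refine ⟨hq.1, hq.2.1.trans (mul_le_mul_of_nonneg_right hp (by linarith)),
      hq.2.2.trans (mul_le_mul_of_nonneg_right hp ?_)⟩
    exact Finset.sum_nonneg fun i hi => by
      have := (Finset.mem_range.1 hi).trans_le hj
      exact mul_nonneg (hJ.w_pos this).le (targetC_nonneg hJ this)
  have h := loop_inv (m := earlyBound J s a K - (a + 1))
    (fun i AF => IsTables J s K a (a + 1 + i) AF ∧
      (Holds (gridOf J s a) AF.1 (Follows J K E (s.δ ^ i) (a + 1 + i)) ∨
        CoversCost J s K a AF.2 (s.δ ^ (J.n - 1) * targetZ J K E J.n)))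
    (x := ((store s.δ (gridOf J s a) (fun _ => none) (startQuad J a)).val, fun _ => none))
    (body := fun i => assignJob J s (gridOf J s a) K (earlyBound J s a K) (a + 1 + i)) ?_ ?_
  · rw [Nat.add_sub_cancel' hm] at h
    refine h.2.imp_left fun h' => ?_
    obtain ⟨i, q, h1, h2, h3, h4, h5⟩ := h'
    exact ⟨i, q, h1, h2, h3, h4, hmono hmn (by omega) h5⟩
  · refine ⟨isTables_start hJ hs hK hn hPa, Or.inl ?_⟩
    obtain ⟨i, q', h1, h2, h3, h4, h5, -⟩ :=
      (covers_store_self s.δ (gridOf J s a) (fun _ => none) (startQuad J a)).exists_le hJ hs hn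
        (V := fun q => q = startQuad J a)
        (by rintro _ rfl; exact (isStage_startQuad hJ hs hK hn hPa).toIsEntry)
        ((tableOf_empty _ _ _).store rfl) (isStage_startQuad hJ hs hK hn hPa).toIsEntry
    exact ⟨i, q', h1, h2, h3, h4, by simpa using follows_start hJ hE h5⟩
  · rintro i hi AF ⟨hT, hA⟩
    refine ⟨isTables_assignJob (j := a + 1 + i) hJ hs hK hn (by omega) (by omega) hT, ?_⟩
    rcases hA with hA | hF
    · rcases follows_assignJob hJ hs hK hE (by omega) (by omega) hT (one_le_pow₀ hδ) hA with h' | h'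
      · left
        rw [pow_succ']
        exact h'
      · right
        obtain ⟨q, h1, h2, h3⟩ := h'
        refine ⟨q, h1, h2, h3.trans (mul_le_mul_of_nonneg_right ?_ hZ)⟩
        exact pow_le_pow_right₀ hδ (by omega)
    · right
      rw [assignJob_val]
      exact scan_inv (fun AF' : Table (Quad ℝ) × Table (Quad ℝ) => CoversCost J s K a AF'.2 _) hF
        fun _ _ _ _ h' =>
          coversCost_extend hs (show a + 1 + i < earlyBound J s a K by omega) hmn _ h'

/-- `Approx(a, ε)` finds a schedule that costs at most `δ^n` times the target schedule. -/
theorem approx_le {E : Finset ℕ} (hE : IsTarget J K a E) (hPa : J.P a ≤ J.T₁) :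
    ∃ q, (approx J s a K).val = some q ∧ q.z ≤ s.δ ^ J.n * targetZ J K E J.n := by
  have hn := hE.lt_n
  have hmn := earlyBound_le hJ hs hn K
  have hδ := (hs.one_lt_δ hJ).le
  have hfull : CoversCost J s K a (fullTable J s a K).val
      (s.δ ^ (J.n - 1) * targetZ J K E J.n) := by
    rcases follows_finalTables hJ hs hK hE hPa with ⟨i, q, hq, hi₁, hi₂, hi₃, hf⟩ | h
    · have hqs := ((isTables_finalTables hJ hs hK hn hPa).1 i q hq).2
      refine scan_reach (fun _ => True) (fun F => CoversCost J s K a F _) trivial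
        (fun _ _ _ _ _ => trivial) (fun _ _ _ F _ h => ?_) hi₁ hi₂ hi₃ hq fun F _ => ?_
      · rw [finish_val hs _ hmn]
        exact h.store _
      · rw [finish_val hs _ hmn]
        exact ⟨_, hqs.finish hJ hK, covers_store_self _ _ _ _,
          hf.finish hJ (one_le_pow₀ hδ) hmn (hE.lt_earlyBound hJ hs)⟩
    · refine scan_inv (fun F => CoversCost J s K a F _) h fun _ _ _ F h => ?_
      rw [finish_val hs _ hmn]
      exact h.store _
  obtain ⟨q₀, h1, h2, h3⟩ := hfull
  obtain ⟨i, q, hq, hi₁, hi₂, hi₃, -, -, -, hz⟩ := h2.exists_le hJ hs hn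
    (fun q hq => hq.toIsEntry) (tableOf_fullTable hJ hs hK hn hPa) h1.toIsEntry
  have hqz : q.z ≤ s.δ ^ J.n * targetZ J K E J.n := by
    refine hz.trans ((mul_le_mul_of_nonneg_left h3 (by linarith)).trans_eq ?_)
    rw [← mul_assoc, ← pow_succ', Nat.sub_add_cancel hJ.n_pos]
  rw [approx_val hs hn]
  refine scan_reach (fun _ => True)
    (fun o : Option (Quad ℝ) => ∃ q, o = some q ∧ q.z ≤ s.δ ^ J.n * targetZ J K E J.n) trivial
    (fun _ _ _ _ _ => trivial) ?_ hi₁ hi₂ hi₃ hq ?_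
  · rintro i' q' - o - ⟨q₁, rfl, hq₁⟩
    simp only [keepBetter, lt_eq, val_bind, val_op, val_ite, val_pure, decide_eq_true_eq]
    split_ifs with hlt
    · exact ⟨q', rfl, hlt.le.trans hq₁⟩
    · exact ⟨q₁, rfl, hq₁⟩
  · rintro (_ | q₁) -
    · exact ⟨q, rfl, hqz⟩
    · simp only [keepBetter, lt_eq, val_bind, val_op, val_ite, val_pure, decide_eq_true_eq]
      split_ifs with hlt
      · exact ⟨q, rfl, hqz⟩
      · exact ⟨q₁, rfl, (not_lt.1 hlt).trans hqz⟩

end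

end Prog

/-! ### Lower bounds for arbitrary schedules -/

namespace Prog

/-- The starting times `σ` give a schedule in which all time deviations are at most `K`. -/
structure IsSchedule (J : Input ℝ) (K : ℝ) (σ : ℕ → ℝ) : Prop where
  start_nonneg : ∀ i < J.n, 0 ≤ σ i
  disjoint : ∀ i < J.n, ∀ i' < J.n, i ≠ i' → σ i + J.p i ≤ σ i' ∨ σ i' + J.p i' ≤ σ i
  avoids : ∀ i < J.n, σ i + J.p i ≤ J.T₁ ∨ J.T₂ ≤ σ i
  dev_le : ∀ i < J.n, |σ i - J.P i| ≤ K

section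

variable {J : Input ℝ} (hJ : J.Good) {A : Finset ℕ} {σ : ℕ → ℝ} {t : ℝ}

/-- Jobs that do not overlap and are processed during `[t, T]` have total length at most
`T - t`. -/
theorem sum_p_le (hA : ∀ i ∈ A, 0 < J.p i) (hσ : ∀ i ∈ A, t ≤ σ i)
    (hd : ∀ i ∈ A, ∀ i' ∈ A, i ≠ i' → σ i + J.p i ≤ σ i' ∨ σ i' + J.p i' ≤ σ i) {T : ℝ}
    (ht : t ≤ T) (hT : ∀ i ∈ A, σ i + J.p i ≤ T) : ∑ i ∈ A, J.p i ≤ T - t := by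
  induction A using Finset.induction_on_max_value σ generalizing T with
  | empty => simpa using ht
  | insert a A haA hmax ih =>
    rw [Finset.sum_insert haA]
    have h1 := hσ a (Finset.mem_insert_self a A)
    have h2 := hT a (Finset.mem_insert_self a A)
    have h3 := ih (fun i hi => hA i (Finset.mem_insert_of_mem hi))
      (fun i hi => hσ i (Finset.mem_insert_of_mem hi))
      (fun i hi i' hi' => hd i (Finset.mem_insert_of_mem hi) i' (Finset.mem_insert_of_mem hi')) h1
      fun i hi => by
        have hp := hA a (Finset.mem_insert_self a A)
        have hle := hmax i hi
        rcases hd i (Finset.mem_insert_of_mem hi) a (Finset.mem_insert_self a A)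
          (by rintro rfl; exact haA hi) with h | h <;> linarith
    linarith

include hJ

/-- **Smith's rule**: jobs that are processed from time `t` on have the smallest total weighted
completion time if they are processed in WSPT order without idle time. Each pair of jobs contributes
the product of the weight of one and the length of the other, and WSPT order minimizes it. -/
theorem smith_rule (hA : ∀ i ∈ A, i < J.n) (hσ : ∀ i ∈ A, t ≤ σ i)
    (hd : ∀ i ∈ A, ∀ i' ∈ A, i ≠ i' → σ i + J.p i ≤ σ i' ∨ σ i' + J.p i' ≤ σ i) :
    ∑ i ∈ A, J.w i * (t + ∑ l ∈ A, if l ≤ i then J.p l else 0) ≤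
      ∑ i ∈ A, J.w i * (σ i + J.p i) := by
  have hp : ∀ i ∈ A, 0 < J.p i := fun i hi => hJ.p_pos (hA i hi)
  have hw : ∀ i ∈ A, 0 < J.w i := fun i hi => hJ.w_pos (hA i hi)
  have h1 : ∀ i ∈ A, t + ∑ l ∈ A, (if σ l ≤ σ i then J.p l else 0) ≤ σ i + J.p i := by
    intro i hi
    have h := sum_p_le (J := J) (A := A.filter fun l => σ l ≤ σ i) (σ := σ) (t := t)
      (T := σ i + J.p i) (fun l hl => hp l (Finset.mem_filter.1 hl).1)
      (fun l hl => hσ l (Finset.mem_filter.1 hl).1)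
      (fun l hl l' hl' => hd l (Finset.mem_filter.1 hl).1 l' (Finset.mem_filter.1 hl').1)
      (by have := hσ i hi; have := hp i hi; linarith) fun l hl => by
        obtain ⟨hl, hle⟩ := Finset.mem_filter.1 hl
        rcases eq_or_ne l i with rfl | hne
        · exact le_rfl
        · have := hp i hi
          rcases hd l hl i hi hne with h | h <;> linarith
    rw [Finset.sum_filter] at h
    linarith
  have h2 : ∑ i ∈ A, ∑ l ∈ A, (if l ≤ i then J.w i * J.p l else 0) ≤
      ∑ i ∈ A, ∑ l ∈ A, (if σ l ≤ σ i then J.w i * J.p l else 0) := by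
    have hpair : ∀ i ∈ A, ∀ l ∈ A,
        (if l ≤ i then J.w i * J.p l else 0) + (if i ≤ l then J.w l * J.p i else 0) ≤
        (if σ l ≤ σ i then J.w i * J.p l else 0) +
          (if σ i ≤ σ l then J.w l * J.p i else 0) := by
      intro i hi l hl
      have hil := mul_pos (hw i hi) (hp l hl)
      have hli := mul_pos (hw l hl) (hp i hi)
      rcases lt_trichotomy i l with h | rfl | h
      · have := hJ.wspt i l h.le (hA l hl)
        rw [if_neg (by omega), if_pos h.le]
        rcases le_total (σ l) (σ i) with h' | h' <;> rw [if_pos h'] <;> split_ifs <;> linarith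
      · simp
      · have := hJ.wspt l i h.le (hA i hi)
        rw [if_pos h.le, if_neg (by omega)]
        rcases le_total (σ l) (σ i) with h' | h' <;> rw [if_pos h'] <;> split_ifs <;> linarith
    have h3 := Finset.sum_le_sum fun i hi => Finset.sum_le_sum fun l hl => hpair i hi l hl
    simp only [Finset.sum_add_distrib] at h3
    rw [Finset.sum_comm (f := fun i l => if i ≤ l then J.w l * J.p i else 0),
      Finset.sum_comm (f := fun i l => if σ i ≤ σ l then J.w l * J.p i else 0)] at h3
    linarith
  have hexp : ∀ (r : ℕ → ℕ → Prop) [∀ i l, Decidable (r i l)],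
      ∑ i ∈ A, J.w i * (t + ∑ l ∈ A, if r i l then J.p l else 0) =
      ∑ i ∈ A, J.w i * t + ∑ i ∈ A, ∑ l ∈ A, (if r i l then J.w i * J.p l else 0) := by
    intro r _
    rw [← Finset.sum_add_distrib]
    refine Finset.sum_congr rfl fun i _ => ?_
    rw [mul_add, Finset.mul_sum]
    simp only [mul_ite, mul_zero]
  calc _ = _ := hexp fun i l => l ≤ i
    _ ≤ _ := add_le_add_right h2 _
    _ = ∑ i ∈ A, J.w i * (t + ∑ l ∈ A, if σ l ≤ σ i then J.p l else 0) :=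
      (hexp fun i l => σ l ≤ σ i).symm
    _ ≤ _ := Finset.sum_le_sum fun i hi => mul_le_mul_of_nonneg_left (h1 i hi) (hw i hi).le

end

theorem earlyLen_eq_sum {J : Input ℝ} {E A : Finset ℕ} {i : ℕ}
    (hA : ∀ l ≤ i, l ∈ A ↔ l ∈ E) : earlyLen J E (i + 1) = ∑ l ∈ A, if l ≤ i then J.p l else 0 := by
  rw [earlyLen, ← Finset.sum_filter, ← Finset.sum_filter]
  refine Finset.sum_congr (Finset.ext fun l => ?_) fun _ _ => rfl
  simp only [Finset.mem_filter, Finset.mem_range, Nat.lt_succ_iff]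
  exact ⟨fun h => ⟨(hA l h.1).2 h.2, h.1⟩, fun h => ⟨h.2, (hA l h.2).1 h.1⟩⟩

/-- The jobs that a schedule processes before the unavailable period give a target schedule, which
is at least as good for every bound on the time deviations that the schedule respects. -/
theorem IsSchedule.exists_target {J : Input ℝ} (hJ : J.Good) {K : ℝ} {σ : ℕ → ℝ}
    (hσ : IsSchedule J K σ) : ∃ a E, J.P a ≤ J.T₁ ∧ J.T₂ - J.P a ≤ K ∧
      ∀ K', K ≤ K' → IsTarget J K' a E ∧
        targetZ J K' E J.n ≤ ∑ i ∈ Finset.range J.n, J.w i * (σ i + J.p i) := by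
  classical
  set E := (Finset.range J.n).filter fun i => σ i + J.p i ≤ J.T₁ with hE
  have hEn : ∀ i ∈ E, i < J.n ∧ σ i + J.p i ≤ J.T₁ := fun i hi => by simpa [hE] using hi
  have hnE : ∀ i < J.n, i ∉ E → J.T₂ ≤ σ i := fun i hi h =>
    (hσ.avoids i hi).resolve_left fun h' => h (by simp [hE, hi, h'])
  have hlen : earlyLen J E J.n ≤ J.T₁ := by
    have h := sum_p_le (J := J) (A := E) (σ := σ) (t := 0) (T := J.T₁)
      (fun i hi => hJ.p_pos (hEn i hi).1) (fun i hi => hσ.start_nonneg i (hEn i hi).1)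
      (fun i hi i' hi' => hσ.disjoint i (hEn i hi).1 i' (hEn i' hi').1)
      (zero_le_one.trans hJ.one_le_T₁) fun i hi => (hEn i hi).2
    rw [sub_zero] at h
    refine le_trans (le_of_eq ?_) h
    rw [earlyLen, ← Finset.sum_filter]
    refine Finset.sum_congr (Finset.ext fun l => ?_) fun _ _ => rfl
    simp only [Finset.mem_filter, Finset.mem_range]
    exact ⟨fun h => h.2, fun h => ⟨(hEn l h).1, h⟩⟩
  have hex : ∃ a, a < J.n ∧ a ∉ E := by
    by_contra! h
    have := earlyLen_eq_P (J := J) h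
    have := hJ.T₁_lt
    linarith
  obtain ⟨han, haE⟩ := Nat.find_spec hex
  have hmin : ∀ i < Nat.find hex, i ∈ E := fun i hi => by
    have := Nat.find_min hex hi
    by_contra h
    exact this ⟨hi.trans han, h⟩
  generalize Nat.find hex = a at han haE hmin
  have hPa : J.P a ≤ J.T₁ := by
    rw [← earlyLen_eq_P hmin]
    exact (earlyLen_mono hJ han.le le_rfl).trans hlen
  refine ⟨a, E, hPa, ?_, fun K' hK' => ⟨⟨han, hmin, haE, hlen, fun i hi hin => ?_⟩, ?_⟩⟩
  · have h1 := hnE a han haE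
    have h2 := (le_abs_self _).trans (hσ.dev_le a han)
    linarith
  · have h1 := (neg_abs_le _).trans' (neg_le_neg (hσ.dev_le i hin))
    have h2 := (hEn i hi).2
    rw [J.P_succ]
    linarith
  -- the jobs whose target completion time is determined by the earlier jobs
  set E₁ := E.filter fun i => J.P (i + 1) - K' ≤ earlyLen J E (i + 1) with hE₁
  have hsplit : ∀ f : ℕ → ℝ, ∑ i ∈ Finset.range J.n, f i =
      ∑ i ∈ E₁, f i + ∑ i ∈ E.filter (fun i => ¬J.P (i + 1) - K' ≤ earlyLen J E (i + 1)), f i +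
        ∑ i ∈ (Finset.range J.n).filter (fun i => ¬σ i + J.p i ≤ J.T₁), f i := by
    intro f
    rw [hE₁, Finset.sum_filter_add_sum_filter_not, hE, Finset.sum_filter_add_sum_filter_not]
  rw [targetZ, hsplit, hsplit]
  refine add_le_add (add_le_add ?_ ?_) ?_
  · refine le_trans (le_of_eq ?_) (smith_rule hJ (A := E₁) (t := 0) (σ := σ) ?_ ?_ ?_)
    · refine Finset.sum_congr rfl fun i hi => ?_
      obtain ⟨hiE, hiK⟩ := Finset.mem_filter.1 hi
      rw [targetC, if_pos hiE, max_eq_left hiK, zero_add, earlyLen_eq_sum (A := E₁)]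
      intro l hl
      refine ⟨fun h => (Finset.mem_filter.1 h).1, fun h => Finset.mem_filter.2 ⟨h, ?_⟩⟩
      have := sub_earlyLen_mono (E := E) hJ (Nat.succ_le_succ hl) (hEn i hiE).1
      simp only [Nat.succ_eq_add_one] at this
      linarith
    · exact fun i hi => (hEn i (Finset.mem_filter.1 hi).1).1
    · exact fun i hi => hσ.start_nonneg i (hEn i (Finset.mem_filter.1 hi).1).1
    · exact fun i hi i' hi' => hσ.disjoint i (hEn i (Finset.mem_filter.1 hi).1).1 i'
        (hEn i' (Finset.mem_filter.1 hi').1).1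
  · refine Finset.sum_le_sum fun i hi => ?_
    obtain ⟨hiE, hiK⟩ := Finset.mem_filter.1 hi
    have hin := (hEn i hiE).1
    refine mul_le_mul_of_nonneg_left ?_ (hJ.w_pos hin).le
    rw [targetC, if_pos hiE, max_eq_right (not_le.1 hiK).le, J.P_succ]
    have := (neg_abs_le _).trans' (neg_le_neg (hσ.dev_le i hin))
    linarith
  · set L := (Finset.range J.n).filter (fun i => ¬σ i + J.p i ≤ J.T₁) with hL
    have hLn : ∀ i ∈ L, i < J.n ∧ i ∉ E := fun i hi => by
      have := Finset.mem_filter.1 hi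
      exact ⟨Finset.mem_range.1 this.1, fun h => this.2 (hEn i h).2⟩
    refine le_trans (le_of_eq ?_) (smith_rule hJ (A := L) (t := J.T₂) (σ := σ) ?_ ?_ ?_)
    · refine Finset.sum_congr rfl fun i hi => ?_
      obtain ⟨hin, hiE⟩ := hLn i hi
      have h1 : earlyLen J E (i + 1) + earlyLen J L (i + 1) = J.P (i + 1) := by
        rw [earlyLen, earlyLen, Input.P, ← Finset.sum_add_distrib]
        refine Finset.sum_congr rfl fun l hl => ?_
        have hln : l < J.n := by have := Finset.mem_range.1 hl; omega
        by_cases h : l ∈ E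
        · rw [if_pos h, if_neg fun h' => (hLn l h').2 h, add_zero]
        · have : l ∈ L := by
            rw [hL, Finset.mem_filter]
            exact ⟨Finset.mem_range.2 hln, fun h' => h (by simp [hE, hln, h'])⟩
          rw [if_neg h, if_pos this, zero_add]
      rw [targetC, if_neg hiE, ← earlyLen_eq_sum (A := L) (E := L) fun _ _ => Iff.rfl]
      congr 2
      linarith
    · exact fun i hi => (hLn i hi).1
    · exact fun i hi => hnE i (hLn i hi).1 (hLn i hi).2
    · exact fun i hi i' hi' => hσ.disjoint i (hLn i hi).1 i' (hLn i' hi').1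

end Prog

/-! ### The search over the first late job and the bound -/

namespace Prog

open Timed

/-- In the `n` steps of the recursion the errors of at most `δ` multiply to at most `1 + ε`. -/
theorem Input.Good.δ_pow_le {J : Input ℝ} (hJ : J.Good) : J.δ ^ J.n ≤ 1 + J.ε := by
  have hn : (0 : ℝ) < J.n := by exact_mod_cast hJ.n_pos
  have hε := hJ.ε_pos
  have hε1 := hJ.ε_le
  have h1 : J.δ ≤ Real.exp (J.ε / (2 * J.n)) := by
    rw [Input.δ, add_comm]
    exact Real.add_one_le_exp _
  have h2 : J.δ ^ J.n ≤ Real.exp (J.ε / 2) := by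
    refine (pow_le_pow_left₀ (by have := hJ.one_lt_δ; linarith) h1 _).trans_eq ?_
    rw [← Real.exp_nat_mul]
    congr 1
    field_simp
  have h3 := abs_le.1 (Real.abs_exp_sub_one_sub_id_le
    (x := J.ε / 2) (by rw [abs_of_pos] <;> linarith))
  nlinarith [h3.2]

theorem IsFull.isSchedule {J : Input ℝ} {K pmin : ℝ} {a : ℕ} {q : Quad ℝ}
    (h : IsFull J K pmin a q) : IsSchedule J K (expand J q.plan).val.2 where
  start_nonneg := h.isPartial.start_nonneg
  disjoint i hi i' hi' hne := by
    rcases lt_or_gt_of_ne hne with h' | h'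
    · exact (h.isPartial.disjoint i' hi' i h').symm
    · exact h.isPartial.disjoint i hi i' h'
  avoids i hi := (h.isPartial.fits i hi).imp (fun h' => h'.trans h.isPartial.l₁_le) fun h' => h'.1
  dev_le := h.isPartial.dev_le

theorem IsSchedule.mono {J : Input ℝ} {K K' : ℝ} {σ : ℕ → ℝ} (h : IsSchedule J K σ)
    (hK : K ≤ K') : IsSchedule J K' σ :=
  ⟨h.start_nonneg, h.disjoint, h.avoids, fun i hi => (h.dev_le i hi).trans hK⟩

/-- The best schedule found so far is feasible, and stored with its objective value. -/
def IsBest (J : Input ℝ) (s : Sums ℝ) (o : Option (ℝ × Arr ℝ)) : Prop :=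
  ∀ x, o = some x → IsSchedule J J.k x.2 ∧ x.1 = (value J s x.2).val

/-- A schedule with objective value at most `B` has been found. -/
def FoundLe (B : ℝ) (o : Option (ℝ × Arr ℝ)) : Prop := ∃ x, o = some x ∧ x.1 ≤ B

theorem tryBound_val (J : Input ℝ) (s : Sums ℝ) (a : ℕ) (K : ℝ) (best : Option (ℝ × Arr ℝ)) :
    (tryBound J s a K best).val = match (approx J s a K).val with
      | none => best
      | some q => match best with
        | none => some ((value J s (expand J q.plan).val.2).val, (expand J q.plan).val.2)
        | some x => if (value J s (expand J q.plan).val.2).val < x.1 then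
            some ((value J s (expand J q.plan).val.2).val, (expand J q.plan).val.2)
          else some x := by
  rw [tryBound, val_bind]
  cases (approx J s a K).val with
  | none => rfl
  | some q =>
    rcases best with _ | ⟨v', S'⟩
    · rfl
    · simp only [val_bind, lt_eq, val_op, val_ite, val_pure, decide_eq_true_eq]

theorem FoundLe.tryBound {B : ℝ} {o : Option (ℝ × Arr ℝ)} (h : FoundLe B o) (J : Input ℝ)
    (s : Sums ℝ) (a : ℕ) (K : ℝ) : FoundLe B (tryBound J s a K o).val := by
  obtain ⟨x, rfl, hx⟩ := h
  rw [tryBound_val]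
  cases (approx J s a K).val with
  | none => exact ⟨x, rfl, hx⟩
  | some q =>
    dsimp only
    split_ifs with hlt
    · exact ⟨_, rfl, hlt.le.trans hx⟩
    · exact ⟨x, rfl, hx⟩

section

variable {J : Input ℝ} (hJ : J.Good) {s : Sums ℝ} (hs : IsSums J s) {a : ℕ} (ha : a < J.n)
  (hPa : J.P a ≤ J.T₁)
include hJ hs ha hPa

theorem IsBest.tryBound {K : ℝ} (hK : J.T₂ - J.P a ≤ K) (hKk : K ≤ J.k)
    {o : Option (ℝ × Arr ℝ)} (h : IsBest J s o) : IsBest J s (tryBound J s a K o).val := by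
  rw [tryBound_val]
  have hf : ∀ q, (approx J s a K).val = some q → IsFull J K s.pmin a q := fun q hq =>
    isFull_of_approx hJ hs hK ha hPa hq
  cases hq : (approx J s a K).val with
  | none => exact h
  | some q =>
    have hnew : IsBest J s
        (some ((value J s (expand J q.plan).val.2).val, (expand J q.plan).val.2)) := by
      intro x hx
      cases hx
      exact ⟨(hf q hq).isSchedule.mono hKk, rfl⟩
    rcases o with _ | x
    · exact hnew
    · dsimp only
      split_ifs
      · exact hnew
      · exact h

omit ha in
theorem foundLe_tryBound {K : ℝ} (hK : J.T₂ - J.P a ≤ K) {E : Finset ℕ} (hE : IsTarget J K a E)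
    (o : Option (ℝ × Arr ℝ)) :
    FoundLe (J.μ * K + (1 + J.ε) * targetZ J K E J.n) (tryBound J s a K o).val := by
  have ha := hE.lt_n
  obtain ⟨q, hq, hz⟩ := approx_le hJ hs hK hE hPa
  have hf := isFull_of_approx hJ hs hK ha hPa hq
  have hZ : 0 ≤ targetZ J K E J.n := Finset.sum_nonneg fun i hi =>
    mul_nonneg (hJ.w_pos (Finset.mem_range.1 hi)).le (targetC_nonneg hJ (Finset.mem_range.1 hi))
  have hv : (value J s (expand J q.plan).val.2).val ≤
      J.μ * K + (1 + J.ε) * targetZ J K E J.n := by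
    obtain ⟨D, hD, -, -, hD'⟩ := value_spec hs (expand J q.plan).val.2
    have hDK : D ≤ K := by
      rcases hD' with rfl | ⟨i, hi, rfl⟩
      · have := hJ.T_lt
        linarith
      · exact hf.isPartial.dev_le i hi
    rw [hD, ← hf.isPartial.z_eq]
    refine add_le_add (mul_le_mul_of_nonneg_left hDK hJ.μ_nonneg) (hz.trans ?_)
    rw [hs.δ_eq]
    exact mul_le_mul_of_nonneg_right hJ.δ_pow_le hZ
  rw [tryBound_val, hq]
  rcases o with _ | x
  · exact ⟨_, rfl, hv⟩
  · dsimp only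
    split_ifs with hlt
    · exact ⟨_, rfl, hv⟩
    · exact ⟨x, rfl, (not_lt.1 hlt).trans hv⟩

end

theorem pow_le_of_le_floor_logb {b x : ℝ} (hb : 1 < b) (hx : 1 ≤ x) {i : ℕ}
    (hi : i ≤ ⌊Real.logb b x⌋₊) : b ^ i ≤ x := by
  have h := (Nat.le_floor_iff (Real.logb_nonneg hb hx)).1 hi
  rwa [Real.le_logb_iff_rpow_le hb (one_pos.trans_le hx), Real.rpow_natCast] at h

theorem lt_pow_floor_logb {b x : ℝ} (hb : 1 < b) (hx : 1 ≤ x) :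
    x < b ^ (⌊Real.logb b x⌋₊ + 1) := by
  have h := Nat.lt_floor_add_one (Real.logb b x)
  rw [Real.logb_lt_iff_lt_rpow hb (one_pos.trans_le hx)] at h
  exact_mod_cast h

/-- The iteration of the main loop of `Approx^μ(ε)` in which job `a` is the first late one. -/
noncomputable def tryJob (J : Input ℝ) (s : Sums ℝ) (a : ℕ) (best : Option (ℝ × Arr ℝ)) :
    Timed (Option (ℝ × Arr ℝ)) := do
  let Pa ← get s.P a
  let Δa ← sub J.T₂ Pa
  if ← le Δa J.k then
    let x ← div J.k Δa
    let r₄ ← floorLog (1 + J.ε) x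
    let y ← loop (fun _ (y : ℝ × Option (ℝ × Arr ℝ)) => do
      let K ← mul y.1 (1 + J.ε)
      let b ← tryBound J s a K y.2
      pure (K, b)) r₄ (Δa, best)
    tryBound J s a J.k y.2
  else pure best

/-- The loop of `tryJob` over the bounds `Δ_a (1 + ε)^i`. -/
noncomputable def tryBounds (J : Input ℝ) (s : Sums ℝ) (a r : ℕ)
    (y : ℝ × Option (ℝ × Arr ℝ)) : Timed (ℝ × Option (ℝ × Arr ℝ)) :=
  loop (fun _ (y : ℝ × Option (ℝ × Arr ℝ)) => do
      let K ← mul y.1 (1 + J.ε)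
      let b ← tryBound J s a K y.2
      pure (K, b)) r y

theorem tryJob_val {J : Input ℝ} {s : Sums ℝ} (hs : IsSums J s) {a : ℕ} (ha : a < J.n)
    (best : Option (ℝ × Arr ℝ)) :
    (tryJob J s a best).val = if J.T₂ - J.P a ≤ J.k then
      (tryBound J s a J.k (tryBounds J s a ⌊Real.logb (1 + J.ε) (J.k / (J.T₂ - J.P a))⌋₊
        (J.T₂ - J.P a, best)).val.2).val
      else best := by
  simp only [tryJob, get_eq, sub_eq, le_eq, div_eq, floorLog_eq, val_bind, val_op, val_ite,
    val_pure, decide_eq_true_eq, hs.P_eq a ha.le, tryBounds]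

theorem approxMu_val (J : Input ℝ) : (approxMu J).val =
    (loop (tryJob J (preprocess J).val) ((countEarly J (preprocess J).val 0).val + 1)
      none).val.map Prod.snd := by
  simp only [approxMu, lit_eq, add_eq, val_bind, val_op, Nat.cast_zero, Nat.cast_one]
  split
  · next h =>
    rw [show (loop (tryJob J (preprocess J).val)
      ((countEarly J (preprocess J).val 0).val + 1) none).val = none from h]
    rfl
  · next v S h =>
    rw [show (loop (tryJob J (preprocess J).val)
      ((countEarly J (preprocess J).val 0).val + 1) none).val = some (v, S) from h]
    rfl

section

variable {J : Input ℝ} (hJ : J.Good) {s : Sums ℝ} (hs : IsSums J s)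
include hJ hs

/-- The jobs that the main loop tries are those that start by time `T₁` in `π*`. -/
theorem lt_countEarly_succ_iff {a : ℕ} :
    a < (countEarly J s 0).val + 1 ↔ a < J.n ∧ J.P a ≤ J.T₁ := by
  obtain ⟨hle, hc⟩ := countEarly_spec hJ hs 0
  simp only [sub_zero] at hc
  have hlt : (countEarly J s 0).val < J.n := by
    refine lt_of_le_of_ne hle fun h => ?_
    have hn := hJ.n_pos
    have := (hc (J.n - 1) (by omega)).1 (by omega)
    rw [Nat.sub_add_cancel hn] at this
    exact absurd hJ.T₁_lt (not_lt.2 this)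
  rcases a with _ | a
  · simp [hJ.n_pos, zero_le_one.trans hJ.one_le_T₁]
  · rw [Nat.succ_lt_succ_iff]
    constructor
    · intro h
      exact ⟨by omega, (hc a (by omega)).1 h⟩
    · rintro ⟨h1, h2⟩
      exact (hc a (by omega)).2 h2

variable {a : ℕ} (ha : a < J.n) (hPa : J.P a ≤ J.T₁)
include ha hPa

/-- While the bounds `Δ_a (1 + ε)^i` are tried, they do not exceed `k`. -/
theorem tryBounds_inv (hk : J.T₂ - J.P a ≤ J.k) {r : ℕ}
    (hr : r ≤ ⌊Real.logb (1 + J.ε) (J.k / (J.T₂ - J.P a))⌋₊) {y : ℝ × Option (ℝ × Arr ℝ)} :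
    ∀ i < r, y.1 = (J.T₂ - J.P a) * (1 + J.ε) ^ i ∧ IsBest J s y.2 →
      y.1 * (1 + J.ε) = (J.T₂ - J.P a) * (1 + J.ε) ^ (i + 1) ∧
      J.T₂ - J.P a ≤ y.1 * (1 + J.ε) ∧ y.1 * (1 + J.ε) ≤ J.k ∧
      IsBest J s (tryBound J s a (y.1 * (1 + J.ε)) y.2).val := by
  rintro i hi ⟨hy, hb⟩
  have hε := hJ.ε_pos
  have hΔ : 0 < J.T₂ - J.P a := by have := hJ.T_lt; linarith
  have h1 : y.1 * (1 + J.ε) = (J.T₂ - J.P a) * (1 + J.ε) ^ (i + 1) := by rw [hy]; ring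
  have h2 : J.T₂ - J.P a ≤ y.1 * (1 + J.ε) := by
    rw [h1]
    exact le_mul_of_one_le_right hΔ.le (one_le_pow₀ (by linarith))
  have h3 : y.1 * (1 + J.ε) ≤ J.k := by
    have := pow_le_of_le_floor_logb (by linarith) ((one_le_div hΔ).2 hk)
      (show i + 1 ≤ _ from (Nat.succ_le_of_lt hi).trans hr)
    rw [le_div_iff₀ hΔ] at this
    rw [h1]
    linarith
  exact ⟨h1, h2, h3, hb.tryBound hJ hs ha hPa h2 h3⟩

theorem isBest_tryBounds (hk : J.T₂ - J.P a ≤ J.k) {r : ℕ}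
    (hr : r ≤ ⌊Real.logb (1 + J.ε) (J.k / (J.T₂ - J.P a))⌋₊) {o : Option (ℝ × Arr ℝ)}
    (h : IsBest J s o) :
    (tryBounds J s a r (J.T₂ - J.P a, o)).val.1 = (J.T₂ - J.P a) * (1 + J.ε) ^ r ∧
      IsBest J s (tryBounds J s a r (J.T₂ - J.P a, o)).val.2 :=
  loop_inv (fun i (y : ℝ × Option (ℝ × Arr ℝ)) =>
      y.1 = (J.T₂ - J.P a) * (1 + J.ε) ^ i ∧ IsBest J s y.2)
    ⟨by simp, h⟩ fun i hi _ hy => by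
      have := tryBounds_inv hJ hs ha hPa hk hr i hi hy
      exact ⟨this.1, this.2.2.2⟩

theorem IsBest.tryJob {o : Option (ℝ × Arr ℝ)} (h : IsBest J s o) :
    IsBest J s (tryJob J s a o).val := by
  rw [tryJob_val hs ha]
  split_ifs with hk
  · exact (isBest_tryBounds hJ hs ha hPa hk le_rfl h).2.tryBound hJ hs ha hPa hk le_rfl
  · exact h

omit hJ hPa in
theorem FoundLe.tryJob {B : ℝ} {o : Option (ℝ × Arr ℝ)} (h : FoundLe B o) :
    FoundLe B (tryJob J s a o).val := by
  rw [tryJob_val hs ha]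
  split_ifs with hk
  · exact (loop_inv (fun _ (y : ℝ × Option (ℝ × Arr ℝ)) => FoundLe B y.2) h
      fun i _ y hy => hy.tryBound J s a _).tryBound J s a _
  · exact h

/-- The bounds tried for job `a` are so dense that one of them exceeds a given number
`D ≥ Δ_a` by a factor of at most `1 + ε`. -/
theorem foundLe_tryJob {D : ℝ} (hD : J.T₂ - J.P a ≤ D) (hDk : D ≤ J.k) {E : Finset ℕ} {z : ℝ}
    (hE : ∀ K, D ≤ K → IsTarget J K a E ∧ targetZ J K E J.n ≤ z) {o : Option (ℝ × Arr ℝ)}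
    (ho : IsBest J s o) : FoundLe ((1 + J.ε) * (J.μ * D + z)) (tryJob J s a o).val := by
  have hε := hJ.ε_pos
  have hk := hD.trans hDk
  have hΔ : 0 < J.T₂ - J.P a := by have := hJ.T_lt; linarith
  have found : ∀ (K : ℝ) o, D ≤ K → K ≤ (1 + J.ε) * D →
      FoundLe ((1 + J.ε) * (J.μ * D + z)) (tryBound J s a K o).val := by
    intro K o h1 h2
    obtain ⟨x, hx, hle⟩ := foundLe_tryBound hJ hs hPa (hD.trans h1) (hE K h1).1 o
    refine ⟨x, hx, hle.trans ?_⟩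
    have h3 := mul_le_mul_of_nonneg_left h2 hJ.μ_nonneg
    have h4 := mul_le_mul_of_nonneg_left (hE K h1).2 (show 0 ≤ 1 + J.ε by linarith)
    linarith
  rw [tryJob_val hs ha, if_pos hk]
  set r := ⌊Real.logb (1 + J.ε) (J.k / (J.T₂ - J.P a))⌋₊ with hr
  by_cases hex : ∃ i, i < r ∧ D ≤ (J.T₂ - J.P a) * (1 + J.ε) ^ (i + 1)
  · obtain ⟨hi, hDi⟩ := Nat.find_spec hex
    have hmin : (J.T₂ - J.P a) * (1 + J.ε) ^ Nat.find hex ≤ D := by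
      rcases hf : Nat.find hex with _ | i
      · simpa using hD
      · have := Nat.find_min hex (m := i) (by omega)
        by_contra h
        exact this ⟨by omega, (not_le.1 h).le⟩
    generalize Nat.find hex = i at hi hDi hmin
    refine FoundLe.tryBound (loop_reach
      (fun i (y : ℝ × Option (ℝ × Arr ℝ)) => y.1 = (J.T₂ - J.P a) * (1 + J.ε) ^ i ∧ IsBest J s y.2)
      (fun (y : ℝ × Option (ℝ × Arr ℝ)) => FoundLe ((1 + J.ε) * (J.μ * D + z)) y.2)
      ⟨by simp, ho⟩ (fun i hi y hy => ?_)
      (fun i _ y _ hy => hy.tryBound J s a _) hi fun y hy => ?_) J s a _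
    · have := tryBounds_inv hJ hs ha hPa hk hr.le i hi hy
      exact ⟨this.1, this.2.2.2⟩
    · have h1 := (tryBounds_inv hJ hs ha hPa hk hr.le i hi hy).1
      refine found (y.1 * (1 + J.ε)) y.2 ?_ ?_
      · rw [h1]
        exact hDi
      · rw [hy.1, mul_comm (1 + J.ε)]
        exact mul_le_mul_of_nonneg_right hmin (by linarith)
  · refine found _ _ hDk ?_
    have hlast : (J.T₂ - J.P a) * (1 + J.ε) ^ r ≤ D := by
      rcases hr' : r with _ | i
      · simpa using hD
      · by_contra h
        exact hex ⟨i, by omega, (not_le.1 h).le⟩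
    have h1 := lt_pow_floor_logb (b := 1 + J.ε) (by linarith) ((one_le_div hΔ).2 hk)
    rw [← hr, div_lt_iff₀ hΔ, pow_succ] at h1
    nlinarith

end

section

variable {J : Input ℝ} (hJ : J.Good)
include hJ

theorem isBest_loop : IsBest J (preprocess J).val
    (loop (tryJob J (preprocess J).val) ((countEarly J (preprocess J).val 0).val + 1)
      none).val := by
  have hs := isSums_preprocess hJ.n_pos
  refine loop_inv (fun _ => IsBest J (preprocess J).val) (fun x h => by cases h) fun a ha o ho => ?_
  obtain ⟨h1, h2⟩ := (lt_countEarly_succ_iff hJ hs).1 ha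
  exact ho.tryJob hJ hs h1 h2

theorem foundLe_loop {D : ℝ} (hDk : D ≤ J.k) {a : ℕ} (ha : a < J.n) (hPa : J.P a ≤ J.T₁)
    (hD : J.T₂ - J.P a ≤ D) {E : Finset ℕ} {z : ℝ}
    (hE : ∀ K, D ≤ K → IsTarget J K a E ∧ targetZ J K E J.n ≤ z) :
    FoundLe ((1 + J.ε) * (J.μ * D + z)) (loop (tryJob J (preprocess J).val)
      ((countEarly J (preprocess J).val 0).val + 1) none).val := by
  have hs := isSums_preprocess hJ.n_pos
  refine loop_reach (fun _ => IsBest J (preprocess J).val) _ (fun x h => by cases h)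
    (fun a ha o ho => ?_) (fun a ha o _ ho => ?_)
    ((lt_countEarly_succ_iff hJ hs).2 ⟨ha, hPa⟩)
    fun o ho => foundLe_tryJob hJ hs ha hPa hD hDk hE ho
  · obtain ⟨h1, h2⟩ := (lt_countEarly_succ_iff hJ hs).1 ha
    exact ho.tryJob hJ hs h1 h2
  · exact ho.tryJob hs ((lt_countEarly_succ_iff hJ hs).1 ha).1

/-- If `Δ_a ≤ k` for some job `a` that starts by `T₁` in `π*`, then `Approx^μ(ε)` finds a feasible
schedule that is optimal up to a factor of `1 + ε`. -/
theorem approxMu_spec {a : ℕ} (ha : a < J.n) (hPa : J.P a ≤ J.T₁) (hk : J.T₂ - J.P a ≤ J.k) :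
    ∃ S, (approxMu J).val = some S ∧ IsSchedule J J.k S ∧
      ∀ (D : ℝ) (σ : ℕ → ℝ), D ≤ J.k → IsSchedule J D σ →
        (value J (preprocess J).val S).val ≤
          (1 + J.ε) * (J.μ * D + ∑ i ∈ Finset.range J.n, J.w i * (σ i + J.p i)) := by
  have hE : ∀ K, IsTarget J K a (Finset.range a) ↔ ∀ i < a, J.P (i + 1) - K ≤ J.T₁ := by
    have hlen : ∀ j, a ≤ j → earlyLen J (Finset.range a) j = J.P a := by
      intro j hj
      induction j, hj using Nat.le_induction with
      | base => exact earlyLen_eq_P fun i hi => Finset.mem_range.2 hi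
      | succ j hj ih =>
        rw [earlyLen_succ_of_not_mem (by simpa using hj), ih]
    intro K
    refine ⟨fun h i hi => h.near i (Finset.mem_range.2 hi) (hi.trans ha), fun h =>
      ⟨ha, fun i hi => Finset.mem_range.2 hi, by simp, (hlen _ ha.le).trans_le hPa,
        fun i hi _ => h i (Finset.mem_range.1 hi)⟩⟩
  have hk0 : 0 ≤ J.k := by have := hJ.T_lt; linarith
  obtain ⟨⟨v, S⟩, hx, -⟩ := foundLe_loop hJ (D := J.k) le_rfl ha hPa hk (E := Finset.range a)
    (z := targetZ J 0 (Finset.range a) J.n) fun K hK => by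
      refine ⟨(hE K).2 fun i hi => ?_, Finset.sum_le_sum fun i hi => ?_⟩
      · have := hJ.P_mono (Nat.succ_le_of_lt hi) ha.le
        simp only [Nat.succ_eq_add_one] at this
        linarith
      · refine mul_le_mul_of_nonneg_left ?_ (hJ.w_pos (Finset.mem_range.1 hi)).le
        unfold targetC
        split_ifs
        · exact max_le_max le_rfl (by linarith)
        · exact le_rfl
  obtain ⟨hS, hv⟩ := isBest_loop hJ _ hx
  refine ⟨S, by rw [approxMu_val, hx]; rfl, hS, fun D σ hD hσ => ?_⟩
  obtain ⟨a', E, hPa', hD', hE'⟩ := hσ.exists_target hJ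
  obtain ⟨x, hx', hle⟩ := foundLe_loop hJ hD (hE' D le_rfl).1.lt_n hPa' hD' hE'
  rw [hx] at hx'
  cases hx'
  exact hv ▸ hle

end

end Prog

/-! ### Running time -/

namespace Prog

open Timed

/-- Logarithms to the base `1 + x` exceed binary ones by a factor of at most `1 / x`, since
`2 ^ x ≤ 1 + x` by Bernoulli's inequality. -/
theorem logb_one_add_le {x U : ℝ} (hx : 0 < x) (hx1 : x ≤ 1) (hU : 1 ≤ U) :
    Real.logb (1 + x) U ≤ Real.logb 2 U / x := by
  have h2 : x * Real.log 2 ≤ Real.log (1 + x) := by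
    rw [← Real.log_rpow two_pos]
    refine Real.log_le_log (Real.rpow_pos_of_pos two_pos x) ?_
    have := rpow_one_add_le_one_add_mul_self (s := 1) (by norm_num) hx.le hx1
    norm_num at this
    exact this
  have h3 : 0 < Real.log 2 := Real.log_pos one_lt_two
  rw [Real.logb, Real.logb, div_div, mul_comm (Real.log 2)]
  exact div_le_div_of_nonneg_left (Real.log_nonneg hU) (by positivity) h2

/-- `max 1 (log₂ x)`. -/
noncomputable def lg (x : ℝ) : ℝ := max 1 (Real.logb 2 x)

theorem one_le_lg (x : ℝ) : 1 ≤ lg x := le_max_left _ _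

theorem logb_le_lg (x : ℝ) : Real.logb 2 x ≤ lg x := le_max_right _ _

theorem lg_le_two_mul {U Q : ℝ} (hU : 0 < U) (hUQ : U ≤ Q ^ 2) : lg U ≤ 2 * lg Q := by
  refine max_le (by linarith [one_le_lg Q]) ?_
  have h := Real.logb_le_logb_of_le one_lt_two hU hUQ
  rw [Real.logb_pow] at h
  have := logb_le_lg Q
  push_cast at h
  linarith

section

variable {J : Input ℝ} (hJ : J.Good)
include hJ

theorem Input.Good.one_le_div : 1 ≤ (J.n : ℝ) / J.ε := by
  rw [_root_.one_le_div hJ.ε_pos]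
  have : (1 : ℝ) ≤ J.n := by exact_mod_cast hJ.n_pos
  linarith [hJ.ε_le]

theorem cells_le {L U : ℝ} (hL : 1 ≤ L) (hLU : L ≤ U) :
    ((cells J.δ L U).val : ℝ) ≤ 4 * (J.n / J.ε) * lg U := by
  have hn : (1 : ℝ) ≤ J.n := by exact_mod_cast hJ.n_pos
  have hε := hJ.ε_pos
  have hε1 := hJ.ε_le
  have hUL : 1 ≤ U / L := (one_le_div (by linarith)).2 hLU
  have h1 : Real.logb J.δ (U / L) ≤ Real.logb 2 (U / L) / (J.ε / (2 * J.n)) :=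
    logb_one_add_le (by positivity) ((div_le_one (by positivity)).2 (by linarith)) hUL
  have h2 : Real.logb 2 (U / L) ≤ lg U :=
    (Real.logb_le_logb_of_le one_lt_two (by linarith)
      (div_le_self (by linarith) hL)).trans (logb_le_lg U)
  have h3 : Real.logb 2 (U / L) / (J.ε / (2 * J.n)) ≤ 2 * (J.n / J.ε) * lg U := by
    calc _ ≤ lg U / (J.ε / (2 * J.n)) := by gcongr
      _ = _ := by field_simp
  have h4 := hJ.one_le_div
  have h5 := one_le_lg U
  have h6 : (⌊Real.logb J.δ (U / L)⌋₊ : ℝ) ≤ Real.logb J.δ (U / L) :=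
    Nat.floor_le (Real.logb_nonneg hJ.one_lt_δ hUL)
  rw [cells_val]
  push_cast
  nlinarith

variable {s : Sums ℝ} (hs : IsSums J s) {a : ℕ} (ha : a < J.n) {Q : ℝ}
  (hQ : J.Z J.n + J.W J.n * J.T₂ ≤ Q ^ 2)
include hs ha hQ

/-- The number of boxes. -/
theorem boxes_le : ((gridOf J s a).m₁ * (gridOf J s a).m₂ * (gridOf J s a).m₃ : ℕ) ≤
    128 * ((J.n / J.ε) ^ 3 * lg J.T₁ * lg (J.T₂ + J.P J.n) * lg Q) := by
  have hTT := hJ.T_lt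
  have hT := hJ.one_le_T₁
  have hp1 := hs.one_le_pmin hJ
  have hL₂ := hJ.L₂_pos ha
  have hL₃ := hJ.one_lt_L₃ ha
  have hδ := hs.δ_eq
  have hpP : J.p a ≤ J.P J.n :=
    Finset.single_le_sum (f := J.p) (fun i hi => (hJ.p_pos (Finset.mem_range.1 hi)).le)
      (Finset.mem_range.2 ha)
  have hZ : J.Z a + J.w a * (J.T₂ + J.p a) ≤ J.Z J.n + J.W J.n * J.T₂ := by
    have h1 : J.Z (a + 1) ≤ J.Z J.n :=
      Finset.sum_le_sum_of_subset_of_nonneg (Finset.range_mono ha) fun i hi _ => by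
        have hi := Finset.mem_range.1 hi
        exact mul_nonneg (hJ.w_pos hi).le (hJ.P_nonneg hi)
    have h2 : J.w a ≤ J.W J.n :=
      Finset.single_le_sum (f := J.w) (fun i hi => (hJ.w_pos (Finset.mem_range.1 hi)).le)
        (Finset.mem_range.2 ha)
    have h3 := hJ.P_nonneg ha.le
    have h4 := hJ.w_pos ha
    rw [J.Z_succ, J.P_succ] at h1
    have h5 := mul_le_mul_of_nonneg_right h2 (show 0 ≤ J.T₂ by linarith)
    nlinarith
  obtain ⟨i, hi, hpi⟩ := hJ.pmin_le
  have m1 : ((gridOf J s a).m₁ : ℝ) ≤ 4 * (J.n / J.ε) * lg J.T₁ := by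
    simp only [gridOf, hδ]
    exact cells_le hJ hp1 ((hs.pmin_le i hi).trans hpi)
  have m2 : ((gridOf J s a).m₂ : ℝ) ≤ 4 * (J.n / J.ε) * lg (J.T₂ + J.P J.n) := by
    simp only [gridOf, hδ]
    exact cells_le hJ hL₂.le (by linarith)
  have m3 : ((gridOf J s a).m₃ : ℝ) ≤ 4 * (J.n / J.ε) * (2 * lg Q) := by
    simp only [gridOf, hδ]
    refine (cells_le hJ hL₃.le hZ).trans ?_
    have := hJ.one_le_div
    exact mul_le_mul_of_nonneg_left (lg_le_two_mul (by linarith) hQ) (by linarith)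
  have hnε := hJ.one_le_div
  have l1 := one_le_lg J.T₁
  have l2 := one_le_lg (J.T₂ + J.P J.n)
  push_cast
  calc _ ≤ 4 * (J.n / J.ε) * lg J.T₁ * (4 * (J.n / J.ε) * lg (J.T₂ + J.P J.n)) *
        (4 * (J.n / J.ε) * (2 * lg Q)) := by gcongr
    _ = _ := by ring

variable (hPa : J.P a ≤ J.T₁)
include hPa

omit hQ in
theorem tryBound_time_le {K : ℝ} (hK : J.T₂ - J.P a ≤ K) (o : Option (ℝ × Arr ℝ)) :
    (tryBound J s a K o).time ≤
      230 * J.n * ((gridOf J s a).m₁ * (gridOf J s a).m₂ * (gridOf J s a).m₃) := by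
  have hM : 0 < (gridOf J s a).m₁ * (gridOf J s a).m₂ * (gridOf J s a).m₃ :=
    Nat.mul_pos (Nat.mul_pos (Nat.succ_pos _) (Nat.succ_pos _)) (Nat.succ_pos _)
  have ht := approx_time_le hJ hs ha K
  have hn := hJ.n_pos
  generalize (gridOf J s a).m₁ * (gridOf J s a).m₂ * (gridOf J s a).m₃ = M at hM ht ⊢
  have hnM : J.n ≤ J.n * M := Nat.le_mul_of_pos_right _ hM
  rw [mul_assoc] at ht ⊢
  rw [tryBound, time_bind]
  cases hq : (approx J s a K).val with
  | none => simp only [time_pure]; omega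
  | some q =>
    have hf := isFull_of_approx hJ hs hK ha hPa hq
    have he := expand_time J q.plan
    have hv := value_time_le J s (expand J q.plan).val.2
    have hl := hf.length_le
    rw [hf.jobs] at he
    rcases o with _ | ⟨v', S'⟩
    · simp only [time_bind, time_op]
      omega
    · simp only [time_bind, lt_eq, time_op, val_op, time_ite, time_pure]
      split_ifs <;> omega

theorem tryJob_time_le (hT : J.T₁ + 1 ≤ J.T₂) {o : Option (ℝ × Arr ℝ)} (ho : IsBest J s o) :
    ((tryJob J s a o).time : ℝ) ≤ 140000 * (J.n * (J.n / J.ε) ^ 3 * lg J.T₁ *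
      lg (J.T₂ + J.P J.n) * lg Q * (lg J.k / J.ε)) := by
  have hε := hJ.ε_pos
  have hε1 := hJ.ε_le
  have hn : (1 : ℝ) ≤ J.n := by exact_mod_cast hJ.n_pos
  set C : ℝ := (J.n / J.ε) ^ 3 * lg J.T₁ * lg (J.T₂ + J.P J.n) * lg Q with hC
  have hC1 : 1 ≤ C := one_le_mul_of_one_le_of_one_le (one_le_mul_of_one_le_of_one_le
    (one_le_mul_of_one_le_of_one_le (one_le_pow₀ hJ.one_le_div) (one_le_lg _)) (one_le_lg _))
    (one_le_lg _)
  have hb := boxes_le hJ hs ha hQ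
  rw [← hC] at hb
  have htry := fun {K : ℝ} (hK : J.T₂ - J.P a ≤ K) o => tryBound_time_le hJ hs ha hPa hK o
  generalize (gridOf J s a).m₁ * (gridOf J s a).m₂ * (gridOf J s a).m₃ = M at hb htry
  have hk1 : 1 ≤ lg J.k / J.ε := by
    rw [one_le_div hε]
    linarith [one_le_lg J.k]
  have hkey : (tryJob J s a o).time ≤ (⌊lg J.k / J.ε⌋₊ + 1) * (230 * J.n * M + 6) := by
    rw [tryJob]
    simp only [get_eq, sub_eq, le_eq, div_eq, floorLog_eq, time_bind, val_op, time_op, time_ite,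
      time_pure, decide_eq_true_eq, hs.P_eq a ha.le]
    split_ifs with hk
    · have hΔ : 1 ≤ J.T₂ - J.P a := by linarith
      have hr : ⌊Real.logb (1 + J.ε) (J.k / (J.T₂ - J.P a))⌋₊ ≤ ⌊lg J.k / J.ε⌋₊ := by
        refine Nat.floor_mono ?_
        refine (logb_one_add_le hε hε1 ((one_le_div (by linarith)).2 hk)).trans ?_
        refine div_le_div_of_nonneg_right ?_ hε.le
        refine (Real.logb_le_logb_of_le one_lt_two (div_pos (by linarith) (by linarith))
          (div_le_self (by linarith) hΔ)).trans (logb_le_lg _)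
      have hl := loop_time_le_of_inv (body := fun _ (y : ℝ × Option (ℝ × Arr ℝ)) => do
          let K ← mul y.1 (1 + J.ε)
          let b ← tryBound J s a K y.2
          pure (K, b)) (m := ⌊Real.logb (1 + J.ε) (J.k / (J.T₂ - J.P a))⌋₊)
        (x := (J.T₂ - J.P a, o))
        (fun i y => y.1 = (J.T₂ - J.P a) * (1 + J.ε) ^ i ∧ IsBest J s y.2)
        (230 * J.n * M + 1) ⟨by simp, ho⟩ fun i hi y hy => by
          have h := tryBounds_inv hJ hs ha hPa hk le_rfl i hi hy
          refine ⟨⟨h.1, h.2.2.2⟩, ?_⟩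
          have := htry h.2.1 y.2
          simp only [mul_eq, time_bind, time_op, val_op, time_pure]
          omega
      have hl' := hl.trans (Nat.mul_le_mul hr
        (show 230 * J.n * M + 1 + 1 ≤ 230 * J.n * M + 6 by omega))
      have h2 := fun o' => htry hk o'
      refine (Nat.add_le_add_left (Nat.add_le_add_left (Nat.add_le_add_left
        (Nat.add_le_add_left (Nat.add_le_add_left (Nat.add_le_add hl' (h2 _)) _) _) _) _) _).trans
        ?_
      rw [Nat.add_mul ⌊lg J.k / J.ε⌋₊ 1, Nat.one_mul]
      omega
    · rw [Nat.add_mul ⌊lg J.k / J.ε⌋₊ 1, Nat.one_mul]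
      omega
  -- the coefficients add up to `2 * (230 * 128 + 6)`
  have hcast : ((tryJob J s a o).time : ℝ) ≤ (⌊lg J.k / J.ε⌋₊ + 1) * (230 * J.n * M + 6) := by
    exact_mod_cast hkey
  have hfl : (⌊lg J.k / J.ε⌋₊ : ℝ) ≤ lg J.k / J.ε := Nat.floor_le (by linarith)
  calc ((tryJob J s a o).time : ℝ) ≤ _ := hcast
    _ ≤ (lg J.k / J.ε + lg J.k / J.ε) * (230 * J.n * (128 * C) + 6 * (J.n * C)) := by
      gcongr
      have := one_le_mul_of_one_le_of_one_le hn hC1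
      linarith
    _ ≤ 140000 * (J.n * C * (lg J.k / J.ε)) := by
      have : 0 ≤ J.n * C * (lg J.k / J.ε) := by positivity
      linarith
    _ = _ := by rw [hC]; ring

omit hs ha hPa in
theorem approxMu_time_le (hT : J.T₁ + 1 ≤ J.T₂) :
    ((approxMu J).time : ℝ) ≤ 150000 * ((J.n : ℝ) ^ 5 / J.ε ^ 4 * lg J.T₁ *
      lg (J.T₂ + J.P J.n) * lg Q * lg J.k) := by
  have hs := isSums_preprocess hJ.n_pos
  have hε := hJ.ε_pos
  have hn : (1 : ℝ) ≤ J.n := by exact_mod_cast hJ.n_pos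
  set B : ℝ := J.n * (J.n / J.ε) ^ 3 * lg J.T₁ * lg (J.T₂ + J.P J.n) * lg Q * (lg J.k / J.ε)
    with hB
  have hB1 : 1 ≤ B := by
    have hk1 : 1 ≤ lg J.k / J.ε := by
      rw [one_le_div hε]
      linarith [one_le_lg J.k, hJ.ε_le]
    exact one_le_mul_of_one_le_of_one_le (one_le_mul_of_one_le_of_one_le
      (one_le_mul_of_one_le_of_one_le (one_le_mul_of_one_le_of_one_le
      (one_le_mul_of_one_le_of_one_le hn (one_le_pow₀ hJ.one_le_div)) (one_le_lg _)) (one_le_lg _))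
      (one_le_lg _)) hk1
  have hl := loop_time_le_of_inv (body := tryJob J (preprocess J).val)
    (m := (countEarly J (preprocess J).val 0).val + 1) (x := none)
    (fun _ => IsBest J (preprocess J).val) ⌊140000 * B⌋₊ (fun x h => by cases h)
    fun a ha o ho => by
      obtain ⟨h1, h2⟩ := (lt_countEarly_succ_iff hJ hs).1 ha
      exact ⟨ho.tryJob hJ hs h1 h2, Nat.le_floor (tryJob_time_le hJ hs h1 hQ h2 hT ho)⟩
  have hc : (countEarly J (preprocess J).val 0).val + 1 ≤ J.n :=
    ((lt_countEarly_succ_iff hJ hs).1 (Nat.lt_succ_self _)).1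
  have hl' := hl.trans (Nat.mul_le_mul_right _ hc)
  have hp := preprocess_time_le J
  have he := countEarly_time_le J (preprocess J).val 0
  have hnat : (approxMu J).time ≤ 23 * J.n + 15 + J.n * (⌊140000 * B⌋₊ + 1) := by
    simp only [approxMu, lit_eq, add_eq, time_bind, val_op, time_op, Nat.cast_zero, Nat.cast_one]
    have hsum : ∀ {x y z x' y' z' : ℕ}, x ≤ x' → y ≤ y' → z ≤ z' →
        x + (1 + (1 + (1 + (y + (1 + (z + 0)))))) ≤ x' + y' + z' + 4 := by
      intros; omega
    split
    · refine (hsum hp he hl').trans ?_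
      omega
    · refine (hsum hp he hl').trans ?_
      omega
  have hfl : (⌊140000 * B⌋₊ : ℝ) ≤ 140000 * B := Nat.floor_le (by linarith)
  calc ((approxMu J).time : ℝ) ≤ 23 * J.n + 15 + J.n * (⌊140000 * B⌋₊ + 1) := by
        exact_mod_cast hnat
    _ ≤ 23 * (J.n * B) + 15 * (J.n * B) + J.n * (140000 * B + B) := by
      have h1 : (J.n : ℝ) ≤ J.n * B := le_mul_of_one_le_right (by linarith) hB1
      have h2 : 1 ≤ J.n * B := hn.trans h1
      gcongr
      linarith
    _ ≤ 150000 * (J.n * B) := by nlinarith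
    _ = _ := by rw [hB]; field_simp

end

end Prog

/-! ### From the rescheduling problem to the input of the algorithm -/

namespace Resched

open Prog

variable (I : Resched) (ε : ℝ)

@[simp] theorem toInput_n : (I.toInput ε).n = I.n := rfl
@[simp] theorem toInput_T₁ : (I.toInput ε).T₁ = I.T₁ := rfl
@[simp] theorem toInput_T₂ : (I.toInput ε).T₂ = I.T₂ := rfl
@[simp] theorem toInput_μ : (I.toInput ε).μ = I.μ := rfl
@[simp] theorem toInput_ε : (I.toInput ε).ε = ε := rfl

theorem toInput_p_of_lt {i : ℕ} (hi : i < I.n) : (I.toInput ε).p i = I.p ⟨i, hi⟩ := dif_pos hi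

theorem toInput_w_of_lt {i : ℕ} (hi : i < I.n) : (I.toInput ε).w i = I.w ⟨i, hi⟩ := dif_pos hi

@[simp] theorem toInput_p (j : Fin I.n) : (I.toInput ε).p j = I.p j := I.toInput_p_of_lt ε j.2

@[simp] theorem toInput_w (j : Fin I.n) : (I.toInput ε).w j = I.w j := I.toInput_w_of_lt ε j.2

theorem toInput_P (j : Fin I.n) : (I.toInput ε).P j = I.origS j := by
  have h : (Finset.range I.n).filter (fun i => i < (j : ℕ)) = Finset.range j := by
    ext i
    simp only [Finset.mem_filter, Finset.mem_range]
    have := j.2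
    omega
  rw [Input.P, origS, ← h, Finset.sum_filter, Finset.sum_range, Finset.sum_filter]
  push_cast
  exact Finset.sum_congr rfl fun i _ => by simp

theorem origC_eq (j : Fin I.n) : I.origC j = I.origS j + I.p j := by
  have h : Finset.univ.filter (fun i => i ≤ j) =
      insert j (Finset.univ.filter fun i => i < j) := by
    ext i
    simp [le_iff_eq_or_lt]
  rw [origC, origS, h, Finset.sum_insert (by simp), add_comm]

theorem toInput_P_n : (I.toInput ε).P I.n = I.totalP := by
  rw [Input.P, totalP, Finset.sum_range]
  simp

theorem toInput_W_n : (I.toInput ε).W I.n = I.totalW := by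
  rw [Input.W, totalW, Finset.sum_range]
  simp

variable {I ε}

theorem Valid.good (hI : I.Valid) (hε : 0 < ε) (hε1 : ε ≤ 1) : (I.toInput ε).Good where
  one_le_p i hi := by
    rw [I.toInput_p_of_lt ε hi]
    exact_mod_cast hI.p_pos _
  one_le_w i hi := by
    rw [I.toInput_w_of_lt ε hi]
    exact_mod_cast hI.w_pos _
  wspt i j hij hj := by
    have hi : i < I.n := hij.trans_lt hj
    rw [I.toInput_p_of_lt ε hi, I.toInput_p_of_lt ε hj, I.toInput_w_of_lt ε hi,
      I.toInput_w_of_lt ε hj]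
    have h := hI.wspt ⟨i, hi⟩ ⟨j, hj⟩ hij
    rw [div_le_div_iff₀ (by exact_mod_cast hI.w_pos _) (by exact_mod_cast hI.w_pos _)] at h
    exact_mod_cast h
  T_lt := by simpa using hI.T_lt
  pmin_le := by
    obtain ⟨j, hj⟩ := hI.pmin_le
    exact ⟨j, j.2, by simpa using hj⟩
  T₁_lt := by
    rw [toInput_n, toInput_P_n, toInput_T₁]
    exact_mod_cast hI.T₁_lt
  ε_pos := hε
  ε_le := hε1
  μ_nonneg := hI.μ_nonneg

/-- The first job completed after `T₁` in `π*` starts by `T₁` there, and it can be the first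
late job. -/
theorem Valid.exists_late (hI : I.Valid) (ε : ℝ) :
    ∃ a < I.n, (I.toInput ε).P a ≤ I.T₁ ∧ I.T₂ - (I.toInput ε).P a ≤ I.k := by
  classical
  have hne : ({j | I.T₁ < I.origC j} : Set (Fin I.n)).Nonempty := by
    have hn : 0 < I.n := by
      obtain ⟨j, -⟩ := hI.pmin_le
      exact j.pos
    refine ⟨⟨I.n - 1, by omega⟩, ?_⟩
    have h : I.origC ⟨I.n - 1, by omega⟩ = I.totalP := by
      rw [origC, totalP, Finset.filter_true_of_mem]
      intro i _
      have := i.2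
      exact Fin.mk_le_mk.2 (by omega)
    change I.T₁ < _
    rw [h]
    exact hI.T₁_lt
  obtain ⟨j, hj⟩ : ∃ j, IsLeast {j | I.T₁ < I.origC j} j := by
    obtain ⟨j, hj, hmin⟩ := Set.exists_min_image _ id (Set.toFinite _) hne
    exact ⟨j, hj, fun i hi => hmin i hi⟩
  refine ⟨j, j.2, ?_, ?_⟩
  · rcases Nat.eq_zero_or_pos (j : ℕ) with h0 | h0
    · rw [h0]
      simp
    · obtain ⟨i, hi⟩ := Nat.exists_eq_succ_of_ne_zero h0.ne'
      have hin : i < I.n := by have := j.2; omega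
      have hnot : I.origC ⟨i, hin⟩ ≤ I.T₁ := by
        by_contra h
        have := Fin.le_def.1 (hj.2 (not_le.1 h))
        simp only at this
        omega
      have hP := (I.toInput ε).P_succ i
      have h1 := I.toInput_P ε ⟨i, hin⟩
      rw [hi, Nat.succ_eq_add_one, hP]
      simp only at h1
      rw [h1, I.toInput_p_of_lt ε hin]
      rw [origC_eq] at hnot
      exact_mod_cast hnot
  · have h := hI.k_ge j hj
    rw [toInput_P, sub_le_iff_le_add]
    have : (I.T₂ : ℝ) ≤ I.origS j + I.k := by exact_mod_cast h
    linarith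

theorem dev_eq (I : Resched) (ε : ℝ) (σ : Fin I.n → ℝ) (j : Fin I.n) :
    I.dev σ j = |σ j - (I.toInput ε).P j| := by
  rw [dev, compl, origC_eq, toInput_P]
  push_cast
  congr 1
  ring

theorem dev_le_devMax (I : Resched) (σ : Fin I.n → ℝ) (j : Fin I.n) : I.dev σ j ≤ I.devMax σ :=
  le_ciSup (f := fun j => I.dev σ j) (Set.finite_range _).bddAbove j

theorem Feasible.isSchedule {τ : Fin I.n → ℝ} (h : I.Feasible τ) (ε : ℝ) :
    IsSchedule (I.toInput ε) (I.devMax τ) (fun i => if hi : i < I.n then τ ⟨i, hi⟩ else 0) where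
  start_nonneg i hi := by
    rw [toInput_n] at hi
    rw [dif_pos hi]
    exact h.start_nonneg _
  disjoint i hi i' hi' hne := by
    rw [toInput_n] at hi hi'
    rw [dif_pos hi, dif_pos hi', I.toInput_p_of_lt ε hi, I.toInput_p_of_lt ε hi']
    exact h.disjoint _ _ fun he => hne (Fin.mk.inj_iff.1 he)
  avoids i hi := by
    rw [toInput_n] at hi
    rw [dif_pos hi, I.toInput_p_of_lt ε hi]
    exact h.avoids _
  dev_le i hi := by
    rw [toInput_n] at hi
    rw [dif_pos hi]
    have := I.dev_le_devMax τ ⟨i, hi⟩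
    rwa [I.dev_eq ε] at this

end Resched

namespace Prog

theorem IsSchedule.feasible {I : Resched} {ε : ℝ} (hn : 0 < I.n) {S : ℕ → ℝ}
    (h : IsSchedule (I.toInput ε) I.k S) : I.Feasible (fun j => S j) where
  start_nonneg j := h.start_nonneg j j.2
  disjoint i j hij := by
    have := h.disjoint i i.2 j j.2 (Fin.val_injective.ne hij)
    simpa [Resched.compl] using this
  avoids j := by
    have := h.avoids j j.2
    simpa [Resched.compl] using this
  devMax_le := by
    have : Nonempty (Fin I.n) := ⟨⟨0, hn⟩⟩
    refine ciSup_le fun j => ?_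
    rw [I.dev_eq ε]
    exact h.dev_le j j.2

theorem objective_le_value {I : Resched} {ε : ℝ} (hI : I.Valid) (hn : 0 < I.n) {s : Sums ℝ}
    (hs : IsSums (I.toInput ε) s) (S : ℕ → ℝ) :
    I.objective (fun j => S j) ≤ (value (I.toInput ε) s S).val := by
  have : Nonempty (Fin I.n) := ⟨⟨0, hn⟩⟩
  obtain ⟨D, hD, -, hle, -⟩ := value_spec hs S
  rw [hD, Resched.objective]
  refine add_le_add (mul_le_mul_of_nonneg_left (ciSup_le fun j => ?_) hI.μ_nonneg) (le_of_eq ?_)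
  · rw [I.dev_eq ε]
    exact hle j j.2
  · rw [Resched.toInput_n, Finset.sum_range]
    simp [Resched.compl]

end Prog

namespace Resched

open Prog

/-- The weighted completion times are bounded by the square of the argument of the third logarithm
of the running time, because there are at most `P` jobs. -/
theorem Valid.cost_le {I : Resched} (hI : I.Valid) {ε : ℝ} (hε : 0 < ε) (hε1 : ε ≤ 1) :
    (I.toInput ε).Z I.n + (I.toInput ε).W I.n * I.T₂ ≤
      ((I.wMax * I.totalP + I.totalW * I.T₂ : ℕ) : ℝ) ^ 2 := by
  have hJ := hI.good hε hε1
  have hn : (I.n : ℝ) ≤ I.totalP := by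
    have : ∑ _j : Fin I.n, 1 ≤ I.totalP := Finset.sum_le_sum fun j _ => hI.p_pos j
    rw [Finset.sum_const, Finset.card_univ, Fintype.card_fin, smul_eq_mul, mul_one] at this
    exact_mod_cast this
  have hw1 : (1 : ℝ) ≤ I.wMax := by
    obtain ⟨j, -⟩ := hI.pmin_le
    exact_mod_cast (hI.w_pos j).trans_le (Finset.le_sup (f := I.w) (Finset.mem_univ j))
  have hZ : (I.toInput ε).Z I.n ≤ I.totalP * (I.wMax * I.totalP) := by
    have h1 : (I.toInput ε).Z I.n ≤ ∑ _i ∈ Finset.range I.n, (I.wMax * I.totalP : ℝ) := by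
      refine Finset.sum_le_sum fun i hi => ?_
      have hi := Finset.mem_range.1 hi
      have h2 := hJ.P_mono (show i + 1 ≤ I.n from hi) le_rfl
      have h3 := hJ.P_nonneg (show i + 1 ≤ I.n from hi)
      rw [I.toInput_P_n] at h2
      rw [I.toInput_w_of_lt ε hi]
      have h4 : (I.w ⟨i, hi⟩ : ℝ) ≤ I.wMax := by
        exact_mod_cast Finset.le_sup (f := I.w) (Finset.mem_univ _)
      exact mul_le_mul h4 h2 h3 (by linarith)
    rw [Finset.sum_const, Finset.card_range, nsmul_eq_mul] at h1
    exact h1.trans (mul_le_mul_of_nonneg_right hn (by positivity))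
  have hPP : (I.totalP : ℝ) * (I.wMax * I.totalP) ≤ (I.wMax * I.totalP : ℝ) ^ 2 := by
    rw [sq]
    refine mul_le_mul_of_nonneg_right ?_ (by positivity)
    exact le_mul_of_one_le_left (by positivity) hw1
  have hWT : (I.totalW * I.T₂ : ℝ) ≤ (I.totalW * I.T₂ : ℝ) ^ 2 := by
    exact_mod_cast Nat.le_self_pow two_ne_zero (I.totalW * I.T₂)
  rw [I.toInput_W_n]
  push_cast
  have h5 : (0 : ℝ) ≤ I.wMax * I.totalP := by positivity
  have h6 : (0 : ℝ) ≤ I.totalW * I.T₂ := by positivity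
  nlinarith

end Resched

theorem theorem4p4 :
    (∀ (I : Resched), I.Valid → ∀ (ε : ℝ), 0 < ε → ε ≤ 1 →
      ∃ S : Prog.Arr ℝ, (Prog.approxMu (I.toInput ε)).val = some S ∧
        I.Feasible (fun j => S j) ∧
        ∀ τ : Fin I.n → ℝ, I.Feasible τ →
          I.objective (fun j => S j) ≤ (1 + ε) * I.objective τ) ∧
    ∃ c : ℝ, 0 < c ∧ ∀ (I : Resched), I.Valid → ∀ (ε : ℝ), 0 < ε → ε ≤ 1 →
      ((Prog.approxMu (I.toInput ε)).time : ℝ) ≤ c * I.timeBound ε := by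
  refine ⟨fun I hI ε hε hε1 => ?_, 150000, by norm_num, fun I hI ε hε hε1 => ?_⟩
  · have hJ := hI.good hε hε1
    have hn : 0 < I.n := hJ.n_pos
    obtain ⟨a, ha, hPa, hk⟩ := hI.exists_late ε
    obtain ⟨S, hS, hfeas, hopt⟩ := Prog.approxMu_spec hJ ha hPa hk
    refine ⟨S, hS, hfeas.feasible hn, fun τ hτ => ?_⟩
    refine (Prog.objective_le_value hI hn (Prog.isSums_preprocess hn) S).trans
      ((hopt _ _ hτ.devMax_le (hτ.isSchedule ε)).trans_eq ?_)
    rw [Resched.objective, Resched.toInput_n, Finset.sum_range]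
    simp [Resched.compl]
  · have h := Prog.approxMu_time_le (hI.good hε hε1) (hI.cost_le hε hε1) 
      (show (I.T₁ : ℝ) + 1 ≤ I.T₂ by exact_mod_cast hI.T_lt)
    rw [Resched.toInput_n, I.toInput_P_n] at h
    rw [Resched.timeBound]
    have hl : Prog.lg ((I.toInput ε).T₂ + I.totalP) = Resched.logFactor (I.T₂ + I.totalP) := by
      rw [Prog.lg, Resched.logFactor, Nat.cast_add]
      rfl
    rw [hl] at h
    exact h
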